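/- Let $q_0>0$, $\sigma,t\in\mathbb R$, let $\mathbf q_\pm\in\mathbb C^2$ with $\|\mathbf q_\pm\|=q_0$, and let $\mathbf q(x,t)\in\mathbb C^2$ be a potential (for instance a solution of the coupled Lakshmanan--Porsezian--Daniel equation) with $\mathbf q(\cdot,t)-\mathbf q_-\in L^1(-\infty,a)$ and $\mathbf q(\cdot,t)-\mathbf q_+\in L^1(a,\infty)$ for every $a\in\mathbb R$. For $z\neq0$ put $k=\frac12(z-q_0^2/z)$, $\lambda=\frac12(z+q_0^2/z)$, $\Lambda_1=\operatorname{diag}(-\lambda,k,\lambda)$, $\mathbf v^\perp=(v_2,-v_1)^\dagger$, $$J=\operatorname{diag}(1,-1,-1),\quad Q=\begin{pmatrix}0&\mathbf q^\dagger\\-\mathbf q&0\end{pmatrix},\quad A=-ikJ+Q,\quad Y_\pm=\begin{pmatrix}1&0&-iq_0/z\\-i\mathbf q_\pm/z&\mathbf q_\pm^\perp/q_0&\mathbf q_\pm/q_0\end{pmatrix},$$ and let $A_\pm$ be $A$ with $\mathbf q$ replaced by $\mathbf q_\pm$. For real $z\ne0$ let $\nu_\pm$ be the solutions of $$\nu_\pm(x,t,z)=Y_\pm+\int_{\pm\infty}^xY_\pm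 e^{i(x-r)\Lambda_1}Y_\pm^{-1}\big(A(r,t)-A_\pm\big)\nu_\pm(r,t,z)e^{-i(x-r)\Lambda_1}\,dr,$$ let $\psi_\pm=\nu_\pm e^{i\Omega}$ be the Jost eigenfunctions, where $\Omega=\operatorname{diag}(\delta_1,\delta_2,\delta_3)$ with $\delta_{1}=-\lambda x+2(k^2+k\lambda-4k^3\lambda\sigma+2k\lambda\sigma q_0^2)t$, $\delta_2=kx+(8k^4\sigma-3\sigma q_0^4-q_0^2)t$, $\delta_{3}=\lambda x+2(k^2-k\lambda+4k^3\lambda\sigma-2k\lambda\sigma q_0^2)t$, and let $S=(s_{ij})$, $H=(h_{ij})$ be given by $\psi_-=\psi_+S(z)$, $H=S^{-1}$. Then the diagonal entries of $S$ and $H$ on $\mathbb R\setminus\{0\}$ have analytic continuations (continuous up to the real boundary points other than $0$) to the following domains: $s_{11}$ to $\{\operatorname{Im}z>0,|z|>q_0\}$, $s_{22}$ to $\{\operatorname{Im}z<0\}$, $s_{33}$ to $\{\operatorname{Im}z>0,|z|<q_0\}$, $h_{11}$ to $\{\operatorname{Im}z<0,|z|>q_0\}$, $h_{22}$ to $\{\operatorname{Im}z>0\}$,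 $h_{33}$ to $\{\operatorname{Im}z<0,|z|<q_0\}$. With each coefficient considered on the union of its domain and $\mathbb R\setminus\{0\}$, as $z\to\infty$, $$s_{11},h_{11}\to1,\qquad s_{22},h_{33}\to\frac{\mathbf q_-^\dagger\mathbf q_+}{q_0^2},\qquad s_{33},h_{22}\to\frac{\mathbf q_+^\dagger\mathbf q_-}{q_0^2},$$ and as $z\to0$, $$s_{33},h_{33}\to1,\qquad s_{22},h_{11}\to\frac{\mathbf q_-^\dagger\mathbf q_+}{q_0^2},\qquad s_{11},h_{22}\to\frac{\mathbf q_+^\dagger\mathbf q_-}{q_0^2}.$$ If moreover $\mathbf q(\cdot,t)$ is differentiable with $\mathbf q_x(\cdot,t)\in L^1(\mathbb R)$, then all these limits are attained with error $O(1/z)$ as $z\to\infty$ and $O(z)$ as $z\to0$. -/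

import Mathlib

open Filter Topology MeasureTheory Asymptotics
open scoped ComplexConjugate

noncomputable section

namespace LPD

/-- Column vectors with two complex components, with the Euclidean (Hermitian) norm. -/
abbrev C2 := EuclideanSpace ℂ (Fin 2)

/-- Complex 3 × 3 matrices. -/
abbrev Mat3 := Matrix (Fin 3) (Fin 3) ℂ

/-- The spectral parameter `k` as a function of the uniformization variable `z`. -/
def kz (q0 : ℝ) (z : ℂ) : ℂ := (z - (q0 : ℂ) ^ 2 / z) / 2

/-- The function `λ` of the uniformization variable `z`; `λ ^ 2 = k ^ 2 + q0 ^ 2`. -/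
def lam (q0 : ℝ) (z : ℂ) : ℂ := (z + (q0 : ℂ) ^ 2 / z) / 2

/-- `J = diag (1, -1, -1)`. -/
def matJ : Mat3 := Matrix.diagonal ![1, -1, -1]

/-- The block matrix `Q` with first row `(0, q†)` and first column `(0, -q)`. -/
def matQ (v : C2) : Mat3 :=
  !![0, conj (v 0), conj (v 1);
     -(v 0), 0, 0;
     -(v 1), 0, 0]

/-- The spatial Lax matrix `A = -i k J + Q` for the value `v` of the potential. -/
def matA (q0 : ℝ) (z : ℂ) (v : C2) : Mat3 := (-(Complex.I * kz q0 z)) • matJ + matQ v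

/-- The eigenvector matrix `Y` of the asymptotic Lax matrices belonging to the boundary value `v`;
its columns are `(1, -i v / z)`, `(0, v^⊥ / q0)`, `(-i q0 / z, v / q0)`, where
`v^⊥ = (v₂, -v₁)†`. -/
def matY (q0 : ℝ) (v : C2) (z : ℂ) : Mat3 :=
  !![1, 0, -(Complex.I * (q0 : ℂ) / z);
     -(Complex.I / z * v 0), conj (v 1) / (q0 : ℂ), v 0 / (q0 : ℂ);
     -(Complex.I / z * v 1), -conj (v 0) / (q0 : ℂ), v 1 / (q0 : ℂ)]

/-- The diagonal `(-λ, k, λ)` of the matrix `Λ₁`. -/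
def Lam1 (q0 : ℝ) (z : ℂ) : Fin 3 → ℂ := ![-lam q0 z, kz q0 z, lam q0 z]

/-- The diagonal `(δ₁, δ₂, δ₃)` of the phase matrix `Ω (x, t, z)`. -/
def phase (σ q0 x t : ℝ) (z : ℂ) : Fin 3 → ℂ :=
  let k := kz q0 z
  let l := lam q0 z
  ![-l * x + 2 * (k ^ 2 + k * l - 4 * k ^ 3 * l * σ + 2 * k * l * σ * (q0 : ℂ) ^ 2) * t,
    k * x + (8 * k ^ 4 * σ - 3 * σ * (q0 : ℂ) ^ 4 - (q0 : ℂ) ^ 2) * t,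
    l * x + 2 * (k ^ 2 - k * l + 4 * k ^ 3 * l * σ - 2 * k * l * σ * (q0 : ℂ) ^ 2) * t]

/-- `exp (i s D)` for the diagonal matrix with diagonal `d`. -/
def expDiag (s : ℂ) (d : Fin 3 → ℂ) : Mat3 :=
  Matrix.diagonal fun j => Complex.exp (Complex.I * s * d j)

/-- The integrand `Y e^{i (x - r) Λ₁} Y⁻¹ (A (r, t) - A_±) ν (r) e^{-i (x - r) Λ₁}` of the Volterra
equations, for the boundary value `v` of the potential `q`. -/
def volterraKernel (q0 : ℝ) (q : ℝ → ℝ → C2) (v : C2) (t : ℝ) (z : ℂ) (ν : ℝ → Mat3)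
    (x r : ℝ) : Mat3 :=
  matY q0 v z * expDiag ((x : ℂ) - r) (Lam1 q0 z) *
    ((matY q0 v z)⁻¹ * (matA q0 z (q r t) - matA q0 z v) * ν r) *
    expDiag (-((x : ℂ) - r)) (Lam1 q0 z)

/-- `ν = ν₋ (·, t, z)` solves the Volterra equation normalized at `x → -∞` (entrywise). -/
def IsNuMinus (q0 : ℝ) (q : ℝ → ℝ → C2) (qm : C2) (t : ℝ) (z : ℂ) (ν : ℝ → Mat3) : Prop :=
  ∀ (x : ℝ) (i j : Fin 3),
    IntegrableOn (fun r => volterraKernel q0 q qm t z ν x r i j) (Set.Iic x) ∧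
    ν x i j = matY q0 qm z i j + ∫ r in Set.Iic x, volterraKernel q0 q qm t z ν x r i j

/-- `ν = ν₊ (·, t, z)` solves the Volterra equation normalized at `x → +∞` (entrywise). -/
def IsNuPlus (q0 : ℝ) (q : ℝ → ℝ → C2) (qp : C2) (t : ℝ) (z : ℂ) (ν : ℝ → Mat3) : Prop :=
  ∀ (x : ℝ) (i j : Fin 3),
    IntegrableOn (fun r => volterraKernel q0 q qp t z ν x r i j) (Set.Ioi x) ∧
    ν x i j = matY q0 qp z i j - ∫ r in Set.Ioi x, volterraKernel q0 q qp t z ν x r i j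

/-- The modified Jost eigenfunction `ν₋ (·, t, z)`: the solution of its Volterra equation. -/
def nuMinus (q0 : ℝ) (q : ℝ → ℝ → C2) (qm : C2) (t : ℝ) (z : ℂ) : ℝ → Mat3 :=
  Classical.epsilon (IsNuMinus q0 q qm t z)

/-- The modified Jost eigenfunction `ν₊ (·, t, z)`: the solution of its Volterra equation. -/
def nuPlus (q0 : ℝ) (q : ℝ → ℝ → C2) (qp : C2) (t : ℝ) (z : ℂ) : ℝ → Mat3 :=
  Classical.epsilon (IsNuPlus q0 q qp t z)

/-- The Jost eigenfunction `ψ₋ = ν₋ e^{i Ω}`. -/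
def psiMinus (σ q0 : ℝ) (q : ℝ → ℝ → C2) (qm : C2) (x t : ℝ) (z : ℂ) : Mat3 :=
  nuMinus q0 q qm t z x * expDiag 1 (phase σ q0 x t z)

/-- The Jost eigenfunction `ψ₊ = ν₊ e^{i Ω}`. -/
def psiPlus (σ q0 : ℝ) (q : ℝ → ℝ → C2) (qp : C2) (x t : ℝ) (z : ℂ) : Mat3 :=
  nuPlus q0 q qp t z x * expDiag 1 (phase σ q0 x t z)

/-- The scattering matrix `S (z)`, given by `ψ₋ = ψ₊ S (z)`. -/
def scatS (σ q0 : ℝ) (q : ℝ → ℝ → C2) (qm qp : C2) (t : ℝ) (z : ℂ) : Mat3 :=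
  Classical.epsilon fun S : Mat3 =>
    ∀ x : ℝ, psiMinus σ q0 q qm x t z = psiPlus σ q0 q qp x t z * S

/-- The inverse scattering matrix `H (z) = S (z)⁻¹`. -/
def scatH (σ q0 : ℝ) (q : ℝ → ℝ → C2) (qm qp : C2) (t : ℝ) (z : ℂ) : Mat3 :=
  (scatS σ q0 q qm qp t z)⁻¹

/-- The real axis without the origin. -/
def realAxis : Set ℂ := {z | z.im = 0 ∧ z ≠ 0}

/-- The domains of analyticity of `s₁₁`, `s₂₂`, `s₃₃`. -/
def sDomain (q0 : ℝ) : Fin 3 → Set ℂ :=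
  ![{z | 0 < z.im ∧ q0 < ‖z‖}, {z | z.im < 0}, {z | 0 < z.im ∧ ‖z‖ < q0}]

/-- The domains of analyticity of `h₁₁`, `h₂₂`, `h₃₃`. -/
def hDomain (q0 : ℝ) : Fin 3 → Set ℂ :=
  ![{z | z.im < 0 ∧ q0 < ‖z‖}, {z | 0 < z.im}, {z | z.im < 0 ∧ ‖z‖ < q0}]

/-- `f` is equal to `g` on the real axis without the origin, it is holomorphic in the open set `D`,
and it is continuous up to the real boundary points of `D` other than the origin. On
`D ∪ realAxis`, at most one such `f` exists for each of the domains above. -/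
structure IsAnalyticContinuation (D : Set ℂ) (g f : ℂ → ℂ) : Prop where
  eq_real : Set.EqOn f g realAxis
  holo : DifferentiableOn ℂ f D
  cont : ContinuousOn f (D ∪ (closure D ∩ realAxis))

/-- `s j` and `h j` are the analytic scattering coefficients: the diagonal entries of `S (z)` and
`H (z)` on the real axis, together with their analytic continuations to their domains. -/
structure IsAnalyticScatteringData (σ q0 : ℝ) (q : ℝ → ℝ → C2) (qm qp : C2) (t : ℝ)
    (s h : Fin 3 → ℂ → ℂ) : Prop where
  s_cont : ∀ j, IsAnalyticContinuation (sDomain q0 j)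
    (fun z => scatS σ q0 q qm qp t z j j) (s j)
  h_cont : ∀ j, IsAnalyticContinuation (hDomain q0 j)
    (fun z => scatH σ q0 q qm qp t z j j) (h j)

/-- `z → ∞` in the set on which the coefficient with domain of analyticity `D` is defined: `D` and
the real axis. -/
def atInf (D : Set ℂ) : Filter ℂ := Bornology.cobounded ℂ ⊓ 𝓟 (D ∪ realAxis)

/-- `z → 0` in the set on which the coefficient with domain of analyticity `D` is defined: `D` and
the real axis without the origin. -/
def atZero (D : Set ℂ) : Filter ℂ := 𝓝[D ∪ realAxis] 0

/-- `q₋† q₊ / q0 ^ 2`. -/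
def cMP (q0 : ℝ) (qm qp : C2) : ℂ := inner ℂ qm qp / (q0 : ℂ) ^ 2

/-- `q₊† q₋ / q0 ^ 2`. -/
def cPM (q0 : ℝ) (qm qp : C2) : ℂ := inner ℂ qp qm / (q0 : ℂ) ^ 2

/-- The values of `s₁₁`, `s₂₂`, `s₃₃` at infinity. -/
def sInf (q0 : ℝ) (qm qp : C2) : Fin 3 → ℂ := ![1, cMP q0 qm qp, cPM q0 qm qp]

/-- The values of `h₁₁`, `h₂₂`, `h₃₃` at infinity. -/
def hInf (q0 : ℝ) (qm qp : C2) : Fin 3 → ℂ := ![1, cPM q0 qm qp, cMP q0 qm qp]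

/-- The values of `s₁₁`, `s₂₂`, `s₃₃` at the origin. -/
def sZero (q0 : ℝ) (qm qp : C2) : Fin 3 → ℂ := ![cPM q0 qm qp, cMP q0 qm qp, 1]

/-- The values of `h₁₁`, `h₂₂`, `h₃₃` at the origin. -/
def hZero (q0 : ℝ) (qm qp : C2) : Fin 3 → ℂ := ![cMP q0 qm qp, cPM q0 qm qp, 1]

end LPD

end

open Filter Topology MeasureTheory Asymptotics
open scoped ComplexConjugate

noncomputable section

namespace LPD

/-! ### Absolutely continuous functions and primitives from `-∞` -/

section AbsolutelyContinuous

open Set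

variable {X Y : Type*} [PseudoMetricSpace X] [PseudoMetricSpace Y]

/-! Each column of `ν₋` solves its own Volterra equation, with kernel `Y e^{is(Λ₁ - λⱼ)} Y⁻¹`, where
`λⱼ` is the `j`-th entry of `Λ₁`. The kernel stays bounded for `s ≥ 0` at a regular point as soon as
`Im (λₗ - λⱼ) ≥ 0` for all `l`. There the Neumann series converges, because the weight `exp (2C
∫_{-∞}^x ‖W‖)` turns the Volterra operator into a contraction by `1/2`; its sum inherits continuity
and holomorphy in `z`. On the real axis the kernel is a bounded one-parameter group, so every
solution is bounded near `-∞`, hence unique, and the functions chosen in the statement are these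
series (`isNuMinus_iff`). The column equations for `ν₊` reduce to those for `ν₋` by `x ↦ -x`, `z ↦
-z` and conjugation with `J` (`isNuPlus_iff_reflect`).

For real `z` the Lax matrix is skew-Hermitian, so inner products of solutions do not depend on `x`.
Letting `x → ∓∞` gives `ψ±† ψ± = Y±† Y± = diag (normY)`, whence `S = diag (normY)⁻¹ ψ₊† ψ₋`. On the
diagonal the phases cancel: `sⱼⱼ` is, up to `normY`, the Hermitian product of the `j`-th columns of
`ν₊` and `ν₋` at `x = 0` (`scatS_apply_self`). Evaluating the conjugated factor at `z̄` makes this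
expression, `scatFun`, holomorphic on the stated domain, and `hⱼⱼ (z)` is the conjugate of `sⱼⱼ
(z̄)`.

The eigenvector matrices degenerate at `±i q₀`, and only `-i q₀` lies in a domain, that of `s₂₂`.
The poles of the first and third spectral projections cancel there, because the two exponentials
collide at the same point; the column stays bounded and the singularity is removable
(`norm_colKernel_one_le`, `exists_analytic_scatFun`).

As `z → ∞`, `Y` and `Y⁻¹` are block diagonal for the splitting `1 + 2` up to `O(1/z)`, while `Q` is
block off-diagonal. In the first Volterra iterate each term therefore carries either a factor `1/z`
or an exponential whose frequency is of size `|z|`. The latter is small by the Riemann-Lebesgue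
lemma, and `O(1/z)` by one integration by parts if `q_x` is integrable
(`exists_norm_colSol_sub_le`). The limit `z → 0` is the same statement transported by `z ↦ -q₀²/z`,
which interchanges the first and third columns (`scatFun_inv`). -/

theorem absolutelyContinuousOnInterval_of_dist_le {f : ℝ → X} {g : ℝ → Y} {a b C : ℝ}
    (hg : AbsolutelyContinuousOnInterval g a b)
    (h : ∀ x ∈ uIcc a b, ∀ y ∈ uIcc a b, dist (f x) (f y) ≤ C * dist (g x) (g y)) :
    AbsolutelyContinuousOnInterval f a b := by
  rw [absolutelyContinuousOnInterval_iff] at hg ⊢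
  intro ε hε
  obtain ⟨δ, hδ, H⟩ := hg (ε / (|C| + 1)) (by positivity)
  refine ⟨δ, hδ, fun E hE hlen => ?_⟩
  have h1 := H E hE hlen
  have hpos : 0 < |C| + 1 := by positivity
  calc ∑ i ∈ Finset.range E.1, dist (f (E.2 i).1) (f (E.2 i).2)
      ≤ ∑ i ∈ Finset.range E.1, (|C| + 1) * dist (g (E.2 i).1) (g (E.2 i).2) := by
        refine Finset.sum_le_sum fun i hi => (h _ (hE.1 i hi).1 _ (hE.1 i hi).2).trans ?_
        gcongr
        exact (le_abs_self C).trans (by linarith)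
    _ = (|C| + 1) * ∑ i ∈ Finset.range E.1, dist (g (E.2 i).1) (g (E.2 i).2) := by
        rw [Finset.mul_sum]
    _ < (|C| + 1) * (ε / (|C| + 1)) := by gcongr
    _ = ε := by field_simp

variable {F : Type*} [NormedAddCommGroup F]

theorem intervalIntegrable_of_Iic {f : ℝ → F} (hf : ∀ a, IntegrableOn f (Iic a)) (a b : ℝ) :
    IntervalIntegrable f volume a b :=
  ⟨(hf b).mono_set Ioc_subset_Iic_self, (hf a).mono_set Ioc_subset_Iic_self⟩

variable [NormedSpace ℝ F]

theorem setIntegral_Iic_sub {f : ℝ → F} (hf : ∀ a, IntegrableOn f (Iic a)) (a b : ℝ) :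
    (∫ r in Iic b, f r) - ∫ r in Iic a, f r = ∫ r in a..b, f r :=
  intervalIntegral.integral_Iic_sub_Iic (hf a) (hf b)

theorem absolutelyContinuousOnInterval_intervalIntegral {f : ℝ → F}
    (hf : ∀ a b, IntervalIntegrable f volume a b) (c a b : ℝ) :
    AbsolutelyContinuousOnInterval (fun x => ∫ r in c..x, f r) a b := by
  have hn : ∀ a b, IntervalIntegrable (fun r => ‖f r‖) volume a b := fun a b => (hf a b).norm
  refine absolutelyContinuousOnInterval_of_dist_le (C := 1)
    ((hn a b).absolutelyContinuousOnInterval_intervalIntegral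
      (c := a) left_mem_uIcc) fun x _ y _ => ?_
  rw [dist_comm, dist_comm (∫ v in a..x, ‖f v‖), dist_eq_norm, Real.dist_eq,
    intervalIntegral.integral_interval_sub_left (hf c y) (hf c x),
    intervalIntegral.integral_interval_sub_left (hn a y) (hn a x), one_mul]
  exact intervalIntegral.norm_integral_le_abs_integral_norm

theorem ae_hasDerivAt_intervalIntegral [CompleteSpace F] {f : ℝ → F}
    (hf : ∀ a b, IntervalIntegrable f volume a b) (c : ℝ) :
    ∀ᵐ x, HasDerivAt (fun x => ∫ r in c..x, f r) (f x) x := by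
  have hloc : LocallyIntegrable f volume := fun x =>
    ⟨Ioc (x - 1) (x + 1), Ioc_mem_nhds (by linarith) (by linarith),
      (intervalIntegrable_iff_integrableOn_Ioc_of_le (by linarith)).1 (hf _ _)⟩
  filter_upwards [LocallyIntegrable.ae_hasDerivAt_integral hloc] with x hx using hx c

theorem absolutelyContinuousOnInterval_setIntegral_Iic {f : ℝ → F}
    (hf : ∀ a, IntegrableOn f (Iic a)) (a b : ℝ) :
    AbsolutelyContinuousOnInterval (fun x => ∫ r in Iic x, f r) a b := by
  refine absolutelyContinuousOnInterval_of_dist_le (C := 1)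
    (absolutelyContinuousOnInterval_intervalIntegral (intervalIntegrable_of_Iic hf) 0 a b)
    fun x _ y _ => ?_
  rw [← sub_add_cancel (∫ r in Iic x, f r) (∫ r in Iic 0, f r),
    ← sub_add_cancel (∫ r in Iic y, f r) (∫ r in Iic 0, f r), setIntegral_Iic_sub hf,
    setIntegral_Iic_sub hf, dist_add_right, one_mul]

theorem continuous_setIntegral_Iic {f : ℝ → F} (hf : ∀ a, IntegrableOn f (Iic a)) :
    Continuous fun x => ∫ r in Iic x, f r := by
  rw [continuous_iff_continuousAt]
  intro x
  have h := (absolutelyContinuousOnInterval_setIntegral_Iic hf (x - 1) (x + 1)).continuousOn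
  rw [uIcc_of_le (by linarith)] at h
  exact h.continuousAt (Icc_mem_nhds (by linarith) (by linarith))

theorem ae_hasDerivAt_setIntegral_Iic [CompleteSpace F] {f : ℝ → F}
    (hf : ∀ a, IntegrableOn f (Iic a)) :
    ∀ᵐ x, HasDerivAt (fun x => ∫ r in Iic x, f r) (f x) x := by
  filter_upwards [ae_hasDerivAt_intervalIntegral (intervalIntegrable_of_Iic hf) 0] with x hx
  have := hx.const_add (∫ r in Iic 0, f r)
  refine this.congr_of_eventuallyEq (Eventually.of_forall fun y => ?_)
  simp only
  rw [← setIntegral_Iic_sub hf 0 y]; abel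

/-- The potential is only integrable near `-∞`, so the differential equations hold only almost
everywhere; this replaces the mean value theorem throughout. -/
theorem eq_of_absolutelyContinuous_of_ae_hasDerivAt_zero {f : ℝ → F}
    (hf : ∀ a b, AbsolutelyContinuousOnInterval f a b) (h0 : ∀ᵐ x, HasDerivAt f 0 x) (x y : ℝ) :
    f x = f y := by
  obtain ⟨C, hC⟩ := (hf x y).const_of_ae_hasDerivAt_zero (h0.mono fun _ h _ => h)
  rw [hC x left_mem_uIcc, hC y right_mem_uIcc]

theorem tendsto_setIntegral_Iic_atBot {f : ℝ → F} (hf : ∀ a, IntegrableOn f (Iic a)) :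
    Tendsto (fun x => ∫ r in Iic x, f r) atBot (𝓝 0) := by
  have h1 : Tendsto (fun x => ∫ r in x..0, f r) atBot (𝓝 (∫ r in Iic 0, f r)) :=
    intervalIntegral_tendsto_integral_Iic 0 (hf 0) tendsto_id
  have h2 := (tendsto_const_nhds (x := ∫ r in Iic 0, f r)).sub h1
  rw [sub_self] at h2
  refine h2.congr fun x => ?_
  rw [← setIntegral_Iic_sub hf x 0]; abel

end AbsolutelyContinuous

/-! ### The exponential weight -/

section Weight

open Set

/-- The exponential weight `exp (c ∫_{-∞}^x g)`. -/
def expWeight (g : ℝ → ℝ) (c x : ℝ) : ℝ := Real.exp (c * ∫ r in Iic x, g r)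

variable {g : ℝ → ℝ} {c : ℝ}

theorem continuous_expWeight (hg : ∀ a, IntegrableOn g (Iic a)) : Continuous (expWeight g c) :=
  Real.continuous_exp.comp (continuous_const.mul (continuous_setIntegral_Iic hg))

theorem expWeight_pos (x : ℝ) : 0 < expWeight g c x := Real.exp_pos _

theorem expWeight_mono (hg : ∀ a, IntegrableOn g (Iic a)) (h0 : ∀ x, 0 ≤ g x) (hc : 0 ≤ c) :
    Monotone (expWeight g c) := fun x y hxy => by
  refine Real.exp_le_exp.2 (mul_le_mul_of_nonneg_left ?_ hc)
  exact setIntegral_mono_set (hg y) (Eventually.of_forall h0) (Iic_subset_Iic.2 hxy).eventuallyLE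

theorem one_le_expWeight (h0 : ∀ x, 0 ≤ g x) (hc : 0 ≤ c) (x : ℝ) : 1 ≤ expWeight g c x :=
  Real.one_le_exp (mul_nonneg hc (integral_nonneg h0))

theorem integrableOn_mul_expWeight (hg : ∀ a, IntegrableOn g (Iic a)) (h0 : ∀ x, 0 ≤ g x)
    (hc : 0 ≤ c) (x : ℝ) : IntegrableOn (fun r => g r * expWeight g c r) (Iic x) := by
  refine Integrable.mul_bdd (c := expWeight g c x) (hg x)
    (continuous_expWeight hg).aestronglyMeasurable ?_
  refine (ae_restrict_iff' measurableSet_Iic).2 (Eventually.of_forall fun r hr => ?_)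
  rw [Real.norm_of_nonneg (expWeight_pos r).le]
  exact expWeight_mono hg h0 hc hr

/-- Almost everywhere the weight has derivative `c g` times itself, and it tends to `1` at `-∞`; the
identity is the fundamental theorem of calculus for absolutely continuous functions. -/
theorem integral_mul_expWeight (hg : ∀ a, IntegrableOn g (Iic a)) (h0 : ∀ x, 0 ≤ g x)
    (hc : 0 ≤ c) (x : ℝ) :
    c * ∫ r in Iic x, g r * expWeight g c r = expWeight g c x - 1 := by
  have hint := integrableOn_mul_expWeight hg h0 hc
  have hac1 : ∀ a b, AbsolutelyContinuousOnInterval (expWeight g c) a b := fun a b => by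
    have hG := absolutelyContinuousOnInterval_setIntegral_Iic hg a b
    refine absolutelyContinuousOnInterval_of_dist_le (C := c * expWeight g c (max a b)) hG
      fun u hu v hv => ?_
    have hmono := expWeight_mono hg h0 hc
    -- Convexity of `exp` makes it Lipschitz below `t` with constant `e^t`, so absolute continuity
    -- passes from the primitive of `g` to the weight.
    have key : ∀ s t, s ≤ t → |Real.exp s - Real.exp t| ≤ Real.exp t * |s - t| := by
      intro s t hst
      have h1 := Real.add_one_le_exp (s - t)
      have h2 : Real.exp s = Real.exp t * Real.exp (s - t) := by rw [← Real.exp_add]; ring_nf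
      have h3 := Real.exp_pos t
      rw [abs_of_nonpos (by rw [sub_nonpos]; exact Real.exp_le_exp.2 hst),
        abs_of_nonpos (by linarith), h2]
      nlinarith
    have key2 : ∀ u v, u ≤ v → v ∈ uIcc a b → dist (expWeight g c u) (expWeight g c v) ≤
        c * expWeight g c (max a b) * dist (∫ r in Iic u, g r) (∫ r in Iic v, g r) := by
      intro u v huv hv
      rw [Real.dist_eq, Real.dist_eq]
      have hs : c * ∫ r in Iic u, g r ≤ c * ∫ r in Iic v, g r :=
        mul_le_mul_of_nonneg_left
          (setIntegral_mono_set (hg v) (Eventually.of_forall h0)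
            (Iic_subset_Iic.2 huv).eventuallyLE) hc
      refine (key _ _ hs).trans ?_
      rw [← mul_sub, abs_mul, abs_of_nonneg hc]
      have : Real.exp (c * ∫ r in Iic v, g r) ≤ expWeight g c (max a b) := hmono hv.2
      nlinarith [mul_nonneg hc (abs_nonneg ((∫ r in Iic u, g r) - ∫ r in Iic v, g r))]
    rcases le_total u v with huv | huv
    · exact key2 u v huv hv
    · rw [dist_comm, dist_comm (∫ r in Iic u, g r)]; exact key2 v u huv hu
  have hac2 := absolutelyContinuousOnInterval_setIntegral_Iic hint
  have hconst := eq_of_absolutelyContinuous_of_ae_hasDerivAt_zero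
    (f := fun x => expWeight g c x - c * ∫ r in Iic x, g r * expWeight g c r)
    (fun a b => (hac1 a b).fun_sub ((hac2 a b).const_mul c)) (by
      filter_upwards [ae_hasDerivAt_setIntegral_Iic hg, ae_hasDerivAt_setIntegral_Iic hint]
        with y h1 h2
      have := ((h1.const_mul c).exp).sub (h2.const_mul c)
      convert! this using 1
      simp only [expWeight]; ring)
  have hlim : Tendsto (fun x => expWeight g c x - c * ∫ r in Iic x, g r * expWeight g c r) atBot
      (𝓝 (1 - c * 0)) := by
    refine Tendsto.sub ?_ ((tendsto_setIntegral_Iic_atBot hint).const_mul c)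
    have := (Real.continuous_exp.tendsto (c * 0)).comp
      ((tendsto_setIntegral_Iic_atBot hg).const_mul c)
    simpa [expWeight] using! this
  have := tendsto_nhds_unique (hlim.congr fun y => hconst y x) tendsto_const_nhds
  linarith

end Weight

/-! ### Holomorphic dependence of integrals on a parameter -/

section Parameter

variable {α : Type*} [MeasurableSpace α] {μ : Measure α}
  {F : Type*} [NormedAddCommGroup F] [NormedSpace ℂ F]

/-- Cauchy's estimate on discs of radius `R / 4` turns a bound on the integrand into one on its
derivative, so no separate domination of the derivative is needed. -/
theorem differentiableOn_integral_of_bounded {U : Set ℂ} (hU : IsOpen U) {f : ℂ → α → F}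
    {bound : α → ℝ} (hmeas : ∀ z ∈ U, AEStronglyMeasurable (f z) μ)
    (hdiff : ∀ᵐ a ∂μ, DifferentiableOn ℂ (fun z => f z a) U) (hb : Integrable bound μ)
    (hle : ∀ᵐ a ∂μ, ∀ z ∈ U, ‖f z a‖ ≤ bound a) :
    DifferentiableOn ℂ (fun z => ∫ a, f z a ∂μ) U := by
  intro z₀ hz₀
  obtain ⟨R, hR, hball⟩ := Metric.isOpen_iff.1 hU z₀ hz₀
  have hR2 : 0 < R / 2 := by positivity
  have hsub : ∀ z ∈ Metric.ball z₀ (R / 2), Metric.closedBall z (R / 4) ⊆ U := by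
    intro z hz w hw
    apply hball
    rw [Metric.mem_ball] at hz ⊢
    rw [Metric.mem_closedBall] at hw
    linarith [dist_triangle w z z₀]
  have hmem : ∀ z ∈ Metric.ball z₀ (R / 2), z ∈ U := fun z hz =>
    hsub z hz (Metric.mem_closedBall_self (by positivity))
  -- Difference quotients along this sequence converge to the derivative, which is thereby
  -- measurable. The denominator `n + 2` keeps all points inside the ball of radius `R`.
  have hlim : Tendsto (fun n : ℕ => z₀ + ((R / (n + 1 + 1) : ℝ) : ℂ)) atTop (𝓝[U \ {z₀}] z₀) := by
    have h0 : Tendsto (fun n : ℕ => R / ((n : ℝ) + 1 + 1)) atTop (𝓝 0) := by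
      have := (tendsto_const_div_atTop_nhds_zero_nat R).comp (tendsto_add_atTop_nat 2)
      refine this.congr fun n => ?_
      simp only [Function.comp]; push_cast; ring_nf
    refine tendsto_nhdsWithin_iff.2 ⟨?_, Eventually.of_forall fun n => ⟨hball ?_, ?_⟩⟩
    · have := (Complex.continuous_ofReal.tendsto 0).comp h0
      simpa using! this.const_add z₀
    · have h1 : (0 : ℝ) < (n : ℝ) + 1 + 1 := by positivity
      rw [Metric.mem_ball, dist_eq_norm, add_sub_cancel_left, Complex.norm_real,
        Real.norm_of_nonneg (by positivity), div_lt_iff₀ h1]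
      nlinarith [(Nat.cast_nonneg n : (0 : ℝ) ≤ n)]
    · have : (R / ((n : ℝ) + 1 + 1)) ≠ 0 := by positivity
      rw [Set.mem_singleton_iff, add_eq_left, Complex.ofReal_eq_zero]
      exact this
  have hd := hasDerivAt_integral_of_dominated_loc_of_deriv_le (μ := μ) (F := f)
    (F' := fun z a => deriv (fun z => f z a) z) (x₀ := z₀) (s := Metric.ball z₀ (R / 2))
    (bound := fun a => bound a / (R / 4)) (Metric.ball_mem_nhds _ hR2)
    (by filter_upwards [Metric.ball_mem_nhds z₀ hR2] with z hz using hmeas z (hmem z hz))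
    (hb.mono' (hmeas z₀ hz₀) (hle.mono fun a ha => ha z₀ hz₀))
    (by
      refine aestronglyMeasurable_of_tendsto_ae atTop
        (f := fun (n : ℕ) a => slope (fun z => f z a) z₀ (z₀ + ((R / (n + 1 + 1) : ℝ) : ℂ)))
        (fun n => ?_) ?_
      · have hn : z₀ + ((R / (n + 1 + 1) : ℝ) : ℂ) ∈ U := by
          have h1 : (0 : ℝ) < (n : ℝ) + 1 + 1 := by positivity
          apply hball
          rw [Metric.mem_ball, dist_eq_norm, add_sub_cancel_left, Complex.norm_real,
            Real.norm_of_nonneg (by positivity), div_lt_iff₀ h1]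
          nlinarith [(Nat.cast_nonneg n : (0 : ℝ) ≤ n)]
        simp only [slope, vsub_eq_sub]
        exact ((hmeas _ hn).sub (hmeas _ hz₀)).const_smul _
      · filter_upwards [hdiff] with a ha
        have h1 := (ha.differentiableAt (hU.mem_nhds hz₀)).hasDerivAt
        exact (hasDerivAt_iff_tendsto_slope.1 h1).comp
          (hlim.mono_right (nhdsWithin_mono _ fun z hz => hz.2)))
    (by
      filter_upwards [hdiff, hle] with a ha hb z hz
      refine Complex.norm_deriv_le_of_forall_mem_sphere_norm_le (by positivity) ?_ fun w hw => ?_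
      · refine DifferentiableOn.diffContOnCl (ha.mono ?_)
        exact (closure_mono Metric.ball_subset_closedBall).trans
          ((Metric.isClosed_closedBall.closure_eq).subset.trans (hsub z hz))
      · exact hb w (hsub z hz (Metric.sphere_subset_closedBall hw)))
    (hb.div_const _)
    (by
      filter_upwards [hdiff] with a ha z hz
      exact (ha.differentiableAt (hU.mem_nhds (hmem z hz))).hasDerivAt)
  exact hd.2.differentiableAt.differentiableWithinAt

end Parameter

/-! ### Volterra equations and their Neumann series -/

section Volterra

open Set

variable {E : Type*} [NormedAddCommGroup E] [NormedSpace ℂ E]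

/-- The Volterra operator `m ↦ ∫_{-∞}^x K (x - r) W (r) m (r) dr`. -/
def voltOp (K W : ℝ → E →L[ℂ] E) (m : ℝ → E) (x : ℝ) : E :=
  ∫ r in Iic x, K (x - r) (W r (m r))

/-- The iterates of the Volterra operator on a constant. -/
def voltIter (K W : ℝ → E →L[ℂ] E) (y : E) : ℕ → ℝ → E
  | 0 => fun _ => y
  | n + 1 => voltOp K W (voltIter K W y n)

/-- The Neumann series of the Volterra equation `m = y + voltOp K W m`. -/
def voltSol (K W : ℝ → E →L[ℂ] E) (y : E) (x : ℝ) : E := ∑' n, voltIter K W y n x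

/-- The weight in which the Volterra operator is a contraction. -/
def voltWeight (W : ℝ → E →L[ℂ] E) (C : ℝ) : ℝ → ℝ := expWeight (fun r => ‖W r‖) (2 * C)

variable {K W : ℝ → E →L[ℂ] E} {C : ℝ}

theorem voltIter_smul (c : ℂ) (y : E) (n : ℕ) (x : ℝ) :
    voltIter K W (c • y) n x = c • voltIter K W y n x := by
  induction n generalizing x with
  | zero => rfl
  | succ n ih =>
    simp only [voltIter, voltOp, ih, map_smul]
    exact integral_smul _ _

theorem voltSol_smul (c : ℂ) (y : E) (x : ℝ) : voltSol K W (c • y) x = c • voltSol K W y x := by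
  simp only [voltSol, voltIter_smul]
  exact tsum_const_smul'' c

theorem one_le_voltWeight (hC : 0 ≤ C) (x : ℝ) : 1 ≤ voltWeight W C x :=
  one_le_expWeight (fun _ => norm_nonneg _) (by positivity) x

variable (hW : ∀ a, IntegrableOn W (Iic a))

include hW

theorem voltWeight_mono (hC : 0 ≤ C) : Monotone (voltWeight W C) :=
  expWeight_mono (fun a => (hW a).norm) (fun _ => norm_nonneg _) (by positivity)

theorem integrableOn_norm_mul_voltWeight (hC : 0 ≤ C) (x : ℝ) :
    IntegrableOn (fun r => ‖W r‖ * voltWeight W C r) (Iic x) :=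
  integrableOn_mul_expWeight (fun a => (hW a).norm) (fun _ => norm_nonneg _) (by positivity) x

/-- The constant `2C` in the exponent of the weight is what produces the factor `1/2`: integrating
`2C ‖W‖` against the weight returns the weight minus one. -/
theorem norm_voltOp_le (hC : 0 ≤ C) (hK : ∀ s, 0 ≤ s → ‖K s‖ ≤ C) {m : ℝ → E} {B x : ℝ}
    (hB : 0 ≤ B) (hm : ∀ r ≤ x, ‖m r‖ ≤ B * voltWeight W C r) :
    ‖voltOp K W m x‖ ≤ B / 2 * voltWeight W C x := by
  have hint := integrableOn_norm_mul_voltWeight hW hC x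
  have h1 : ‖voltOp K W m x‖ ≤ ∫ r in Iic x, C * B * (‖W r‖ * voltWeight W C r) := by
    refine norm_integral_le_of_norm_le (hint.const_mul _) ?_
    refine (ae_restrict_iff' measurableSet_Iic).2 (Eventually.of_forall fun r hr => ?_)
    calc ‖K (x - r) (W r (m r))‖ ≤ ‖K (x - r)‖ * (‖W r‖ * ‖m r‖) :=
          (ContinuousLinearMap.le_opNorm _ _).trans
            (mul_le_mul_of_nonneg_left (ContinuousLinearMap.le_opNorm _ _) (norm_nonneg _))
      _ ≤ C * (‖W r‖ * (B * voltWeight W C r)) := by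
          gcongr
          · exact hK _ (sub_nonneg.2 hr)
          · exact hm r hr
      _ = C * B * (‖W r‖ * voltWeight W C r) := by ring
  rw [integral_const_mul] at h1
  have h2 : 2 * C * ∫ r in Iic x, ‖W r‖ * voltWeight W C r = voltWeight W C x - 1 :=
    integral_mul_expWeight (fun a => (hW a).norm) (fun _ => norm_nonneg _)
      (by positivity) x
  calc _ ≤ _ := h1
    _ = B / 2 * (2 * C * ∫ r in Iic x, ‖W r‖ * voltWeight W C r) := by ring
    _ = B / 2 * (voltWeight W C x - 1) := by rw [h2]
    _ ≤ _ := by gcongr; linarith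

/-- A bounded almost solution of the homogeneous Volterra equation is small. -/
theorem norm_le_of_norm_sub_voltOp_le (hC : 0 ≤ C) (hK : ∀ s, 0 ≤ s → ‖K s‖ ≤ C) {d : ℝ → E}
    {a M ρ : ℝ} (hM : ∀ x ≤ a, ‖d x‖ ≤ M) (hρ : ∀ x ≤ a, ‖d x - voltOp K W d x‖ ≤ ρ) :
    ∀ x ≤ a, ‖d x‖ ≤ 2 * ρ * voltWeight W C x := by
  have hρ0 : 0 ≤ ρ := (norm_nonneg _).trans (hρ a le_rfl)
  have hM0 : 0 ≤ M := (norm_nonneg _).trans (hM a le_rfl)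
  -- One application sends a weighted bound `B` to `ρ + B / 2`, whose fixed point is `2ρ`; the
  -- initial bound `M` decays geometrically.
  have key : ∀ n : ℕ, ∀ x ≤ a, ‖d x‖ ≤ (2 * ρ + M * (1 / 2) ^ n) * voltWeight W C x := by
    intro n
    induction n with
    | zero =>
      intro x hx
      have h1 := one_le_voltWeight (W := W) hC x
      have h2 := hM x hx
      simp only [pow_zero, mul_one]
      nlinarith
    | succ n ih =>
      intro x hx
      have h1 := one_le_voltWeight (W := W) hC x
      have h2 := norm_voltOp_le hW hC hK (m := d) (x := x) (B := 2 * ρ + M * (1 / 2) ^ n)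
        (by positivity) fun r hr => ih r (hr.trans hx)
      have h3 := norm_le_norm_add_norm_sub' (d x) (voltOp K W d x)
      have h4 := hρ x hx
      rw [pow_succ]
      nlinarith
  intro x hx
  have hlim : Tendsto (fun n : ℕ => (2 * ρ + M * (1 / 2) ^ n) * voltWeight W C x) atTop
      (𝓝 ((2 * ρ + M * 0) * voltWeight W C x)) :=
    ((tendsto_pow_atTop_nhds_zero_of_lt_one (by norm_num) (by norm_num)).const_mul M
      |>.const_add _).mul_const _
  rw [mul_zero, add_zero] at hlim
  exact ge_of_tendsto' hlim fun n => key n x hx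

theorem norm_voltIter_le (hC : 0 ≤ C) (hK : ∀ s, 0 ≤ s → ‖K s‖ ≤ C) (y : E) (n : ℕ) (x : ℝ) :
    ‖voltIter K W y n x‖ ≤ ‖y‖ * (1 / 2) ^ n * voltWeight W C x := by
  induction n generalizing x with
  | zero =>
    have := one_le_voltWeight (W := W) hC x
    simp only [voltIter, pow_zero, mul_one]
    nlinarith [norm_nonneg y]
  | succ n ih =>
    refine (norm_voltOp_le hW hC hK (by positivity) fun r _ => ih r).trans (le_of_eq ?_)
    rw [pow_succ]; ring

theorem norm_voltSol_le [CompleteSpace E] (hC : 0 ≤ C) (hK : ∀ s, 0 ≤ s → ‖K s‖ ≤ C) (y : E)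
    (x : ℝ) : ‖voltSol K W y x‖ ≤ 2 * ‖y‖ * voltWeight W C x := by
  have hs : HasSum (fun n : ℕ => ‖y‖ * (1 / 2) ^ n * voltWeight W C x)
      (‖y‖ * 2 * voltWeight W C x) := (hasSum_geometric_two.mul_left _).mul_right _
  refine (tsum_of_norm_bounded hs fun n => norm_voltIter_le hW hC hK y n x).trans (le_of_eq ?_)
  ring

omit hW

/-! ### Continuity, holomorphy and uniqueness for families of Volterra equations -/

section Family

variable {K : ℂ → ℝ → E →L[ℂ] E} {V : Set ℂ} {y : ℂ → E}

theorem aestronglyMeasurable_voltOp_integrand {K : ℝ → E →L[ℂ] E}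
    (hW : ∀ a, IntegrableOn W (Iic a)) (hKc : Continuous K) {m : ℝ → E} (hm : Continuous m)
    (x : ℝ) : AEStronglyMeasurable (fun r => K (x - r) (W r (m r))) (volume.restrict (Iic x)) := by
  have h1 : AEStronglyMeasurable (fun r => W r (m r)) (volume.restrict (Iic x)) :=
    ContinuousLinearMap.aestronglyMeasurable_comp₂ (ContinuousLinearMap.apply ℂ E).flip
      (hW x).1 hm.aestronglyMeasurable
  exact ContinuousLinearMap.aestronglyMeasurable_comp₂ (ContinuousLinearMap.apply ℂ E).flip
      (hKc.comp (continuous_const.sub continuous_id)).aestronglyMeasurable h1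

theorem integrableOn_voltOp_integrand {K : ℝ → E →L[ℂ] E}
    (hW : ∀ a, IntegrableOn W (Iic a)) (hC : 0 ≤ C) (hK : ∀ s, 0 ≤ s → ‖K s‖ ≤ C)
    (hKc : Continuous K) {m : ℝ → E} (hm : Continuous m) {B : ℝ} (x : ℝ)
    (hmB : ∀ r ≤ x, ‖m r‖ ≤ B) : IntegrableOn (fun r => K (x - r) (W r (m r))) (Iic x) := by
  refine ((hW x).norm.const_mul (C * B)).mono'
    (aestronglyMeasurable_voltOp_integrand hW hKc hm x) ?_
  refine (ae_restrict_iff' measurableSet_Iic).2 (Eventually.of_forall fun r hr => ?_)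
  calc ‖K (x - r) (W r (m r))‖ ≤ ‖K (x - r)‖ * (‖W r‖ * ‖m r‖) :=
        (ContinuousLinearMap.le_opNorm _ _).trans
          (mul_le_mul_of_nonneg_left (ContinuousLinearMap.le_opNorm _ _) (norm_nonneg _))
    _ ≤ C * (‖W r‖ * B) := by
        gcongr
        · exact hK _ (sub_nonneg.2 hr)
        · exact hmB r hr
    _ = C * B * ‖W r‖ := by ring

theorem integrableOn_potential {a : ℝ} (hW : IntegrableOn W (Iic a)) {m : ℝ → E}
    (hm : Continuous m) {B : ℝ} (hmB : ∀ r ≤ a, ‖m r‖ ≤ B) :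
    IntegrableOn (fun r => W r (m r)) (Iic a) := by
  refine (hW.norm.mul_const B).mono'
    (ContinuousLinearMap.aestronglyMeasurable_comp₂ (ContinuousLinearMap.apply ℂ E).flip
      hW.1 hm.aestronglyMeasurable) ?_
  refine (ae_restrict_iff' measurableSet_Iic).2 (Eventually.of_forall fun r hr => ?_)
  refine (ContinuousLinearMap.le_opNorm _ _).trans ?_
  gcongr
  exact hmB r hr

/-- The hypotheses on a family of Volterra equations with parameters in `V`. -/
structure IsVoltFamily (K : ℂ → ℝ → E →L[ℂ] E) (W : ℝ → E →L[ℂ] E) (y : ℂ → E) (V : Set ℂ)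
    (C M : ℝ) : Prop where
  nonneg : 0 ≤ C
  integrable : ∀ a, IntegrableOn W (Iic a)
  bound : ∀ z ∈ V, ∀ s, 0 ≤ s → ‖K z s‖ ≤ C
  cont : ContinuousOn (fun p : ℂ × ℝ => K p.1 p.2) (V ×ˢ univ)
  bound_init : ∀ z ∈ V, ‖y z‖ ≤ M
  cont_init : ContinuousOn y V

variable {M : ℝ} (h : IsVoltFamily K W y V C M)

include h

theorem IsVoltFamily.continuous {z : ℂ} (hz : z ∈ V) : Continuous (K z) :=
  continuousOn_univ.1 (h.cont.comp (f := fun s => (z, s)) (by fun_prop) fun s _ => ⟨hz, mem_univ s⟩)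

theorem IsVoltFamily.norm_voltIter_le {z : ℂ} (hz : z ∈ V) (n : ℕ) (x : ℝ) :
    ‖voltIter (K z) W (y z) n x‖ ≤ M * (1 / 2) ^ n * voltWeight W C x := by
  refine (LPD.norm_voltIter_le h.integrable h.nonneg (h.bound z hz) (y z) n x).trans ?_
  have := one_le_voltWeight (W := W) h.nonneg x
  have := h.bound_init z hz
  gcongr

/-- Dominated convergence, jointly in the parameter and the end point. -/
theorem IsVoltFamily.continuousOn_voltOp {m : ℂ → ℝ → E} {B : ℝ}
    (hm : ContinuousOn (fun p : ℂ × ℝ => m p.1 p.2) (V ×ˢ univ))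
    (hB : ∀ z ∈ V, ∀ x, ‖m z x‖ ≤ B * voltWeight W C x) :
    ContinuousOn (fun p : ℂ × ℝ => voltOp (K p.1) W (m p.1) p.2) (V ×ˢ univ) := by
  rintro ⟨z₀, x₀⟩ ⟨hz₀, -⟩
  have hmz : ∀ z ∈ V, Continuous (m z) := fun z hz =>
    continuousOn_univ.1 (hm.comp (f := fun s => (z, s)) (by fun_prop) fun s _ => ⟨hz, mem_univ s⟩)
  -- The indicator moves the variable end point into the integrand, so that the domain of
  -- integration is fixed.
  have heq : (fun p : ℂ × ℝ => voltOp (K p.1) W (m p.1) p.2) = fun p : ℂ × ℝ =>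
      ∫ r, (Iic p.2).indicator (fun r => K p.1 (p.2 - r) (W r (m p.1 r))) r := by
    funext p
    rw [integral_indicator measurableSet_Iic]; rfl
  rw [heq]
  have hmem : ∀ᶠ p : ℂ × ℝ in 𝓝[V ×ˢ univ] (z₀, x₀), p.1 ∈ V ∧ p.2 < x₀ + 1 := by
    have h1 : ∀ᶠ p : ℂ × ℝ in 𝓝[V ×ˢ univ] (z₀, x₀), p ∈ V ×ˢ (univ : Set ℝ) :=
      self_mem_nhdsWithin
    have h2 : ∀ᶠ p : ℂ × ℝ in 𝓝[V ×ˢ univ] (z₀, x₀), p.2 < x₀ + 1 :=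
      mem_nhdsWithin_of_mem_nhds
        ((continuous_snd.tendsto (z₀, x₀)).eventually (Iio_mem_nhds (by simp)))
    filter_upwards [h1, h2] with p h1 h2 using ⟨h1.1, h2⟩
  refine continuousWithinAt_of_dominated
    (bound := (Iic (x₀ + 1)).indicator fun r => C * B * (‖W r‖ * voltWeight W C r)) ?_ ?_ ?_ ?_
  · filter_upwards [hmem] with p hp
    rw [aestronglyMeasurable_indicator_iff measurableSet_Iic]
    exact aestronglyMeasurable_voltOp_integrand h.integrable (h.continuous hp.1) (hmz _ hp.1) _
  · filter_upwards [hmem] with p hp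
    refine Eventually.of_forall fun r => ?_
    by_cases hr : r ≤ p.2
    · rw [indicator_of_mem (mem_Iic.2 hr), indicator_of_mem (mem_Iic.2 (hr.trans hp.2.le))]
      calc ‖K p.1 (p.2 - r) (W r (m p.1 r))‖ ≤ ‖K p.1 (p.2 - r)‖ * (‖W r‖ * ‖m p.1 r‖) :=
            (ContinuousLinearMap.le_opNorm _ _).trans
              (mul_le_mul_of_nonneg_left (ContinuousLinearMap.le_opNorm _ _) (norm_nonneg _))
        _ ≤ C * (‖W r‖ * (B * voltWeight W C r)) := by
            have := h.nonneg
            gcongr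
            · exact h.bound _ hp.1 _ (sub_nonneg.2 hr)
            · exact hB _ hp.1 r
        _ = C * B * (‖W r‖ * voltWeight W C r) := by ring
    · rw [indicator_of_notMem (by simpa using hr), norm_zero]
      have hB0 : 0 ≤ B * voltWeight W C r := (norm_nonneg _).trans (hB _ hp.1 r)
      refine indicator_nonneg (fun r _ => ?_) r
      have hB0 : 0 ≤ B * voltWeight W C r := (norm_nonneg _).trans (hB _ hp.1 r)
      have := mul_nonneg (mul_nonneg h.nonneg (norm_nonneg (W r))) hB0
      nlinarith
  · rw [integrable_indicator_iff measurableSet_Iic]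
    exact (integrableOn_norm_mul_voltWeight h.integrable h.nonneg _).const_mul _
  -- Only at `r = x₀` can the indicator jump in the limit, and that is a null set.
  · have hne : ∀ᵐ r : ℝ, r ≠ x₀ := by simp [ae_iff, measure_singleton]
    filter_upwards [hne] with r hr
    rcases lt_or_gt_of_ne hr with hr | hr
    · have hev : ∀ᶠ p : ℂ × ℝ in 𝓝[V ×ˢ univ] (z₀, x₀), K p.1 (p.2 - r) (W r (m p.1 r)) =
          (Iic p.2).indicator (fun r => K p.1 (p.2 - r) (W r (m p.1 r))) r := by
        have h2 : ∀ᶠ p : ℂ × ℝ in 𝓝[V ×ˢ univ] (z₀, x₀), r < p.2 :=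
          mem_nhdsWithin_of_mem_nhds
            ((continuous_snd.tendsto (z₀, x₀)).eventually (Ioi_mem_nhds hr))
        filter_upwards [h2] with p hp
        rw [indicator_of_mem (mem_Iic.2 hp.le)]
      have hK1 : ContinuousWithinAt (fun p : ℂ × ℝ => K p.1 (p.2 - r)) (V ×ˢ univ) (z₀, x₀) :=
        (h.cont.comp (f := fun p : ℂ × ℝ => (p.1, p.2 - r)) (by fun_prop)
          fun p hp => ⟨hp.1, mem_univ _⟩) (z₀, x₀) ⟨hz₀, mem_univ _⟩
      have hm1 : ContinuousWithinAt (fun p : ℂ × ℝ => m p.1 r) (V ×ˢ univ) (z₀, x₀) :=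
        (hm.comp (f := fun p : ℂ × ℝ => (p.1, r)) (by fun_prop)
          fun p hp => ⟨hp.1, mem_univ _⟩) (z₀, x₀) ⟨hz₀, mem_univ _⟩
      have h3 : ContinuousWithinAt (fun p : ℂ × ℝ => K p.1 (p.2 - r) (W r (m p.1 r)))
          (V ×ˢ univ) (z₀, x₀) :=
        hK1.clm_apply ((W r).continuous.continuousAt.comp_continuousWithinAt hm1)
      exact h3.congr_of_eventuallyEq (hev.mono fun _ h => h.symm)
        (by rw [indicator_of_mem (mem_Iic.2 hr.le)])
    · have hev : ∀ᶠ p : ℂ × ℝ in 𝓝[V ×ˢ univ] (z₀, x₀),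
          (Iic p.2).indicator (fun r => K p.1 (p.2 - r) (W r (m p.1 r))) r = 0 := by
        have h2 : ∀ᶠ p : ℂ × ℝ in 𝓝[V ×ˢ univ] (z₀, x₀), p.2 < r :=
          mem_nhdsWithin_of_mem_nhds
            ((continuous_snd.tendsto (z₀, x₀)).eventually (Iio_mem_nhds hr))
        filter_upwards [h2] with p hp
        rw [indicator_of_notMem (by simpa using hp)]
      exact continuousWithinAt_const.congr_of_eventuallyEq hev
        (by rw [indicator_of_notMem (by simpa using hr)])

theorem IsVoltFamily.continuousOn_voltIter (n : ℕ) :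
    ContinuousOn (fun p : ℂ × ℝ => voltIter (K p.1) W (y p.1) n p.2) (V ×ˢ univ) := by
  induction n with
  | zero => exact h.cont_init.comp continuousOn_fst fun p hp => hp.1
  | succ n ih =>
    exact h.continuousOn_voltOp (m := fun z => voltIter (K z) W (y z) n) ih
      fun z hz x => h.norm_voltIter_le hz n x

theorem IsVoltFamily.continuousOn_voltSol [CompleteSpace E] :
    ContinuousOn (fun p : ℂ × ℝ => voltSol (K p.1) W (y p.1) p.2) (V ×ˢ univ) := by
  -- The weight is increasing, so the series converges uniformly on each half-line `x < a` though
  -- not on the whole line.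
  have hloc : ∀ a : ℝ,
      ContinuousOn (fun p : ℂ × ℝ => voltSol (K p.1) W (y p.1) p.2) (V ×ˢ Iio a) := by
    intro a
    refine continuousOn_tsum (u := fun n => |M| * (1 / 2) ^ n * voltWeight W C a)
      (fun n => (h.continuousOn_voltIter n).mono (prod_mono_right (subset_univ _)))
      ((summable_geometric_two.mul_left _).mul_right _) fun n p hp => ?_
    refine (h.norm_voltIter_le hp.1 n p.2).trans ?_
    have := voltWeight_mono h.integrable h.nonneg (le_of_lt hp.2)
    have := one_le_voltWeight (W := W) h.nonneg p.2
    gcongr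
    exact le_abs_self M
  rintro ⟨z, x⟩ ⟨hz, -⟩
  refine (hloc (x + 1) (z, x) ⟨hz, by simp⟩).mono_of_mem_nhdsWithin ?_
  rw [nhdsWithin_prod_eq]
  exact Filter.prod_mem_prod self_mem_nhdsWithin
    (mem_nhdsWithin_of_mem_nhds (Iio_mem_nhds (by simp)))

theorem IsVoltFamily.continuous_voltSol [CompleteSpace E] {z : ℂ} (hz : z ∈ V) :
    Continuous (voltSol (K z) W (y z)) :=
  continuousOn_univ.1 (h.continuousOn_voltSol.comp (f := fun s => (z, s)) (by fun_prop)
    fun s _ => ⟨hz, mem_univ s⟩)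

theorem IsVoltFamily.differentiableOn_voltIter {U : Set ℂ} (hU : IsOpen U)
    (hUV : U ⊆ V) (hK : ∀ s, 0 ≤ s → DifferentiableOn ℂ (fun z => K z s) U)
    (hy : DifferentiableOn ℂ y U) (n : ℕ) (x : ℝ) :
    DifferentiableOn ℂ (fun z => voltIter (K z) W (y z) n x) U := by
  induction n generalizing x with
  | zero => exact hy
  | succ n ih =>
    refine differentiableOn_integral_of_bounded hU
      (bound := fun r => C * (M * (1 / 2) ^ n) * (‖W r‖ * voltWeight W C r)) ?_ ?_ ?_ ?_
    · intro z hz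
      refine aestronglyMeasurable_voltOp_integrand h.integrable (h.continuous (hUV hz)) ?_ x
      exact continuousOn_univ.1 ((h.continuousOn_voltIter n).comp (f := fun s => (z, s))
        (by fun_prop) fun s _ => ⟨hUV hz, mem_univ s⟩)
    · refine (ae_restrict_iff' measurableSet_Iic).2 (Eventually.of_forall fun r hr => ?_)
      exact (hK _ (sub_nonneg.2 hr)).clm_apply
        ((W r).differentiable.comp_differentiableOn (ih r))
    · exact (integrableOn_norm_mul_voltWeight h.integrable h.nonneg _).const_mul _
    · refine (ae_restrict_iff' measurableSet_Iic).2 (Eventually.of_forall fun r hr z hz => ?_)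
      calc ‖K z (x - r) (W r (voltIter (K z) W (y z) n r))‖
          ≤ ‖K z (x - r)‖ * (‖W r‖ * ‖voltIter (K z) W (y z) n r‖) :=
            (ContinuousLinearMap.le_opNorm _ _).trans
              (mul_le_mul_of_nonneg_left (ContinuousLinearMap.le_opNorm _ _) (norm_nonneg _))
        _ ≤ C * (‖W r‖ * (M * (1 / 2) ^ n * voltWeight W C r)) := by
            have := h.nonneg
            gcongr
            · exact h.bound _ (hUV hz) _ (sub_nonneg.2 hr)
            · exact h.norm_voltIter_le (hUV hz) n r
        _ = _ := by ring

theorem IsVoltFamily.differentiableOn_voltSol [CompleteSpace E] {U : Set ℂ} (hU : IsOpen U)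
    (hUV : U ⊆ V) (hK : ∀ s, 0 ≤ s → DifferentiableOn ℂ (fun z => K z s) U)
    (hy : DifferentiableOn ℂ y U) (x : ℝ) :
    DifferentiableOn ℂ (fun z => voltSol (K z) W (y z) x) U :=
  Complex.differentiableOn_tsum_of_summable_norm
    (u := fun n => M * (1 / 2) ^ n * voltWeight W C x)
    ((summable_geometric_two.mul_left _).mul_right _)
    (fun n => h.differentiableOn_voltIter hU hUV hK hy n x) hU
    fun n _ hz => h.norm_voltIter_le (hUV hz) n x

/-- The Neumann series may be integrated term by term: its terms are dominated by a geometric series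
times the integrable function `‖W‖` times the weight. -/
theorem IsVoltFamily.voltSol_eq [CompleteSpace E] {z : ℂ} (hz : z ∈ V) (x : ℝ) :
    voltSol (K z) W (y z) x = y z + voltOp (K z) W (voltSol (K z) W (y z)) x := by
  have hsum : ∀ x, Summable fun n => voltIter (K z) W (y z) n x := fun x =>
    Summable.of_norm_bounded ((summable_geometric_two.mul_left M).mul_right (voltWeight W C x))
      fun n => h.norm_voltIter_le hz n x
  have hs : HasSum (fun n => voltIter (K z) W (y z) (n + 1) x)
      (voltOp (K z) W (voltSol (K z) W (y z)) x) := by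
    have hgeo : ∀ r, HasSum (fun n : ℕ => C * (M * (1 / 2) ^ n) * (‖W r‖ * voltWeight W C r))
        (C * (M * 2) * (‖W r‖ * voltWeight W C r)) := fun r =>
      ((hasSum_geometric_two.mul_left M).mul_left C).mul_right _
    refine hasSum_integral_of_dominated_convergence
      (fun n r => C * (M * (1 / 2) ^ n) * (‖W r‖ * voltWeight W C r)) ?_ ?_ ?_ ?_ ?_
    · intro n
      refine aestronglyMeasurable_voltOp_integrand h.integrable (h.continuous hz) ?_ x
      exact continuousOn_univ.1 ((h.continuousOn_voltIter n).comp (f := fun s => (z, s))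
        (by fun_prop) fun s _ => ⟨hz, mem_univ s⟩)
    · intro n
      refine (ae_restrict_iff' measurableSet_Iic).2 (Eventually.of_forall fun r hr => ?_)
      calc ‖K z (x - r) (W r (voltIter (K z) W (y z) n r))‖
          ≤ ‖K z (x - r)‖ * (‖W r‖ * ‖voltIter (K z) W (y z) n r‖) :=
            (ContinuousLinearMap.le_opNorm _ _).trans
              (mul_le_mul_of_nonneg_left (ContinuousLinearMap.le_opNorm _ _) (norm_nonneg _))
        _ ≤ C * (‖W r‖ * (M * (1 / 2) ^ n * voltWeight W C r)) := by
            have := h.nonneg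
            gcongr
            · exact h.bound _ hz _ (sub_nonneg.2 hr)
            · exact h.norm_voltIter_le hz n r
        _ = _ := by ring
    · exact Eventually.of_forall fun r => (hgeo r).summable
    · simp_rw [fun r => (hgeo r).tsum_eq]
      exact (integrableOn_norm_mul_voltWeight h.integrable h.nonneg _).const_mul _
    · refine Eventually.of_forall fun r => ?_
      exact ((K z (x - r)).comp (W r)).hasSum (hsum r).hasSum
  rw [voltSol, (hsum x).tsum_eq_zero_add, hs.tsum_eq]
  rfl

/-- Solutions that are bounded near `-∞` are unique. -/
theorem IsVoltFamily.eq_voltSol [CompleteSpace E] {z : ℂ} (hz : z ∈ V) {m : ℝ → E}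
    (hm : ∀ a, ∃ B, ∀ x ≤ a, ‖m x‖ ≤ B)
    (hint : ∀ x, IntegrableOn (fun r => K z (x - r) (W r (m r))) (Iic x))
    (heq : ∀ x, m x = y z + voltOp (K z) W m x) : m = voltSol (K z) W (y z) := by
  have hsB : ∀ a, ∀ x ≤ a, ‖voltSol (K z) W (y z) x‖ ≤ 2 * ‖y z‖ * voltWeight W C a := by
    intro a x hx
    refine (norm_voltSol_le h.integrable h.nonneg (h.bound z hz) (y z) x).trans ?_
    have := voltWeight_mono h.integrable h.nonneg hx
    gcongr
  funext a
  obtain ⟨B, hB⟩ := hm a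
  have key := norm_le_of_norm_sub_voltOp_le h.integrable h.nonneg (h.bound z hz)
    (d := fun x => m x - voltSol (K z) W (y z) x) (a := a) (ρ := 0)
    (M := B + 2 * ‖y z‖ * voltWeight W C a)
    (fun x hx => norm_sub_le_of_le (hB x hx) (hsB a x hx)) (fun x hx => by
      have hi2 := integrableOn_voltOp_integrand h.integrable h.nonneg (h.bound z hz)
        (h.continuous hz) (h.continuous_voltSol hz) x (hsB x)
      have h1 : voltOp (K z) W (fun x => m x - voltSol (K z) W (y z) x) x =
          voltOp (K z) W m x - voltOp (K z) W (voltSol (K z) W (y z)) x := by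
        rw [voltOp, voltOp, voltOp, ← integral_sub (hint x) hi2]
        simp only [map_sub]
      rw [h1]
      have h2 := heq x
      have h3 := h.voltSol_eq hz x
      have h4 : m x - voltSol (K z) W (y z) x - (voltOp (K z) W m x -
          voltOp (K z) W (voltSol (K z) W (y z)) x) =
          (m x - voltOp (K z) W m x) - (voltSol (K z) W (y z) x -
          voltOp (K z) W (voltSol (K z) W (y z)) x) := by abel
      have h5 : m x - voltOp (K z) W m x = y z := by nth_rw 1 [h2]; abel
      have h6 : voltSol (K z) W (y z) x - voltOp (K z) W (voltSol (K z) W (y z)) x = y z := by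
        nth_rw 1 [h3]; abel
      rw [h4, h5, h6, sub_self, norm_zero]) a le_rfl
  rw [mul_zero, zero_mul] at key
  exact sub_eq_zero.1 (norm_le_zero_iff.1 key)

end Family

end Volterra

/-! ### Oscillatory integrals and the Riemann-Lebesgue lemma -/

section Oscillatory

open Set

/-- The integral `∫_{-∞}^x e^{i (x - r) ζ} f (r) dr`. -/
def oscInt (f : ℝ → ℂ) (ζ : ℂ) (x : ℝ) : ℂ :=
  ∫ r in Iic x, Complex.exp (Complex.I * ((x - r : ℝ) : ℂ) * ζ) * f r

theorem norm_exp_I_mul_le_one {s : ℝ} (hs : 0 ≤ s) {ζ : ℂ} (hζ : 0 ≤ ζ.im) :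
    ‖Complex.exp (Complex.I * (s : ℂ) * ζ)‖ ≤ 1 := by
  rw [Complex.norm_exp, Real.exp_le_one_iff]
  have : (Complex.I * (s : ℂ) * ζ).re = -(s * ζ.im) := by simp
  rw [this]
  exact neg_nonpos.2 (mul_nonneg hs hζ)

theorem integrableOn_exp_mul {f : ℝ → ℂ} {x : ℝ} (hf : IntegrableOn f (Iic x)) {ζ : ℂ}
    (hζ : 0 ≤ ζ.im) :
    IntegrableOn (fun r => Complex.exp (Complex.I * ((x - r : ℝ) : ℂ) * ζ) * f r) (Iic x) := by
  refine Integrable.bdd_mul (c := 1) hf (by fun_prop) ?_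
  refine (ae_restrict_iff' measurableSet_Iic).2 (Eventually.of_forall fun r hr => ?_)
  exact norm_exp_I_mul_le_one (sub_nonneg.2 hr) hζ

theorem norm_oscInt_le {f : ℝ → ℂ} {x : ℝ} (hf : IntegrableOn f (Iic x)) {ζ : ℂ}
    (hζ : 0 ≤ ζ.im) : ‖oscInt f ζ x‖ ≤ ∫ r in Iic x, ‖f r‖ := by
  refine norm_integral_le_of_norm_le hf.norm ?_
  refine (ae_restrict_iff' measurableSet_Iic).2 (Eventually.of_forall fun r hr => ?_)
  rw [norm_mul]
  exact mul_le_of_le_one_left (norm_nonneg _) (norm_exp_I_mul_le_one (sub_nonneg.2 hr) hζ)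

/-- Integration by parts gains `1/ζ`. As `f` and `f'` are integrable, `f → 0` at `-∞`, so the
boundary term at `x` and the remaining integral are each at most `∫ ‖f'‖`; hence the factor `2`. -/
theorem norm_oscInt_le_of_hasDerivAt {f f' : ℝ → ℂ} {a : ℝ} (hd : ∀ x, HasDerivAt f (f' x) x)
    (hf' : IntegrableOn f' (Iic a)) (hf : IntegrableOn f (Iic a)) {ζ : ℂ} (hζ : 0 ≤ ζ.im)
    (hζ0 : ζ ≠ 0) {x : ℝ} (hx : x ≤ a) :
    ‖oscInt f ζ x‖ ≤ 2 * (∫ r in Iic a, ‖f' r‖) / ‖ζ‖ := by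
  have hsub : Iic x ⊆ Iic a := Iic_subset_Iic.2 hx
  have hmono : ∫ r in Iic x, ‖f' r‖ ≤ ∫ r in Iic a, ‖f' r‖ :=
    setIntegral_mono_set hf'.norm (Eventually.of_forall fun _ => norm_nonneg _) hsub.eventuallyLE
  have hf0 : Tendsto f atBot (𝓝 0) :=
    tendsto_zero_of_hasDerivAt_of_integrableOn_Iic (fun y _ => hd y) hf' hf
  have hfx : ‖f x‖ ≤ ∫ r in Iic a, ‖f' r‖ := by
    have h1 := integral_Iic_of_hasDerivAt_of_tendsto' (fun y _ => hd y) (hf'.mono_set hsub) hf0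
    rw [sub_zero] at h1
    rw [← h1]
    exact (norm_integral_le_integral_norm _).trans hmono
  set e : ℝ → ℂ := fun r => Complex.exp (Complex.I * ((x - r : ℝ) : ℂ) * ζ) with he
  have hζI : Complex.I * ζ ≠ 0 := mul_ne_zero Complex.I_ne_zero hζ0
  have hed : ∀ r, HasDerivAt e (-(Complex.I * ζ) * e r) r := by
    intro r
    have h1 : HasDerivAt (fun r : ℝ => Complex.I * ((x - r : ℝ) : ℂ) * ζ)
        (Complex.I * ((-1 : ℝ) : ℂ) * ζ) r := by
      have h2 : HasDerivAt (fun r : ℝ => x - r) (-1) r := by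
        simpa using! (hasDerivAt_id r).const_sub x
      exact (h2.ofReal_comp.const_mul _).mul_const _
    convert! h1.cexp using 1
    simp only [he]; push_cast; ring
  have hFd : ∀ r, HasDerivAt (fun r => -(Complex.I * ζ)⁻¹ * (e r * f r))
      (e r * f r - (Complex.I * ζ)⁻¹ * (e r * f' r)) r := by
    intro r
    convert! ((hed r).mul (hd r)).const_mul (-(Complex.I * ζ)⁻¹) using 1
    field_simp
    ring
  have hi1 : IntegrableOn (fun r => e r * f r) (Iic x) :=
    integrableOn_exp_mul (hf.mono_set hsub) hζ
  have hi2 : IntegrableOn (fun r => e r * f' r) (Iic x) :=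
    integrableOn_exp_mul (hf'.mono_set hsub) hζ
  have hlim : Tendsto (fun r => -(Complex.I * ζ)⁻¹ * (e r * f r)) atBot (𝓝 0) := by
    rw [← mul_zero (-(Complex.I * ζ)⁻¹)]
    refine Tendsto.const_mul _ ?_
    refine squeeze_zero_norm' ?_ (by simpa using hf0.norm)
    filter_upwards [Iic_mem_atBot x] with r hr
    rw [norm_mul]
    exact mul_le_of_le_one_left (norm_nonneg _) (norm_exp_I_mul_le_one (sub_nonneg.2 hr) hζ)
  have key := integral_Iic_of_hasDerivAt_of_tendsto' (fun r _ => hFd r)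
    (hi1.sub (hi2.const_mul _)) hlim
  rw [integral_sub hi1 (hi2.const_mul _), integral_const_mul, sub_zero] at key
  have hex : e x = 1 := by simp [he]
  have hosc : oscInt f ζ x = (Complex.I * ζ)⁻¹ * oscInt f' ζ x -
      (Complex.I * ζ)⁻¹ * f x := by
    rw [hex, one_mul] at key
    have : oscInt f ζ x = (Complex.I * ζ)⁻¹ * oscInt f' ζ x + -(Complex.I * ζ)⁻¹ * f x := by
      rw [← key]; simp only [oscInt, he]; ring
    rw [this]; ring
  have hn : ‖(Complex.I * ζ)⁻¹‖ = ‖ζ‖⁻¹ := by simp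
  rw [hosc]
  refine (norm_sub_le _ _).trans ?_
  rw [norm_mul, norm_mul, hn, ← mul_add, div_eq_inv_mul]
  gcongr
  linarith [(norm_oscInt_le (hf'.mono_set hsub) hζ).trans hmono]

/-- The Riemann-Lebesgue lemma, uniform in the end point and in the upper half plane. -/
theorem exists_norm_oscInt_le {f : ℝ → ℂ} {a : ℝ} (hf : IntegrableOn f (Iic a)) {ε : ℝ}
    (hε : 0 < ε) :
    ∃ B, ∀ ζ : ℂ, 0 ≤ ζ.im → B ≤ ‖ζ‖ → ∀ x ≤ a, ‖oscInt f ζ x‖ ≤ ε := by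
  have hfi : Integrable ((Iic a).indicator f) := (integrable_indicator_iff measurableSet_Iic).2 hf
  -- Approximation in `L¹` by a smooth compactly supported `g`: the error costs `ε / 2` uniformly in
  -- `ζ` and `x`, and `g` is handled by integration by parts.
  obtain ⟨g, hgs, hgd, hg⟩ := MemLp.exist_eLpNorm_sub_le (by simp) le_rfl
    (memLp_one_iff_integrable.2 hfi) (half_pos hε)
  have hgc : Continuous g := hgd.continuous
  have hgi : Integrable g := hgc.integrable_of_hasCompactSupport hgs
  have hdi : Integrable (deriv g) :=
    (hgd.continuous_deriv (by simp)).integrable_of_hasCompactSupport hgs.deriv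
  have hsub : ∫ r in Iic a, ‖f r - g r‖ ≤ ε / 2 := by
    have h1 : Integrable ((Iic a).indicator f - g) := hfi.sub hgi
    have h2 : ∫ r, ‖((Iic a).indicator f - g) r‖ ≤ ε / 2 := by
      rw [integral_norm_eq_lintegral_enorm h1.1, ← eLpNorm_one_eq_lintegral_enorm]
      exact ENNReal.toReal_le_of_le_ofReal (by positivity) hg
    refine le_trans ?_ h2
    calc ∫ r in Iic a, ‖f r - g r‖ = ∫ r in Iic a, ‖((Iic a).indicator f - g) r‖ := by
          refine setIntegral_congr_fun measurableSet_Iic fun r hr => ?_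
          simp [indicator_of_mem hr]
      _ ≤ _ := setIntegral_le_integral h1.norm (Eventually.of_forall fun _ => norm_nonneg _)
  set D := ∫ r in Iic a, ‖deriv g r‖
  have hD : 0 ≤ D := integral_nonneg fun _ => norm_nonneg _
  -- The first summand makes `2D / ‖ζ‖ ≤ ε / 2`; the `1` keeps `ζ` away from zero even if `D = 0`.
  refine ⟨4 * D / ε + 1, fun ζ hζ hB x hx => ?_⟩
  have hζpos : 0 < ‖ζ‖ := lt_of_lt_of_le (by positivity) hB
  have h1 := norm_oscInt_le_of_hasDerivAt
    (fun x => (hgd.differentiable (by simp) x).hasDerivAt) hdi.integrableOn hgi.integrableOn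
    hζ (norm_pos_iff.1 hζpos) hx
  have h2 : 2 * D / ‖ζ‖ ≤ ε / 2 := by
    rw [div_le_iff₀ hζpos]
    have : 4 * D ≤ ε * ‖ζ‖ := by
      calc 4 * D = ε * (4 * D / ε) := by field_simp
        _ ≤ ε * ‖ζ‖ := by gcongr; linarith
    linarith
  have hfx : IntegrableOn f (Iic x) := hf.mono_set (Iic_subset_Iic.2 hx)
  have h3 : oscInt f ζ x = oscInt (fun r => f r - g r) ζ x + oscInt g ζ x := by
    have hfg : IntegrableOn (fun r => f r - g r) (Iic x) := hfx.sub hgi.integrableOn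
    rw [oscInt, oscInt, oscInt, ← integral_add (integrableOn_exp_mul hfg hζ)
      (integrableOn_exp_mul hgi.integrableOn hζ)]
    refine integral_congr_ae (Eventually.of_forall fun r => ?_)
    simp only []; ring
  have h4 : ‖oscInt (fun r => f r - g r) ζ x‖ ≤ ε / 2 := by
    refine (norm_oscInt_le (hfx.sub hgi.integrableOn) hζ).trans (le_trans ?_ hsub)
    exact setIntegral_mono_set (hf.sub hgi.integrableOn).norm
      (Eventually.of_forall fun _ => norm_nonneg _) (Iic_subset_Iic.2 hx).eventuallyLE
  rw [h3]
  calc _ ≤ _ := norm_add_le _ _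
    _ ≤ ε / 2 + ε / 2 := add_le_add h4 (h1.trans h2)
    _ = ε := by ring

end Oscillatory

/-! ### The eigenvector matrices and their inverses -/

section Matrices

open Set

/-- The continuous linear map of a 3 × 3 matrix. -/
def matCLM : Mat3 →ₗ[ℂ] ((Fin 3 → ℂ) →L[ℂ] (Fin 3 → ℂ)) :=
  (LinearMap.toContinuousLinearMap.toLinearMap).comp (Matrix.toLin' (R := ℂ)).toLinearMap

@[simp]
theorem matCLM_apply (M : Mat3) (v : Fin 3 → ℂ) : matCLM M v = M.mulVec v := rfl

theorem norm_matCLM_le (M : Mat3) : ‖matCLM M‖ ≤ ∑ i, ∑ j, ‖M i j‖ := by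
  refine ContinuousLinearMap.opNorm_le_bound _ (by positivity) fun v => ?_
  rw [pi_norm_le_iff_of_nonneg (by positivity)]
  intro i
  calc ‖∑ j, M i j * v j‖ ≤ ∑ j, ‖M i j * v j‖ := norm_sum_le _ _
    _ ≤ ∑ j, ‖M i j‖ * ‖v‖ := by
        refine Finset.sum_le_sum fun j _ => ?_
        rw [norm_mul]
        gcongr
        exact norm_le_pi_norm v j
    _ = (∑ j, ‖M i j‖) * ‖v‖ := by rw [Finset.sum_mul]
    _ ≤ _ := mul_le_mul_of_nonneg_right
        (Finset.single_le_sum (f := fun i => ∑ j, ‖M i j‖) (s := Finset.univ)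
          (fun i _ => Finset.sum_nonneg fun j _ => norm_nonneg (M i j)) (Finset.mem_univ i))
        (norm_nonneg _)

theorem matCLM_eq_sum (M : Mat3) :
    matCLM M = ∑ i, ∑ j, M i j • matCLM (Matrix.single i j 1) := by
  conv_lhs => rw [Matrix.matrix_eq_sum_single M]
  simp only [map_sum]
  refine Finset.sum_congr rfl fun i _ => Finset.sum_congr rfl fun j _ => ?_
  rw [← map_smul, Matrix.smul_single, smul_eq_mul, mul_one]

theorem differentiableOn_matCLM {M : ℂ → Mat3} {U : Set ℂ}
    (h : ∀ i j, DifferentiableOn ℂ (fun z => M z i j) U) :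
    DifferentiableOn ℂ (fun z => matCLM (M z)) U := by
  simp_rw [fun z => matCLM_eq_sum (M z)]
  exact DifferentiableOn.fun_sum fun i _ => DifferentiableOn.fun_sum fun j _ =>
    (h i j).smul_const _

variable {q0 : ℝ} {v : C2} {z : ℂ}

theorem kz_add_lam (q0 : ℝ) (z : ℂ) : kz q0 z + lam q0 z = z := by simp only [kz, lam]; ring

theorem lam_sub_kz (q0 : ℝ) (z : ℂ) : lam q0 z - kz q0 z = (q0 : ℂ) ^ 2 / z := by
  simp only [kz, lam]; ring

theorem kz_neg (q0 : ℝ) (z : ℂ) : kz q0 (-z) = -kz q0 z := by simp only [kz, div_neg]; ring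

theorem lam_neg (q0 : ℝ) (z : ℂ) : lam q0 (-z) = -lam q0 z := by simp only [lam, div_neg]; ring

theorem kz_conj (q0 : ℝ) (z : ℂ) : kz q0 (conj z) = conj (kz q0 z) := by
  simp [kz, map_ofNat]

theorem lam_conj (q0 : ℝ) (z : ℂ) : lam q0 (conj z) = conj (lam q0 z) := by
  simp [lam, map_ofNat]

theorem Lam1_neg (q0 : ℝ) (z : ℂ) (j : Fin 3) : Lam1 q0 (-z) j = -Lam1 q0 z j := by
  fin_cases j <;> simp [Lam1, kz_neg, lam_neg]

theorem Lam1_conj (q0 : ℝ) (z : ℂ) (j : Fin 3) : Lam1 q0 (conj z) j = conj (Lam1 q0 z j) := by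
  fin_cases j <;> simp [Lam1, kz_conj, lam_conj]

/-- The involution `z ↦ -q₀²/z` fixes `k` and changes the sign of `λ`. It will carry the behaviour
at infinity to the origin. -/
theorem Lam1_inv (hq0 : q0 ≠ 0) (hz : z ≠ 0) (j : Fin 3) :
    Lam1 q0 (-(q0 : ℂ) ^ 2 / z) j = Lam1 q0 z (Equiv.swap 0 2 j) := by
  have hq : (q0 : ℂ) ≠ 0 := Complex.ofReal_ne_zero.2 hq0
  have h1 : lam q0 (-(q0 : ℂ) ^ 2 / z) = -lam q0 z := by
    simp only [lam]; field_simp; ring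
  have h2 : kz q0 (-(q0 : ℂ) ^ 2 / z) = kz q0 z := by
    simp only [kz]; field_simp; ring
  fin_cases j
  · simp [Lam1, h1]
  · simp [Lam1, h2, Equiv.swap_apply_of_ne_of_ne]
  · simp [Lam1, h1]

theorem sum_mul_conj (hv : ‖v‖ = q0) (a b : ℂ) (ha : a = v 0) (hb : b = v 1) :
    a * conj a + b * conj b = (q0 : ℂ) ^ 2 := by
  have h := EuclideanSpace.norm_sq_eq v
  rw [hv, Fin.sum_univ_two, ← ha, ← hb] at h
  rw [Complex.mul_conj, Complex.mul_conj, Complex.normSq_eq_norm_sq, Complex.normSq_eq_norm_sq]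
  have := congrArg Complex.ofReal h
  push_cast at this ⊢
  exact this.symm

/-- The points at which the asymptotic eigenvector matrices are regular and invertible. -/
def regularSet (q0 : ℝ) : Set ℂ := {z | z ≠ 0 ∧ z ^ 2 + (q0 : ℂ) ^ 2 ≠ 0}

theorem isOpen_regularSet (q0 : ℝ) : IsOpen (regularSet q0) :=
  isOpen_ne.inter (isOpen_ne.preimage (f := fun z : ℂ => z ^ 2 + (q0 : ℂ) ^ 2) (by fun_prop))

/-- The diagonal of `Y† Y`. -/
def normY (q0 : ℝ) (z : ℂ) : Fin 3 → ℂ :=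
  ![1 + (q0 : ℂ) ^ 2 / z ^ 2, 1, 1 + (q0 : ℂ) ^ 2 / z ^ 2]

/-- The holomorphic adjoint `Y (z̄)†` of the matrix `Y (z)`. -/
def adjY (q0 : ℝ) (v : C2) (z : ℂ) : Mat3 :=
  !![1, Complex.I / z * conj (v 0), Complex.I / z * conj (v 1);
     0, v 1 / (q0 : ℂ), -v 0 / (q0 : ℂ);
     Complex.I * (q0 : ℂ) / z, conj (v 0) / (q0 : ℂ), conj (v 1) / (q0 : ℂ)]

theorem conjTranspose_matY (q0 : ℝ) (v : C2) (z : ℂ) :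
    (matY q0 v z).conjTranspose = adjY q0 v (conj z) := by
  ext i j
  fin_cases i <;> fin_cases j <;>
    simp [matY, adjY, Matrix.conjTranspose_apply] <;> ring

theorem normY_ne_zero (hz : z ∈ regularSet q0) (j : Fin 3) : normY q0 z j ≠ 0 := by
  have h : 1 + (q0 : ℂ) ^ 2 / z ^ 2 ≠ 0 := by
    have := hz.1
    rw [show 1 + (q0 : ℂ) ^ 2 / z ^ 2 = (z ^ 2 + (q0 : ℂ) ^ 2) / z ^ 2 by field_simp]
    exact div_ne_zero hz.2 (pow_ne_zero 2 this)
  fin_cases j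
  · exact h
  · exact one_ne_zero
  · exact h

/-- For real `z` this is the orthogonality of the eigenvectors of a skew-Hermitian matrix. The
holomorphic adjoint extends it to complex `z` and gives `Y⁻¹` explicitly, singular only at `0` and
at the zeros `±i q₀` of `normY`. -/
theorem adjY_mul_matY (hq0 : q0 ≠ 0) (hv : ‖v‖ = q0) (hz : z ≠ 0) :
    adjY q0 v z * matY q0 v z = Matrix.diagonal (normY q0 z) := by
  have hq : (q0 : ℂ) ≠ 0 := Complex.ofReal_ne_zero.2 hq0
  have h := sum_mul_conj hv _ _ rfl rfl
  have hI := Complex.I_sq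
  ext i j
  fin_cases i <;> fin_cases j <;>
    simp [Matrix.mul_apply, Fin.sum_univ_three, matY, adjY, normY] <;> field_simp <;>
    grind

theorem inv_matY (hq0 : q0 ≠ 0) (hv : ‖v‖ = q0) (hz : z ∈ regularSet q0) :
    (matY q0 v z)⁻¹ = Matrix.diagonal (fun l => (normY q0 z l)⁻¹) * adjY q0 v z := by
  refine Matrix.inv_eq_left_inv ?_
  rw [Matrix.mul_assoc, adjY_mul_matY hq0 hv hz.1, Matrix.diagonal_mul_diagonal,
    ← Matrix.diagonal_one]
  congr 1
  funext l
  exact inv_mul_cancel₀ (normY_ne_zero hz l)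

theorem inv_matY_apply (hq0 : q0 ≠ 0) (hv : ‖v‖ = q0) (hz : z ∈ regularSet q0) (i j : Fin 3) :
    (matY q0 v z)⁻¹ i j = (normY q0 z i)⁻¹ * adjY q0 v z i j := by
  rw [inv_matY hq0 hv hz, Matrix.diagonal_mul]

theorem isUnit_det_matY (hq0 : q0 ≠ 0) (hv : ‖v‖ = q0) (hz : z ∈ regularSet q0) :
    IsUnit (matY q0 v z).det := by
  have h : (matY q0 v z)⁻¹ * matY q0 v z = 1 := by
    rw [inv_matY hq0 hv hz, Matrix.mul_assoc, adjY_mul_matY hq0 hv hz.1,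
      Matrix.diagonal_mul_diagonal, ← Matrix.diagonal_one]
    congr 1
    funext l
    exact inv_mul_cancel₀ (normY_ne_zero hz l)
  have h2 := congrArg Matrix.det h
  rw [Matrix.det_mul, Matrix.det_one] at h2
  exact IsUnit.of_mul_eq_one_right _ h2

theorem differentiableOn_matY (q0 : ℝ) (v : C2) (i j : Fin 3) :
    DifferentiableOn ℂ (fun z => matY q0 v z i j) {z | z ≠ 0} := by
  intro z hz
  have hz : z ≠ 0 := hz
  refine DifferentiableAt.differentiableWithinAt ?_
  fin_cases i <;> fin_cases j <;> simp [matY] <;> fun_prop (disch := exact hz)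

theorem differentiableOn_adjY (q0 : ℝ) (v : C2) (i j : Fin 3) :
    DifferentiableOn ℂ (fun z => adjY q0 v z i j) {z | z ≠ 0} := by
  intro z hz
  have hz : z ≠ 0 := hz
  refine DifferentiableAt.differentiableWithinAt ?_
  fin_cases i <;> fin_cases j <;> simp [adjY] <;> fun_prop (disch := exact hz)

theorem differentiableOn_normY (q0 : ℝ) (j : Fin 3) :
    DifferentiableOn ℂ (fun z => normY q0 z j) {z | z ≠ 0} := by
  intro z hz
  have hz : z ≠ 0 := hz
  refine DifferentiableAt.differentiableWithinAt ?_
  fin_cases j <;> simp [normY] <;> fun_prop (disch := exact pow_ne_zero 2 hz)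

theorem differentiableOn_inv_matY (hq0 : q0 ≠ 0) (hv : ‖v‖ = q0) (i j : Fin 3) :
    DifferentiableOn ℂ (fun z => (matY q0 v z)⁻¹ i j) (regularSet q0) := by
  have hsub : regularSet q0 ⊆ {z | z ≠ 0} := fun z hz => hz.1
  refine DifferentiableOn.congr (f := fun z => (normY q0 z i)⁻¹ * adjY q0 v z i j) ?_
    fun z hz => inv_matY_apply hq0 hv hz i j
  exact (((differentiableOn_normY q0 i).mono hsub).inv fun z hz => normY_ne_zero hz i).mul
    ((differentiableOn_adjY q0 v i j).mono hsub)

end Matrices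

/-! ### The columns of the modified eigenfunctions -/

section Columns

open Set

variable {q0 : ℝ} {v : C2} {z : ℂ}

/-- The spectral projections of the asymptotic Lax matrix. -/
def specProj (q0 : ℝ) (v : C2) (l : Fin 3) (z : ℂ) : (Fin 3 → ℂ) →L[ℂ] (Fin 3 → ℂ) :=
  matCLM (Matrix.of fun i j => matY q0 v z i l * (matY q0 v z)⁻¹ l j)

/-- The kernel `Y e^{i s (Λ₁ - Λ₁ j)} Y⁻¹` of the Volterra equation of the `j`-th column. -/
def colKernel (q0 : ℝ) (v : C2) (j : Fin 3) (z : ℂ) (s : ℝ) : (Fin 3 → ℂ) →L[ℂ] (Fin 3 → ℂ) :=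
  ∑ l, Complex.exp (Complex.I * (s : ℂ) * (Lam1 q0 z l - Lam1 q0 z j)) • specProj q0 v l z

/-- The potential of the Volterra equations as a continuous linear map. -/
def potCLM (q : ℝ → C2) (v : C2) (r : ℝ) : (Fin 3 → ℂ) →L[ℂ] (Fin 3 → ℂ) :=
  matCLM (matQ (q r - v))

/-- The `j`-th column of the modified eigenfunction that is normalized at `-∞`. -/
def colSol (q0 : ℝ) (q : ℝ → C2) (v : C2) (j : Fin 3) (z : ℂ) : ℝ → Fin 3 → ℂ :=
  voltSol (colKernel q0 v j z) (potCLM q v) fun i => matY q0 v z i j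

/-- The points at which the kernel of the `j`-th column is bounded. -/
def boundedSet (q0 : ℝ) (j : Fin 3) : Set ℂ :=
  {z | z ≠ 0 ∧ ∀ l, 0 ≤ (Lam1 q0 z l - Lam1 q0 z j).im}

theorem colKernel_eq (q0 : ℝ) (v : C2) (j : Fin 3) (z : ℂ) (s : ℝ) :
    colKernel q0 v j z s = matCLM (matY q0 v z *
      Matrix.diagonal (fun l => Complex.exp (Complex.I * (s : ℂ) * (Lam1 q0 z l - Lam1 q0 z j))) *
      (matY q0 v z)⁻¹) := by
  simp only [colKernel, specProj, ← map_smul, ← map_sum]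
  congr 1
  ext a b
  simp only [Matrix.sum_apply, Matrix.smul_apply, Matrix.of_apply, smul_eq_mul]
  rw [Matrix.mul_apply]
  refine Finset.sum_congr rfl fun l _ => ?_
  rw [Matrix.mul_diagonal]; ring

/-- The map `u ↦ matCLM (matQ u)` as a real linear map. -/
def matQLin : C2 →ₗ[ℝ] ((Fin 3 → ℂ) →L[ℂ] (Fin 3 → ℂ)) where
  toFun u := matCLM (matQ u)
  map_add' u w := by
    rw [← map_add]
    congr 1
    ext i j
    fin_cases i <;> fin_cases j <;> simp [matQ] <;> ring
  map_smul' c u := by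
    have : (RingHom.id ℝ) c • matCLM (matQ u) = (c : ℂ) • matCLM (matQ u) := rfl
    rw [this, ← map_smul]
    congr 1
    ext i j
    fin_cases i <;> fin_cases j <;> simp [matQ]

theorem integrableOn_potCLM {q : ℝ → C2} {s : Set ℝ}
    (hq : IntegrableOn (fun x => q x - v) s) : IntegrableOn (potCLM q v) s :=
  (LinearMap.toContinuousLinearMap matQLin).integrable_comp hq

theorem differentiableOn_specProj (hq0 : q0 ≠ 0) (hv : ‖v‖ = q0) (l : Fin 3) :
    DifferentiableOn ℂ (specProj q0 v l) (regularSet q0) :=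
  differentiableOn_matCLM fun i j =>
    ((differentiableOn_matY q0 v i l).mono fun _ hz => hz.1).mul
      (differentiableOn_inv_matY hq0 hv l j)

theorem differentiableOn_Lam1 (q0 : ℝ) (l : Fin 3) :
    DifferentiableOn ℂ (fun z => Lam1 q0 z l) {z | z ≠ 0} := by
  intro z hz
  have hz : z ≠ 0 := hz
  refine DifferentiableAt.differentiableWithinAt ?_
  fin_cases l <;> simp [Lam1, lam, kz] <;> fun_prop (disch := exact hz)

theorem differentiableOn_colKernel (hq0 : q0 ≠ 0) (hv : ‖v‖ = q0) (j : Fin 3) (s : ℝ) :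
    DifferentiableOn ℂ (fun z => colKernel q0 v j z s) (regularSet q0) := by
  have hL : ∀ l, DifferentiableOn ℂ (fun z => Lam1 q0 z l) (regularSet q0) := fun l =>
    (differentiableOn_Lam1 q0 l).mono fun _ hz => hz.1
  exact DifferentiableOn.fun_sum fun l _ => DifferentiableOn.smul
    (((hL l).sub (hL j)).const_mul _).cexp (differentiableOn_specProj hq0 hv l)

theorem continuousOn_colKernel (hq0 : q0 ≠ 0) (hv : ‖v‖ = q0) (j : Fin 3) :
    ContinuousOn (fun p : ℂ × ℝ => colKernel q0 v j p.1 p.2) (regularSet q0 ×ˢ univ) := by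
  have hfst : MapsTo Prod.fst (regularSet q0 ×ˢ (univ : Set ℝ)) (regularSet q0) :=
    fun p hp => hp.1
  have hL : ∀ l, ContinuousOn (fun p : ℂ × ℝ => Lam1 q0 p.1 l)
      (regularSet q0 ×ˢ (univ : Set ℝ)) := fun l =>
    (((differentiableOn_Lam1 q0 l).mono fun z (hz : z ∈ regularSet q0) => hz.1).continuousOn).comp
      continuousOn_fst hfst
  have hP : ∀ l, ContinuousOn (fun p : ℂ × ℝ => specProj q0 v l p.1)
      (regularSet q0 ×ˢ (univ : Set ℝ)) := fun l =>
    (differentiableOn_specProj hq0 hv l).continuousOn.comp continuousOn_fst hfst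
  have hE : ∀ l, ContinuousOn (fun p : ℂ × ℝ =>
      Complex.exp (Complex.I * (p.2 : ℂ) * (Lam1 q0 p.1 l - Lam1 q0 p.1 j)))
      (regularSet q0 ×ˢ (univ : Set ℝ)) := fun l =>
    ContinuousOn.cexp (ContinuousOn.mul (by fun_prop) ((hL l).sub (hL j)))
  exact continuousOn_finsetSum _ fun l _ => (hE l).smul (hP l)

theorem norm_colKernel_le_sum (j : Fin 3) (hz : z ∈ boundedSet q0 j) {s : ℝ} (hs : 0 ≤ s) :
    ‖colKernel q0 v j z s‖ ≤ ∑ l, ‖specProj q0 v l z‖ := by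
  refine (norm_sum_le _ _).trans (Finset.sum_le_sum fun l _ => ?_)
  rw [norm_smul]
  exact mul_le_of_le_one_left (norm_nonneg _) (norm_exp_I_mul_le_one hs (hz.2 l))

variable {q : ℝ → C2}

theorem isVoltFamily_colKernel (hq0 : q0 ≠ 0) (hv : ‖v‖ = q0)
    (hq : ∀ a, IntegrableOn (fun x => q x - v) (Iic a)) (j : Fin 3) {V : Set ℂ} {C M : ℝ}
    (hV : V ⊆ regularSet q0) (hC : 0 ≤ C)
    (hK : ∀ z ∈ V, ∀ s, 0 ≤ s → ‖colKernel q0 v j z s‖ ≤ C)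
    (hM : ∀ z ∈ V, ‖fun i => matY q0 v z i j‖ ≤ M) :
    IsVoltFamily (colKernel q0 v j) (potCLM q v) (fun z i => matY q0 v z i j) V C M where
  nonneg := hC
  integrable a := integrableOn_potCLM (hq a)
  bound := hK
  cont := (continuousOn_colKernel hq0 hv j).mono (prod_mono_left hV)
  bound_init := hM
  cont_init := continuousOn_pi.2 fun i =>
    ((differentiableOn_matY q0 v i j).mono fun _ hz => (hV hz).1).continuousOn

/-- For frequencies in the closed upper half plane the kernel is bounded by the sum of the norms of
the spectral projections, which is locally bounded at regular points. The bounded set need not be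
open, hence the intersection with it. -/
theorem exists_isVoltFamily_nhds (hq0 : q0 ≠ 0) (hv : ‖v‖ = q0)
    (hq : ∀ a, IntegrableOn (fun x => q x - v) (Iic a)) (j : Fin 3) (hz : z ∈ regularSet q0) :
    ∃ N, IsOpen N ∧ z ∈ N ∧ N ⊆ regularSet q0 ∧ ∃ C M, IsVoltFamily (colKernel q0 v j)
      (potCLM q v) (fun z i => matY q0 v z i j) (N ∩ boundedSet q0 j) C M := by
  have hopen := isOpen_regularSet q0
  have h1 : ContinuousAt (fun w => ∑ l, ‖specProj q0 v l w‖) z := by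
    refine ContinuousOn.continuousAt ?_ (hopen.mem_nhds hz)
    exact continuousOn_finsetSum _ fun l _ => (differentiableOn_specProj hq0 hv l).continuousOn.norm
  have h2 : ContinuousAt (fun w => ‖fun i => matY q0 v w i j‖) z := by
    refine ContinuousOn.continuousAt (s := regularSet q0) ?_ (hopen.mem_nhds hz)
    exact (continuousOn_pi.2 fun i =>
      ((differentiableOn_matY q0 v i j).mono fun _ hz => hz.1).continuousOn).norm
  have h3 := (h1.eventually (gt_mem_nhds (lt_add_one _))).and
    ((h2.eventually (gt_mem_nhds (lt_add_one _))).and (hopen.mem_nhds hz))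
  obtain ⟨N, hN, hNo, hzN⟩ := eventually_nhds_iff.1 h3
  refine ⟨N, hNo, hzN, fun w hw => (hN w hw).2.2, (∑ l, ‖specProj q0 v l z‖) + 1,
    ‖fun i => matY q0 v z i j‖ + 1, isVoltFamily_colKernel hq0 hv hq j
      (fun w hw => (hN w hw.1).2.2) (by positivity) (fun w hw s hs => ?_) fun w hw => ?_⟩
  · exact (norm_colKernel_le_sum j hw.2 hs).trans (hN w hw.1).1.le
  · exact (hN w hw.1).2.1.le

theorem continuousOn_colSol (hq0 : q0 ≠ 0) (hv : ‖v‖ = q0)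
    (hq : ∀ a, IntegrableOn (fun x => q x - v) (Iic a)) (j : Fin 3) (x : ℝ) :
    ContinuousOn (fun z => colSol q0 q v j z x) (boundedSet q0 j ∩ regularSet q0) := by
  rintro z ⟨hz, hzr⟩
  obtain ⟨N, hNo, hzN, hNr, C, M, h⟩ := exists_isVoltFamily_nhds hq0 hv hq j hzr
  have h1 : ContinuousOn (fun z => colSol q0 q v j z x) (N ∩ boundedSet q0 j) :=
    h.continuousOn_voltSol.comp (f := fun w => (w, x)) (by fun_prop) fun w hw => ⟨hw, mem_univ _⟩
  refine (h1 z ⟨hzN, hz⟩).mono_of_mem_nhdsWithin ?_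
  filter_upwards [mem_nhdsWithin_of_mem_nhds (hNo.mem_nhds hzN), self_mem_nhdsWithin] with w h1 h2
    using ⟨h1, h2.1⟩

theorem differentiableOn_colSol (hq0 : q0 ≠ 0) (hv : ‖v‖ = q0)
    (hq : ∀ a, IntegrableOn (fun x => q x - v) (Iic a)) (j : Fin 3) (x : ℝ) {U : Set ℂ}
    (hU : IsOpen U) (hUb : U ⊆ boundedSet q0 j) (hUr : U ⊆ regularSet q0) :
    DifferentiableOn ℂ (fun z => colSol q0 q v j z x) U := by
  intro z hz
  obtain ⟨N, hNo, hzN, hNr, C, M, h⟩ := exists_isVoltFamily_nhds hq0 hv hq j (hUr hz)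
  have h1 := h.differentiableOn_voltSol (hNo.inter hU) (fun w hw => ⟨hw.1, hUb hw.2⟩)
    (fun s _ => (differentiableOn_colKernel hq0 hv j s).mono fun w hw => hNr hw.1)
    (differentiableOn_pi.2 fun i => (differentiableOn_matY q0 v i j).mono
      fun w hw => (hNr hw.1).1) x
  exact (h1.differentiableAt ((hNo.inter hU).mem_nhds ⟨hzN, hz⟩)).differentiableWithinAt

end Columns

/-! ### The eigenfunctions on the real axis: existence, uniqueness, reflection -/

section RealAxis

open Set

variable {q0 : ℝ} {v : C2} {z : ℂ} {t : ℝ}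

theorem conj_eq_of_mem_realAxis (hz : z ∈ realAxis) : conj z = z := Complex.conj_eq_iff_im.2 hz.1

theorem Lam1_im_eq_zero (hz : z ∈ realAxis) (j : Fin 3) : (Lam1 q0 z j).im = 0 := by
  rw [← Complex.conj_eq_iff_im, ← Lam1_conj, conj_eq_of_mem_realAxis hz]

theorem realAxis_subset_boundedSet (q0 : ℝ) (j : Fin 3) : realAxis ⊆ boundedSet q0 j :=
  fun z hz => ⟨hz.2, fun l => by simp [Lam1_im_eq_zero hz]⟩

theorem realAxis_subset_regularSet (hq0 : q0 ≠ 0) : realAxis ⊆ regularSet q0 := by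
  rintro z ⟨hz, hz0⟩
  refine ⟨hz0, fun h => ?_⟩
  have hr : z = (z.re : ℂ) := Complex.ext (by simp) (by simp [hz])
  rw [hr] at h
  have : z.re ^ 2 + q0 ^ 2 = 0 := by exact_mod_cast h
  have := sq_nonneg z.re
  have := pow_pos (abs_pos.2 hq0) 2
  rw [sq_abs] at this
  linarith

theorem neg_mem_realAxis (hz : z ∈ realAxis) : -z ∈ realAxis :=
  ⟨by simp [hz.1], neg_ne_zero.2 hz.2⟩

theorem norm_exp_I_mul_real (s : ℝ) {ζ : ℂ} (hζ : ζ.im = 0) :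
    ‖Complex.exp (Complex.I * (s : ℂ) * ζ)‖ = 1 := by
  rw [Complex.norm_exp]
  simp [hζ]

theorem norm_colKernel_le_of_realAxis (hz : z ∈ realAxis) (j : Fin 3) (s : ℝ) :
    ‖colKernel q0 v j z s‖ ≤ ∑ l, ‖specProj q0 v l z‖ := by
  refine (norm_sum_le _ _).trans (Finset.sum_le_sum fun l _ => ?_)
  rw [norm_smul, norm_exp_I_mul_real s (by simp [Lam1_im_eq_zero hz]), one_mul]

/-- The kernel is the exponential group of a diagonalizable matrix. This allows a change of base
point in the Volterra integral. -/
theorem colKernel_add (hq0 : q0 ≠ 0) (hv : ‖v‖ = q0) (hz : z ∈ regularSet q0) (j : Fin 3)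
    (s s' : ℝ) (u : Fin 3 → ℂ) :
    colKernel q0 v j z (s + s') u = colKernel q0 v j z s (colKernel q0 v j z s' u) := by
  simp only [colKernel_eq, matCLM_apply, Matrix.mulVec_mulVec]
  congr 1
  have h := Matrix.nonsing_inv_mul _ (isUnit_det_matY hq0 hv hz)
  have h2 : ∀ D D' : Mat3, matY q0 v z * D * (matY q0 v z)⁻¹ * (matY q0 v z * D' *
      (matY q0 v z)⁻¹) = matY q0 v z * (D * D') * (matY q0 v z)⁻¹ := by
    intro D D'
    calc _ = matY q0 v z * D * ((matY q0 v z)⁻¹ * matY q0 v z) * D' * (matY q0 v z)⁻¹ := by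
          simp only [Matrix.mul_assoc]
      _ = _ := by rw [h, Matrix.mul_one]; simp only [Matrix.mul_assoc]
  rw [h2, Matrix.diagonal_mul_diagonal]
  congr 3
  funext l
  rw [← Complex.exp_add]
  congr 1
  push_cast; ring

theorem matA_sub_matA (q0 : ℝ) (z : ℂ) (u w : C2) :
    matA q0 z u - matA q0 z w = matQ (u - w) := by
  ext i j
  fin_cases i <;> fin_cases j <;> simp [matA, matQ] <;> ring

theorem mul_apply_eq_mulVec (M N : Mat3) (i j : Fin 3) :
    (M * N) i j = M.mulVec (fun k => N k j) i := rfl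

variable {q : ℝ → ℝ → C2}

/-- On the `j`-th column the right-hand exponential is a scalar, which only shifts all frequencies
by that of `j`; the matrix equation thus decouples into columns. -/
theorem volterraKernel_apply (ν : ℝ → Mat3) (x r : ℝ) (i j : Fin 3) :
    volterraKernel q0 q v t z ν x r i j = colKernel q0 v j z (x - r)
      (potCLM (fun x => q x t) v r fun k => ν r k j) i := by
  rw [colKernel_eq, volterraKernel, expDiag, expDiag, Matrix.mul_diagonal, matA_sub_matA, potCLM,
    matCLM_apply, matCLM_apply, Matrix.mulVec_mulVec]
  have h1 : matY q0 v z * Matrix.diagonal (fun l => Complex.exp (Complex.I * ((x - r : ℝ) : ℂ) *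
      (Lam1 q0 z l - Lam1 q0 z j))) = Complex.exp (Complex.I * -((x : ℂ) - r) * Lam1 q0 z j) •
      (matY q0 v z * Matrix.diagonal (fun l => Complex.exp (Complex.I * ((x : ℂ) - r) *
        Lam1 q0 z l))) := by
    rw [← Matrix.mul_smul]
    congr 1
    ext a b
    simp only [Matrix.diagonal_apply, Matrix.smul_apply, smul_eq_mul]
    split_ifs
    · rw [← Complex.exp_add]; congr 1; push_cast; ring
    · rw [mul_zero]
  rw [h1, Matrix.smul_mul, Matrix.smul_mul, Matrix.smul_mulVec, Pi.smul_apply, smul_eq_mul,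
    mul_comm]
  congr 1
  rw [← mul_apply_eq_mulVec]
  simp only [Matrix.mul_assoc]

/-- The Volterra equations hold columnwise. -/
theorem isNuMinus_iff_columns (ν : ℝ → Mat3) :
    IsNuMinus q0 q v t z ν ↔ ∀ j,
      (∀ x, IntegrableOn (fun r => colKernel q0 v j z (x - r)
        (potCLM (fun x => q x t) v r fun k => ν r k j)) (Iic x)) ∧
      ∀ x, (fun i => ν x i j) = (fun i => matY q0 v z i j) + voltOp (colKernel q0 v j z)
        (potCLM (fun x => q x t) v) (fun r k => ν r k j) x := by
  constructor
  · intro h j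
    have hint : ∀ x, IntegrableOn (fun r => colKernel q0 v j z (x - r)
        (potCLM (fun x => q x t) v r fun k => ν r k j)) (Iic x) := by
      refine fun x => Integrable.of_eval fun i => ?_
      have := (h x i j).1
      simp only [volterraKernel_apply] at this
      exact this
    refine ⟨hint, fun x => ?_⟩
    funext i
    have h1 := (h x i j).2
    simp only [volterraKernel_apply] at h1
    rw [h1, Pi.add_apply, voltOp, eval_integral fun i => (hint x).eval i]
  · intro h x i j
    simp only [volterraKernel_apply]
    refine ⟨((h j).1 x).eval i, ?_⟩
    have h1 := congrFun ((h j).2 x) i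
    rw [Pi.add_apply, voltOp, eval_integral fun i => ((h j).1 x).eval i] at h1
    exact h1

/-- No boundedness is required of `ν` in its definition, only integrability of the integrand. By the
group law the integral up to `x` is `K (x - a)` applied to part of the integral up to `a`, and on
the real axis `K` is bounded for both signs of its argument. Hence integrability at the single point
`a` bounds the solution on `(-∞, a]`. -/
theorem norm_le_of_column_equation (hq0 : q0 ≠ 0) (hv : ‖v‖ = q0) (hz : z ∈ realAxis) (j : Fin 3)
    {W : ℝ → (Fin 3 → ℂ) →L[ℂ] (Fin 3 → ℂ)} {y : Fin 3 → ℂ} {m : ℝ → Fin 3 → ℂ}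
    (hint : ∀ x, IntegrableOn (fun r => colKernel q0 v j z (x - r) (W r (m r))) (Iic x))
    (heq : ∀ x, m x = y + voltOp (colKernel q0 v j z) W m x) (a : ℝ) :
    ∃ B, ∀ x ≤ a, ‖m x‖ ≤ B := by
  set C := ∑ l, ‖specProj q0 v l z‖
  refine ⟨‖y‖ + C * ∫ r in Iic a, ‖colKernel q0 v j z (a - r) (W r (m r))‖, fun x hx => ?_⟩
  rw [heq x]
  refine (norm_add_le _ _).trans (add_le_add le_rfl ?_)
  have h1 : voltOp (colKernel q0 v j z) W m x = colKernel q0 v j z (x - a)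
      (∫ r in Iic x, colKernel q0 v j z (a - r) (W r (m r))) := by
    rw [← ContinuousLinearMap.integral_comp_comm _
      ((hint a).mono_set (Iic_subset_Iic.2 hx)), voltOp]
    refine integral_congr_ae (Eventually.of_forall fun r => ?_)
    simp only []
    rw [← colKernel_add hq0 hv (realAxis_subset_regularSet hq0 hz), sub_add_sub_cancel]
  rw [h1]
  refine (ContinuousLinearMap.le_opNorm _ _).trans ?_
  gcongr
  · exact norm_colKernel_le_of_realAxis hz j _
  · refine (norm_integral_le_integral_norm _).trans ?_
    exact setIntegral_mono_set (hint a).norm (Eventually.of_forall fun _ => norm_nonneg _)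
      (Iic_subset_Iic.2 hx).eventuallyLE

theorem exists_isVoltFamily_of_realAxis {q : ℝ → C2} (hq0 : q0 ≠ 0) (hv : ‖v‖ = q0)
    (hq : ∀ a, IntegrableOn (fun x => q x - v) (Iic a)) (j : Fin 3) (hz : z ∈ realAxis) :
    ∃ V C M, z ∈ V ∧ IsVoltFamily (colKernel q0 v j) (potCLM q v)
      (fun z i => matY q0 v z i j) V C M := by
  obtain ⟨N, -, hzN, -, C, M, h⟩ :=
    exists_isVoltFamily_nhds hq0 hv hq j (realAxis_subset_regularSet hq0 hz)
  exact ⟨N ∩ boundedSet q0 j, C, M, ⟨hzN, realAxis_subset_boundedSet q0 j hz⟩, h⟩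

/-- The matrix whose columns are the solutions of the Volterra equations. -/
def solMat (q0 : ℝ) (q : ℝ → C2) (v : C2) (z : ℂ) (x : ℝ) : Mat3 :=
  Matrix.of fun i j => colSol q0 q v j z x i

/-- Existence and uniqueness together: they identify the function picked by `Classical.epsilon` in
`nuMinus`. -/
theorem isNuMinus_iff (hq0 : q0 ≠ 0) (hv : ‖v‖ = q0)
    (hq : ∀ a, IntegrableOn (fun x => q x t - v) (Iic a)) (hz : z ∈ realAxis) (ν : ℝ → Mat3) :
    IsNuMinus q0 q v t z ν ↔ ν = solMat q0 (fun x => q x t) v z := by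
  rw [isNuMinus_iff_columns]
  constructor
  · intro h
    funext x
    ext i j
    obtain ⟨V, C, M, hzV, hV⟩ := exists_isVoltFamily_of_realAxis hq0 hv hq j hz
    have := hV.eq_voltSol hzV (norm_le_of_column_equation hq0 hv hz j (h j).1 (h j).2) (h j).1
      (h j).2
    exact congrFun (congrFun this x) i
  · rintro rfl j
    obtain ⟨V, C, M, hzV, hV⟩ := exists_isVoltFamily_of_realAxis hq0 hv hq j hz
    refine ⟨fun x => ?_, fun x => hV.voltSol_eq hzV x⟩
    refine integrableOn_voltOp_integrand hV.integrable hV.nonneg (hV.bound z hzV)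
      (hV.continuous hzV) (hV.continuous_voltSol hzV)
      (B := 2 * ‖fun i => matY q0 v z i j‖ * voltWeight (potCLM (fun x => q x t) v) C x) x
      fun r hr => ?_
    refine (norm_voltSol_le hV.integrable hV.nonneg (hV.bound z hzV) _ r).trans ?_
    have := voltWeight_mono hV.integrable hV.nonneg hr
    gcongr

theorem nuMinus_eq (hq0 : q0 ≠ 0) (hv : ‖v‖ = q0)
    (hq : ∀ a, IntegrableOn (fun x => q x t - v) (Iic a)) (hz : z ∈ realAxis) :
    nuMinus q0 q v t z = solMat q0 (fun x => q x t) v z :=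
  (isNuMinus_iff hq0 hv hq hz _).1
    (Classical.epsilon_spec ⟨_, (isNuMinus_iff hq0 hv hq hz _).2 rfl⟩)

theorem matJ_mul_matJ : matJ * matJ = 1 := by
  rw [matJ, Matrix.diagonal_mul_diagonal, ← Matrix.diagonal_one]
  congr 1
  funext i
  fin_cases i <;> simp

theorem matJ_mul_matY_mul_matJ (q0 : ℝ) (v : C2) (z : ℂ) :
    matJ * matY q0 v z * matJ = matY q0 v (-z) := by
  ext i j
  rw [matJ, Matrix.mul_diagonal, Matrix.diagonal_mul]
  fin_cases i <;> fin_cases j <;> simp [matY, div_neg]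

theorem matJ_mul_matA_mul_matJ (q0 : ℝ) (z : ℂ) (u : C2) :
    matJ * matA q0 (-z) u * matJ = -matA q0 z u := by
  ext i j
  rw [matJ, Matrix.mul_diagonal, Matrix.diagonal_mul]
  fin_cases i <;> fin_cases j <;> simp [matA, matQ, matJ, kz_neg]

theorem matJ_mul_expDiag (s : ℂ) (d : Fin 3 → ℂ) : matJ * expDiag s d = expDiag s d * matJ := by
  rw [matJ, expDiag, Matrix.diagonal_mul_diagonal, Matrix.diagonal_mul_diagonal]
  congr 1
  funext i
  rw [mul_comm]

/-- Conjugation with `J` takes `Y (z)` to `Y (-z)` and `A (-z)` to `-A (z)`, while `Λ₁` is odd in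
`z`; reversing `x` absorbs the remaining signs. -/
theorem volterraKernel_reflect (ν : ℝ → Mat3) (x r : ℝ) :
    volterraKernel q0 (fun x t => q (-x) t) v t (-z) (fun x => matJ * ν (-x) * matJ) x r =
      -(matJ * volterraKernel q0 q v t z ν (-x) (-r) * matJ) := by
  have hJ := matJ_mul_matJ
  have hinv : (matY q0 v (-z))⁻¹ = matJ * (matY q0 v z)⁻¹ * matJ := by
    have hJinv : matJ⁻¹ = matJ := Matrix.inv_eq_left_inv hJ
    rw [← matJ_mul_matY_mul_matJ, Matrix.mul_inv_rev, Matrix.mul_inv_rev, hJinv, Matrix.mul_assoc]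
  have hA : matA q0 (-z) (q (-r) t) - matA q0 (-z) v =
      -(matJ * (matA q0 z (q (-r) t) - matA q0 z v) * matJ) := by
    have h1 : ∀ u, matA q0 (-z) u = -(matJ * matA q0 z u * matJ) := fun u => by
      rw [← neg_neg z, neg_neg (-z), matJ_mul_matA_mul_matJ q0 (-z) u, neg_neg]
    rw [h1, h1, Matrix.mul_sub, Matrix.sub_mul]; abel
  have hE : ∀ s s' : ℂ, s' = -s → expDiag s (Lam1 q0 (-z)) = expDiag s' (Lam1 q0 z) := by
    rintro s _ rfl
    simp only [expDiag, Lam1_neg]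
    congr 1
    funext l
    congr 1
    ring
  have hE1 := hE ((x : ℂ) - r) (((-x : ℝ) : ℂ) - ((-r : ℝ) : ℂ)) (by push_cast; ring)
  have hE2 := hE (-((x : ℂ) - r)) (-(((-x : ℝ) : ℂ) - ((-r : ℝ) : ℂ))) (by push_cast; ring)
  simp only [volterraKernel, hinv, hA, hE1, hE2]
  rw [← matJ_mul_matY_mul_matJ q0 v z]
  have hc1 := matJ_mul_expDiag (((-x : ℝ) : ℂ) - ((-r : ℝ) : ℂ)) (Lam1 q0 z)
  have hc2 := matJ_mul_expDiag (-(((-x : ℝ) : ℂ) - ((-r : ℝ) : ℂ))) (Lam1 q0 z)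
  generalize expDiag (((-x : ℝ) : ℂ) - ((-r : ℝ) : ℂ)) (Lam1 q0 z) = E1 at *
  generalize expDiag (-(((-x : ℝ) : ℂ) - ((-r : ℝ) : ℂ))) (Lam1 q0 z) = E2 at *
  have hJm : ∀ X : Mat3, matJ * (matJ * X) = X := fun X => by
    rw [← Matrix.mul_assoc, hJ, Matrix.one_mul]
  have hc1m : ∀ X : Mat3, matJ * (E1 * X) = E1 * (matJ * X) := fun X => by
    rw [← Matrix.mul_assoc, hc1, Matrix.mul_assoc]
  simp only [Matrix.mul_assoc, Matrix.neg_mul, Matrix.mul_neg, hJm, hc1m, hc2]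

theorem matJ_mul_mul_matJ_apply (M : Mat3) (i j : Fin 3) :
    (matJ * M * matJ) i j = (![1, -1, -1] : Fin 3 → ℂ) i * (![1, -1, -1] : Fin 3 → ℂ) j * M i j := by
  rw [matJ, Matrix.mul_diagonal, Matrix.diagonal_mul]; ring

theorem isNuPlus_iff_reflect (ν : ℝ → Mat3) :
    IsNuPlus q0 q v t z ν ↔ IsNuMinus q0 (fun x t => q (-x) t) v t (-z)
      (fun x => matJ * ν (-x) * matJ) := by
  have hs : ∀ i : Fin 3, (![1, -1, -1] : Fin 3 → ℂ) i * (![1, -1, -1] : Fin 3 → ℂ) i = 1 := by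
    intro i; fin_cases i <;> simp
  have key : ∀ x i j, ((IntegrableOn (fun r => volterraKernel q0 q v t z ν (-x) r i j)
      (Ioi (-x)) ∧ ν (-x) i j = matY q0 v z i j -
        ∫ r in Ioi (-x), volterraKernel q0 q v t z ν (-x) r i j) ↔
      (IntegrableOn (fun r => volterraKernel q0 (fun x t => q (-x) t) v t (-z)
        (fun x => matJ * ν (-x) * matJ) x r i j) (Iic x) ∧
      (matJ * ν (-x) * matJ) i j = matY q0 v (-z) i j + ∫ r in Iic x,
        volterraKernel q0 (fun x t => q (-x) t) v t (-z)
        (fun x => matJ * ν (-x) * matJ) x r i j)) := by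
    -- Conjugation with `J` multiplies the entry `(i, j)` by a sign `c`, and `c² = 1` allows it to
    -- be cancelled on both sides.
    intro x i j
    set c : ℂ := (![1, -1, -1] : Fin 3 → ℂ) i * (![1, -1, -1] : Fin 3 → ℂ) j with hc
    have hcc : c * c = 1 := by
      rw [hc, mul_mul_mul_comm, hs, hs, one_mul]
    have hc0 : c ≠ 0 := fun h => by rw [h, zero_mul] at hcc; exact zero_ne_one hcc
    simp only [volterraKernel_reflect, Matrix.neg_apply, matJ_mul_mul_matJ_apply,
      ← matJ_mul_matY_mul_matJ q0 v z, ← hc]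
    have hint : IntegrableOn (fun r => -(c * volterraKernel q0 q v t z ν (-x) (-r) i j)) (Iic x) ↔
        IntegrableOn (fun r => volterraKernel q0 q v t z ν (-x) r i j) (Ioi (-x)) := by
      have h1 : IntegrableOn (fun r => volterraKernel q0 q v t z ν (-x) r i j) (Ioi (-x)) ↔
          IntegrableOn (fun r => volterraKernel q0 q v t z ν (-x) (-r) i j) (Iic x) := by
        rw [← integrableOn_Ici_iff_integrableOn_Ioi,
          ← (Measure.measurePreserving_neg (volume : Measure ℝ)).integrableOn_comp_preimage
            (Homeomorph.neg ℝ).measurableEmbedding]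
        simp [Function.comp_def]
      rw [h1]
      constructor
      · intro h
        refine (h.const_mul (-c)).congr (Eventually.of_forall fun r => ?_)
        simp only []
        rw [neg_mul_neg, ← mul_assoc, hcc, one_mul]
      · exact fun h => (h.const_mul c).neg
    have hval : ∫ r in Iic x, -(c * volterraKernel q0 q v t z ν (-x) (-r) i j) =
        -(c * ∫ r in Ioi (-x), volterraKernel q0 q v t z ν (-x) r i j) := by
      rw [integral_neg, integral_const_mul,
        integral_comp_neg_Iic x fun r => volterraKernel q0 q v t z ν (-x) r i j]
    rw [hint, hval, ← sub_eq_add_neg, ← mul_sub, mul_right_inj' hc0]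
  constructor
  · exact fun h x i j => (key x i j).1 (h (-x) i j)
  · intro h x i j
    have := (key (-x) i j).2 (h (-x) i j)
    rwa [neg_neg] at this

theorem nuPlus_eq (hq0 : q0 ≠ 0) (hv : ‖v‖ = q0)
    (hq : ∀ a, IntegrableOn (fun x => q (-x) t - v) (Iic a)) (hz : z ∈ realAxis) (x : ℝ) :
    nuPlus q0 q v t z x = matJ * solMat q0 (fun x => q (-x) t) v (-z) (-x) * matJ := by
  have hiff : ∀ ν, IsNuPlus q0 q v t z ν ↔
      (fun x => matJ * ν (-x) * matJ) = solMat q0 (fun x => q (-x) t) v (-z) := fun ν => by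
    rw [isNuPlus_iff_reflect, isNuMinus_iff (q := fun x t => q (-x) t) hq0 hv hq
      (neg_mem_realAxis hz)]
  have hJ : ∀ X : Mat3, matJ * (matJ * X * matJ) * matJ = X := fun X => by
    simp only [Matrix.mul_assoc, matJ_mul_matJ, Matrix.mul_one]
    rw [← Matrix.mul_assoc, matJ_mul_matJ, Matrix.one_mul]
  have h := (hiff _).1 (Classical.epsilon_spec (p := IsNuPlus q0 q v t z)
    ⟨fun x => matJ * solMat q0 (fun x => q (-x) t) v (-z) (-x) * matJ, (hiff _).2 (by
      funext x; simp only [neg_neg, hJ])⟩)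
  have h2 := congrFun h (-x)
  simp only [neg_neg] at h2
  rw [← h2, hJ]
  rfl

end RealAxis

/-! ### Solutions of the linear system in integrated form -/

section Lax

open Set

/-- `φ` is a solution of `φ' = B φ` in the integrated sense. -/
structure IsLaxSol (B : ℝ → Mat3) (φ : ℝ → Fin 3 → ℂ) : Prop where
  integrable : ∀ i a b, IntervalIntegrable (fun r => (B r).mulVec (φ r) i) volume a b
  eq : ∀ x i, φ x i = φ 0 i + ∫ r in (0 : ℝ)..x, (B r).mulVec (φ r) i

variable {B : ℝ → Mat3} {φ ψ : ℝ → Fin 3 → ℂ}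

theorem IsLaxSol.smul (h : IsLaxSol B φ) (c : ℂ) : IsLaxSol B fun x => c • φ x where
  integrable i a b := by
    simp only [Matrix.mulVec_smul, Pi.smul_apply, smul_eq_mul]
    exact (h.integrable i a b).const_mul c
  eq x i := by
    simp only [Matrix.mulVec_smul, Pi.smul_apply, smul_eq_mul,
      intervalIntegral.integral_const_mul]
    rw [h.eq x i]; ring

theorem IsLaxSol.congr {B' : ℝ → Mat3} (h : IsLaxSol B φ) (hB : ∀ x, B x = B' x)
    (hφ : ∀ x, φ x = ψ x) : IsLaxSol B' ψ := by
  obtain rfl : B = B' := funext hB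
  obtain rfl : φ = ψ := funext hφ
  exact h

/-- Used to pass from solutions normalized at `-∞` for the reflected potential at `-z` to solutions
normalized at `+∞` for the original one at `z`. -/
theorem IsLaxSol.reflect (h : IsLaxSol B φ) :
    IsLaxSol (fun x => -(matJ * B (-x) * matJ)) fun x => matJ.mulVec (φ (-x)) := by
  have h1 : ∀ r i, (-(matJ * B (-r) * matJ)).mulVec (matJ.mulVec (φ (-r))) i =
      -((![1, -1, -1] : Fin 3 → ℂ) i) * (B (-r)).mulVec (φ (-r)) i := by
    intro r i
    rw [Matrix.neg_mulVec, Matrix.mulVec_mulVec, Matrix.mul_assoc, matJ_mul_matJ, Matrix.mul_one,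
      ← Matrix.mulVec_mulVec, Pi.neg_apply, matJ, Matrix.mulVec_diagonal]
    ring
  refine ⟨fun i a b => ?_, fun x i => ?_⟩
  · simp only [h1]
    refine IntervalIntegrable.const_mul ?_ _
    have := (IntervalIntegrable.iff_comp_neg (f := fun r => (B r).mulVec (φ r) i)).1
      (h.integrable i (-a) (-b))
    simpa using this
  · simp only [h1, intervalIntegral.integral_const_mul]
    rw [intervalIntegral.integral_comp_neg fun r => (B r).mulVec (φ r) i, matJ,
      Matrix.mulVec_diagonal, Matrix.mulVec_diagonal, h.eq (-x) i, neg_zero,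
      intervalIntegral.integral_symm]
    ring

theorem IsLaxSol.absolutelyContinuous (h : IsLaxSol B φ) (i : Fin 3) (a b : ℝ) :
    AbsolutelyContinuousOnInterval (fun x => φ x i) a b := by
  refine absolutelyContinuousOnInterval_of_dist_le (C := 1)
    (absolutelyContinuousOnInterval_intervalIntegral (h.integrable i) 0 a b) fun x _ y _ => ?_
  rw [h.eq x i, h.eq y i, dist_add_left, one_mul]

theorem IsLaxSol.ae_hasDerivAt (h : IsLaxSol B φ) :
    ∀ᵐ x, ∀ i, HasDerivAt (fun x => φ x i) ((B x).mulVec (φ x) i) x := by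
  rw [ae_all_iff]
  intro i
  filter_upwards [ae_hasDerivAt_intervalIntegral (h.integrable i) 0] with x hx
  refine (hx.const_add (φ 0 i)).congr_of_eventuallyEq (Eventually.of_forall fun y => h.eq y i)

theorem isLaxSol_of_ae_hasDerivAt
    (hac : ∀ i a b, AbsolutelyContinuousOnInterval (fun x => φ x i) a b)
    (hint : ∀ i a b, IntervalIntegrable (fun r => (B r).mulVec (φ r) i) volume a b)
    (hd : ∀ᵐ x, ∀ i, HasDerivAt (fun x => φ x i) ((B x).mulVec (φ x) i) x) : IsLaxSol B φ := by
  refine ⟨hint, fun x i => ?_⟩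
  have h := eq_of_absolutelyContinuous_of_ae_hasDerivAt_zero
    (f := fun x => φ x i - ∫ r in (0 : ℝ)..x, (B r).mulVec (φ r) i)
    (fun a b => (hac i a b).fun_sub
      (absolutelyContinuousOnInterval_intervalIntegral (hint i) 0 a b)) (by
      filter_upwards [hd, ae_hasDerivAt_intervalIntegral (hint i) 0] with y h1 h2
      simpa using! (h1 i).sub h2) x 0
  simp only [intervalIntegral.integral_same, sub_zero] at h
  rw [← h]; ring

/-- Inner products of solutions are constant if the coefficient is skew-Hermitian. -/
theorem IsLaxSol.star_dotProduct_eq (hB : ∀ x, (B x).conjTranspose = -B x) (hφ : IsLaxSol B φ)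
    (hψ : IsLaxSol B ψ) (x y : ℝ) : star (φ x) ⬝ᵥ ψ x = star (φ y) ⬝ᵥ ψ y := by
  have hterm : ∀ i a b,
      AbsolutelyContinuousOnInterval (fun x => (starRingEnd ℂ) (φ x i) * ψ x i) a b := by
    intro i a b
    refine AbsolutelyContinuousOnInterval.fun_smul (M := ℂ) ?_ (hψ.absolutelyContinuous i a b)
    refine absolutelyContinuousOnInterval_of_dist_le (C := 1) (hφ.absolutelyContinuous i a b)
      fun x _ y _ => ?_
    rw [Complex.dist_conj_conj, one_mul]
  have hac : ∀ a b, AbsolutelyContinuousOnInterval (fun x => star (φ x) ⬝ᵥ ψ x) a b := by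
    intro a b
    have := ((hterm 0 a b).fun_add (hterm 1 a b)).fun_add (hterm 2 a b)
    simpa [dotProduct, Fin.sum_univ_three] using this
  refine eq_of_absolutelyContinuous_of_ae_hasDerivAt_zero hac ?_ x y
  filter_upwards [hφ.ae_hasDerivAt, hψ.ae_hasDerivAt] with x h1 h2
  have h3 : HasDerivAt (fun x => ∑ i, star (φ x i) * ψ x i)
      (∑ i, (star ((B x).mulVec (φ x) i) * ψ x i + star (φ x i) * (B x).mulVec (ψ x) i)) x :=
    HasDerivAt.fun_sum fun i _ => (h1 i).star.mul (h2 i)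
  have h4 : ∑ i, (star ((B x).mulVec (φ x) i) * ψ x i + star (φ x i) * (B x).mulVec (ψ x) i) =
      star ((B x).mulVec (φ x)) ⬝ᵥ ψ x + star (φ x) ⬝ᵥ (B x).mulVec (ψ x) := by
    rw [Finset.sum_add_distrib]; rfl
  rw [h4, Matrix.star_mulVec, hB, ← Matrix.dotProduct_mulVec, Matrix.neg_mulVec,
    dotProduct_neg, neg_add_cancel] at h3
  exact h3

end Lax

/-! ### The Jost solutions solve the Lax equation -/

section Jost

open Set

variable {q0 : ℝ} {v : C2} {z : ℂ} {q : ℝ → C2}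

theorem conjTranspose_matA (hz : z ∈ realAxis) (u : C2) :
    (matA q0 z u).conjTranspose = -matA q0 z u := by
  have hk : (starRingEnd ℂ) (kz q0 z) = kz q0 z := by rw [← kz_conj, conj_eq_of_mem_realAxis hz]
  ext i j
  fin_cases i <;> fin_cases j <;> simp [matA, matQ, matJ, hk]

theorem matA_mul_matY (hq0 : q0 ≠ 0) (hv : ‖v‖ = q0) (hz : z ≠ 0) :
    matA q0 z v * matY q0 v z =
      matY q0 v z * Matrix.diagonal (fun l => Complex.I * Lam1 q0 z l) := by
  have hq : (q0 : ℂ) ≠ 0 := Complex.ofReal_ne_zero.2 hq0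
  have h := sum_mul_conj hv _ _ rfl rfl
  have hI := Complex.I_sq
  ext i j
  rw [Matrix.mul_diagonal]
  fin_cases i <;> fin_cases j <;>
    simp [Matrix.mul_apply, Fin.sum_univ_three, matY, matA, matQ, matJ, Lam1, kz, lam] <;>
    field_simp <;> grind

theorem colSol_eq (hq0 : q0 ≠ 0) (hv : ‖v‖ = q0)
    (hq : ∀ a, IntegrableOn (fun x => q x - v) (Iic a)) (hz : z ∈ realAxis) (j : Fin 3) :
    Continuous (colSol q0 q v j z) ∧
    (∀ a, ∃ B, ∀ x ≤ a, ‖colSol q0 q v j z x‖ ≤ B) ∧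
    (∀ a, IntegrableOn (fun r => potCLM q v r (colSol q0 q v j z r)) (Iic a)) ∧
    ∀ x, colSol q0 q v j z x = (fun i => matY q0 v z i j) +
      voltOp (colKernel q0 v j z) (potCLM q v) (colSol q0 q v j z) x := by
  obtain ⟨V, C, M, hzV, hV⟩ := exists_isVoltFamily_of_realAxis hq0 hv hq j hz
  have hc : Continuous (colSol q0 q v j z) := hV.continuous_voltSol hzV
  have hB : ∀ a, ∃ B, ∀ x ≤ a, ‖colSol q0 q v j z x‖ ≤ B := fun a => by
    refine ⟨2 * ‖fun i => matY q0 v z i j‖ * voltWeight (potCLM q v) C a, fun r hr => ?_⟩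
    refine (norm_voltSol_le hV.integrable hV.nonneg (hV.bound z hzV) _ r).trans ?_
    have := voltWeight_mono hV.integrable hV.nonneg hr
    gcongr
  refine ⟨hc, hB, fun a => ?_, hV.voltSol_eq hzV⟩
  obtain ⟨B, hB⟩ := hB a
  exact integrableOn_potential (hV.integrable a) hc hB

/-- On the real axis the kernel is bounded, so the Volterra integral is controlled by the tail of an
integrable function. -/
theorem tendsto_colSol_atBot (hq0 : q0 ≠ 0) (hv : ‖v‖ = q0)
    (hq : ∀ a, IntegrableOn (fun x => q x - v) (Iic a)) (hz : z ∈ realAxis) (j : Fin 3) :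
    Tendsto (colSol q0 q v j z) atBot (𝓝 fun i => matY q0 v z i j) := by
  obtain ⟨hc, hB, hint, heq⟩ := colSol_eq hq0 hv hq hz j
  set C := ∑ l, ‖specProj q0 v l z‖
  have h0 := (tendsto_setIntegral_Iic_atBot fun a => (hint a).norm).const_mul C
  rw [mul_zero] at h0
  have h1 : Tendsto (voltOp (colKernel q0 v j z) (potCLM q v) (colSol q0 q v j z)) atBot
      (𝓝 0) := by
    refine squeeze_zero_norm (fun x => ?_) h0
    rw [← integral_const_mul]
    refine norm_integral_le_of_norm_le ((hint x).norm.const_mul C)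
      (Eventually.of_forall fun r => ?_)
    refine (ContinuousLinearMap.le_opNorm _ _).trans ?_
    gcongr
    exact norm_colKernel_le_of_realAxis hz j _
  have h2 := h1.const_add fun i => matY q0 v z i j
  rw [add_zero] at h2
  exact h2.congr fun x => (heq x).symm

/-- Variation of constants: in the eigenbasis `Y` the free equation is diagonal, and the potential
enters through primitives of integrable functions, which may be differentiated almost everywhere. -/
theorem isLaxSol_colSol (hq0 : q0 ≠ 0) (hv : ‖v‖ = q0)
    (hq : ∀ a, IntegrableOn (fun x => q x - v) (Iic a)) (hz : z ∈ realAxis) (j : Fin 3) :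
    IsLaxSol (fun x => matA q0 z (q x)) fun x =>
      Complex.exp (Complex.I * (x : ℂ) * Lam1 q0 z j) • colSol q0 q v j z x := by
  obtain ⟨hc, -, hint, heq⟩ := colSol_eq hq0 hv hq hz j
  have hreg := realAxis_subset_regularSet hq0 hz
  set u : ℝ → Fin 3 → ℂ := fun r => potCLM q v r (colSol q0 q v j z r) with hu
  set e : Fin 3 → ℝ → ℂ := fun l x => Complex.exp (Complex.I * (x : ℂ) * Lam1 q0 z l) with he
  set φ : ℝ → Fin 3 → ℂ := fun x => e j x • colSol q0 q v j z x with hφ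
  set Y := matY q0 v z with hY
  set g : Fin 3 → ℝ → ℂ := fun l r =>
    Complex.exp (Complex.I * (r : ℂ) * (Lam1 q0 z j - Lam1 q0 z l)) * (Y⁻¹).mulVec (u r) l with hg
  have hec : ∀ l, Continuous (e l) := fun l => by simp only [he]; fun_prop
  have hYu : ∀ l a, IntegrableOn (fun r => (Y⁻¹).mulVec (u r) l) (Iic a) := fun l a =>
    ((matCLM Y⁻¹).integrable_comp (hint a)).eval l
  have hgi : ∀ l a, IntegrableOn (g l) (Iic a) := by
    intro l a
    refine Integrable.bdd_mul (c := 1) (hYu l a) (by fun_prop) (Eventually.of_forall fun r => ?_)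
    rw [norm_exp_I_mul_real r (by simp [Lam1_im_eq_zero hz])]
  -- Splitting the exponential of `x - r` takes the dependence on `x` out of the integral; what
  -- remains is `Y e^{ixΛ₁}` applied to the unit vector `eⱼ` plus primitives.
  have hrep : ∀ x i, φ x i =
      ∑ l, Y i l * (e l x * ((if l = j then 1 else 0) + ∫ r in Iic x, g l r)) := by
    intro x i
    have h1 : ∀ i r, colKernel q0 v j z (x - r) (u r) i = ∑ l, Y i l *
        Complex.exp (Complex.I * (x : ℂ) * (Lam1 q0 z l - Lam1 q0 z j)) * g l r := by
      intro i r
      rw [colKernel_eq, matCLM_apply, ← Matrix.mulVec_mulVec, Matrix.mulVec, dotProduct]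
      refine Finset.sum_congr rfl fun l _ => ?_
      rw [Matrix.mul_diagonal]
      simp only [hg, ← hY]
      rw [mul_assoc (Y i l), mul_assoc (Y i l), ← mul_assoc (Complex.exp _), ← Complex.exp_add]
      congr 4
      push_cast; ring
    have hi : IntegrableOn (fun r => colKernel q0 v j z (x - r) (u r)) (Iic x) := by
      refine Integrable.of_eval fun i => ?_
      exact (integrable_finsetSum _ fun l _ => (hgi l x).const_mul _).congr
        (Eventually.of_forall fun r => (h1 i r).symm)
    have h2 := congrFun (heq x) i
    rw [Pi.add_apply, voltOp, eval_integral fun i => hi.eval i] at h2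
    have h3 : ∫ r in Iic x, colKernel q0 v j z (x - r) (u r) i = ∑ l, Y i l *
        Complex.exp (Complex.I * (x : ℂ) * (Lam1 q0 z l - Lam1 q0 z j)) *
          ∫ r in Iic x, g l r := by
      simp only [h1]
      rw [integral_finsetSum _ fun l _ => (hgi l x).const_mul _]
      simp only [integral_const_mul]
    have h4 : ∑ l, Y i l * (e l x * ((if l = j then 1 else 0) + ∫ r in Iic x, g l r)) =
        e j x * Y i j + ∑ l, Y i l * (e l x * ∫ r in Iic x, g l r) := by
      have : e j x * Y i j = ∑ l, Y i l * (e l x * (if l = j then 1 else 0)) := by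
        simp [mul_comm]
      rw [this, ← Finset.sum_add_distrib]
      refine Finset.sum_congr rfl fun l _ => ?_
      ring
    rw [h4, hφ]
    simp only [Pi.smul_apply, smul_eq_mul]
    rw [h2, h3, mul_add, Finset.mul_sum]
    congr 1
    refine Finset.sum_congr rfl fun l _ => ?_
    have h5 : e l x = e j x * Complex.exp (Complex.I * (x : ℂ) * (Lam1 q0 z l - Lam1 q0 z j)) := by
      simp only [he]; rw [← Complex.exp_add]; congr 1; ring
    rw [h5]; ring
  have hed : ∀ l x, HasDerivAt (e l) (Complex.I * Lam1 q0 z l * e l x) x := by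
    intro l x
    have h1 : HasDerivAt (fun x : ℝ => Complex.I * (x : ℂ) * Lam1 q0 z l)
        (Complex.I * 1 * Lam1 q0 z l) x :=
      ((Complex.ofRealCLM.hasDerivAt (x := x)).const_mul Complex.I).mul_const _
    convert! h1.cexp using 1
    simp only [he]; ring
  have hsplit : ∀ x, (matA q0 z (q x)).mulVec (φ x) =
      (matA q0 z v).mulVec (φ x) + e j x • u x := by
    intro x
    rw [← sub_eq_iff_eq_add', ← Matrix.sub_mulVec, matA_sub_matA, hφ, Matrix.mulVec_smul]
    rfl
  refine isLaxSol_of_ae_hasDerivAt ?_ ?_ ?_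
  · intro i a b
    simp only [hrep]
    have hterm : ∀ l, AbsolutelyContinuousOnInterval
        (fun x => Y i l * (e l x * ((if l = j then 1 else 0) + ∫ r in Iic x, g l r))) a b := by
      intro l
      refine AbsolutelyContinuousOnInterval.const_smul (M := ℂ) (Y i l) ?_
      refine AbsolutelyContinuousOnInterval.fun_smul (M := ℂ) ?_ ?_
      · refine ContDiffOn.absolutelyContinuousOnInterval (ContDiff.contDiffOn ?_)
        exact ((contDiff_const.mul Complex.ofRealCLM.contDiff).mul contDiff_const).cexp
      · refine absolutelyContinuousOnInterval_of_dist_le (C := 1)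
          (absolutelyContinuousOnInterval_setIntegral_Iic (hgi l) a b) fun x _ y _ => ?_
        rw [dist_add_left, one_mul]
    have := ((hterm 0).fun_add (hterm 1)).fun_add (hterm 2)
    simpa only [Fin.sum_univ_three] using this
  · intro i a b
    simp only [hsplit, Pi.add_apply, Pi.smul_apply, smul_eq_mul]
    refine IntervalIntegrable.add (Continuous.intervalIntegrable ?_ a b) ?_
    · have hφc : Continuous φ := (hec j).smul hc
      exact (continuous_apply i).comp ((matCLM (matA q0 z v)).continuous.comp hφc)
    · refine intervalIntegrable_of_Iic (fun a => ?_) a b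
      refine Integrable.bdd_mul (c := 1) ((hint a).eval i) (hec j).aestronglyMeasurable
        (Eventually.of_forall fun r => ?_)
      rw [norm_exp_I_mul_real r (Lam1_im_eq_zero hz j)]
  · have hall : ∀ᵐ x, ∀ l, HasDerivAt (fun x => ∫ r in Iic x, g l r) (g l x) x :=
      ae_all_iff.2 fun l => ae_hasDerivAt_setIntegral_Iic (hgi l)
    filter_upwards [hall] with x hx i
    simp only [hrep]
    have h1 : HasDerivAt
        (fun x => ∑ l, Y i l * (e l x * ((if l = j then 1 else 0) + ∫ r in Iic x, g l r)))
        (∑ l, Y i l * (Complex.I * Lam1 q0 z l * e l x *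
          ((if l = j then 1 else 0) + ∫ r in Iic x, g l r) + e l x * g l x)) x :=
      HasDerivAt.fun_sum fun l _ => ((hed l x).mul ((hx l).const_add _)).const_mul _
    convert! h1 using 1
    have hφY : φ x = Y.mulVec fun l => e l x * ((if l = j then 1 else 0) + ∫ r in Iic x, g l r) := by
      funext i; exact hrep x i
    rw [hsplit, Pi.add_apply, hφY, Matrix.mulVec_mulVec, matA_mul_matY hq0 hv hz.2,
      ← Matrix.mulVec_mulVec]
    have h3 : e j x • u x = Y.mulVec fun l => e l x * g l x := by
      have h4 : (fun l => e l x * g l x) = e j x • (Y⁻¹).mulVec (u x) := by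
        funext l
        simp only [hg, he, Pi.smul_apply, smul_eq_mul]
        rw [← mul_assoc, ← Complex.exp_add]
        congr 2
        ring
      rw [h4, Matrix.mulVec_smul, Matrix.mulVec_mulVec,
        Matrix.mul_nonsing_inv _ (isUnit_det_matY hq0 hv hreg), Matrix.one_mulVec]
    rw [h3, ← Pi.add_apply, ← Matrix.mulVec_add, Matrix.mulVec, dotProduct]
    refine Finset.sum_congr rfl fun l _ => ?_
    rw [Pi.add_apply, Matrix.mulVec_diagonal]
    ring

end Jost

/-! ### The scattering matrix as a product of Jost solutions -/

section Scattering

open Set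

variable {q0 : ℝ} {v : C2} {z : ℂ}

theorem conjTranspose_mul_eq_of_isLaxSol {B M N : ℝ → Mat3}
    (hB : ∀ x, (B x).conjTranspose = -B x) (hM : ∀ j, IsLaxSol B fun x k => M x k j)
    (hN : ∀ j, IsLaxSol B fun x k => N x k j) (x y : ℝ) :
    (M x).conjTranspose * N x = (M y).conjTranspose * N y := by
  ext i j
  exact (hM i).star_dotProduct_eq hB (hN j) x y

theorem expDiag_conjTranspose_mul {s : ℂ} (hs : conj s = s) {d : Fin 3 → ℂ}
    (hd : ∀ j, conj (d j) = d j) (X : Mat3) (i j : Fin 3) :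
    ((expDiag s d).conjTranspose * X * expDiag s d) i j =
      Complex.exp (Complex.I * s * (d j - d i)) * X i j := by
  have h1 : (starRingEnd ℂ) (Complex.exp (Complex.I * s * d i)) =
      Complex.exp (-(Complex.I * s * d i)) := by
    rw [← Complex.exp_conj]
    simp [hs, hd]
  rw [expDiag, Matrix.diagonal_conjTranspose, Matrix.mul_diagonal, Matrix.diagonal_mul,
    Pi.star_apply, Complex.star_def, h1, mul_right_comm, ← Complex.exp_add]
  congr 2
  ring

theorem expDiag_conjTranspose_mul_diagonal {s : ℂ} (hs : conj s = s) {d : Fin 3 → ℂ}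
    (hd : ∀ j, conj (d j) = d j) (g : Fin 3 → ℂ) :
    (expDiag s d).conjTranspose * Matrix.diagonal g * expDiag s d = Matrix.diagonal g := by
  ext i j
  rw [expDiag_conjTranspose_mul hs hd]
  by_cases h : i = j
  · subst h; simp
  · simp [Matrix.diagonal_apply_ne _ h]

theorem conj_Lam1 (hz : z ∈ realAxis) (j : Fin 3) : conj (Lam1 q0 z j) = Lam1 q0 z j :=
  Complex.conj_eq_iff_im.2 (Lam1_im_eq_zero hz j)

theorem solMat_mul_expDiag_apply (q : ℝ → C2) (x : ℝ) (k j : Fin 3) :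
    (solMat q0 q v z x * expDiag (x : ℂ) (Lam1 q0 z)) k j =
      (Complex.exp (Complex.I * (x : ℂ) * Lam1 q0 z j) • colSol q0 q v j z x) k := by
  rw [expDiag, Matrix.mul_diagonal, Pi.smul_apply, smul_eq_mul, mul_comm]; rfl

theorem isLaxSol_solMat {q : ℝ → C2} (hq0 : q0 ≠ 0) (hv : ‖v‖ = q0)
    (hq : ∀ a, IntegrableOn (fun x => q x - v) (Iic a)) (hz : z ∈ realAxis) (j : Fin 3) :
    IsLaxSol (fun x => matA q0 z (q x)) fun x k =>
      (solMat q0 q v z x * expDiag (x : ℂ) (Lam1 q0 z)) k j :=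
  (isLaxSol_colSol hq0 hv hq hz j).congr (fun _ => rfl) fun x => by
    funext k; rw [solMat_mul_expDiag_apply]

theorem conjTranspose_matY_mul_matY (hq0 : q0 ≠ 0) (hv : ‖v‖ = q0) (hz : z ∈ realAxis) :
    (matY q0 v z).conjTranspose * matY q0 v z = Matrix.diagonal (normY q0 z) := by
  rw [conjTranspose_matY, conj_eq_of_mem_realAxis hz, adjY_mul_matY hq0 hv hz.2]

/-- After removal of the unimodular exponentials the product is independent of `x`. A diagonal entry
thus equals its limit at `-∞`; an off-diagonal one has constant modulus and limit zero. -/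
theorem conjTranspose_solMat_mul_solMat {q : ℝ → C2} (hq0 : q0 ≠ 0) (hv : ‖v‖ = q0)
    (hq : ∀ a, IntegrableOn (fun x => q x - v) (Iic a)) (hz : z ∈ realAxis) (x : ℝ) :
    (solMat q0 q v z x).conjTranspose * solMat q0 q v z x = Matrix.diagonal (normY q0 z) := by
  set M := solMat q0 q v z with hM
  have hlim : ∀ i j, Tendsto (fun x => ((M x).conjTranspose * M x) i j) atBot
      (𝓝 (Matrix.diagonal (normY q0 z) i j)) := by
    intro i j
    rw [← conjTranspose_matY_mul_matY hq0 hv hz]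
    simp only [Matrix.mul_apply, Matrix.conjTranspose_apply]
    refine tendsto_finsetSum _ fun k _ => Tendsto.mul ?_ ?_
    · exact ((continuous_apply k).tendsto _ |>.comp (tendsto_colSol_atBot hq0 hv hq hz i)).star
    · exact (continuous_apply k).tendsto _ |>.comp (tendsto_colSol_atBot hq0 hv hq hz j)
  have hrel : ∀ (x : ℝ) (i j : Fin 3), Complex.exp (Complex.I * (x : ℂ) * (Lam1 q0 z j - Lam1 q0 z i)) *
      ((M x).conjTranspose * M x) i j = ((M 0).conjTranspose * M 0) i j := by
    intro x i j
    have h1 := conjTranspose_mul_eq_of_isLaxSol (fun x => conjTranspose_matA hz (q x))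
      (isLaxSol_solMat hq0 hv hq hz) (isLaxSol_solMat hq0 hv hq hz) x 0
    have h2 : ∀ x : ℝ, ((M x * expDiag (x : ℂ) (Lam1 q0 z)).conjTranspose *
        (M x * expDiag (x : ℂ) (Lam1 q0 z))) i j =
        Complex.exp (Complex.I * (x : ℂ) * (Lam1 q0 z j - Lam1 q0 z i)) *
        ((M x).conjTranspose * M x) i j := by
      intro x
      rw [← expDiag_conjTranspose_mul (Complex.conj_ofReal x) (conj_Lam1 hz),
        Matrix.conjTranspose_mul]
      simp only [Matrix.mul_assoc]
    rw [← h2, h1, h2]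
    simp
  ext i j
  by_cases hij : i = j
  · subst hij
    have hc : ∀ y, ((M y).conjTranspose * M y) i i = ((M 0).conjTranspose * M 0) i i := fun y => by
      rw [← hrel y]; simp
    rw [hc]
    exact tendsto_nhds_unique ((hlim i i).congr hc) tendsto_const_nhds |>.symm
  · have hn : ∀ y, ‖((M y).conjTranspose * M y) i j‖ = ‖((M 0).conjTranspose * M 0) i j‖ :=
      fun y => by
        rw [← hrel y, norm_mul, norm_exp_I_mul_real y (by simp [Lam1_im_eq_zero hz]), one_mul]
    have h1 := tendsto_nhds_unique ((hlim i j).norm.congr hn) tendsto_const_nhds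
    have h2 : Matrix.diagonal (normY q0 z) i j = 0 := Matrix.diagonal_apply_ne _ hij
    rw [h2, norm_zero] at h1
    rw [h2, ← norm_eq_zero, hn, ← h1]

theorem phase_eq (σ q0 x t : ℝ) (z : ℂ) (j : Fin 3) :
    phase σ q0 x t z j = Lam1 q0 z j * x + phase σ q0 0 t z j := by
  fin_cases j <;> simp [phase, Lam1]

theorem conj_phase (σ x t : ℝ) (hz : z ∈ realAxis) (j : Fin 3) :
    conj (phase σ q0 x t z j) = phase σ q0 x t z j := by
  have hk : (starRingEnd ℂ) (kz q0 z) = kz q0 z := by rw [← kz_conj, conj_eq_of_mem_realAxis hz]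
  have hl : (starRingEnd ℂ) (lam q0 z) = lam q0 z := by
    rw [← lam_conj, conj_eq_of_mem_realAxis hz]
  fin_cases j <;> simp [phase, hk, hl, map_ofNat]

/-- The time-dependent phase is a right factor constant in `x`, so it leaves the Lax equation
untouched. -/
theorem expDiag_phase (σ q0 x t : ℝ) (z : ℂ) :
    expDiag 1 (phase σ q0 x t z) =
      expDiag (x : ℂ) (Lam1 q0 z) * expDiag 1 (phase σ q0 0 t z) := by
  rw [expDiag, expDiag, expDiag, Matrix.diagonal_mul_diagonal]
  congr 1
  funext j
  rw [phase_eq, ← Complex.exp_add]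
  congr 1
  ring

theorem normY_neg (q0 : ℝ) (z : ℂ) : normY q0 (-z) = normY q0 z := by simp [normY]

variable {σ t : ℝ} {q : ℝ → ℝ → C2} {qm qp : C2}

theorem conjTranspose_matJ : matJ.conjTranspose = matJ := by
  rw [matJ, Matrix.diagonal_conjTranspose]
  congr 1
  funext i
  fin_cases i <;> simp

theorem isLaxSol_nuPlus (hq0 : q0 ≠ 0) (hqp : ‖qp‖ = q0)
    (hp : ∀ a, IntegrableOn (fun x => q (-x) t - qp) (Iic a)) (hz : z ∈ realAxis) (j : Fin 3) :
    IsLaxSol (fun x => matA q0 z (q x t)) fun x k =>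
      (nuPlus q0 q qp t z x * expDiag (x : ℂ) (Lam1 q0 z)) k j := by
  have h := ((isLaxSol_solMat hq0 hqp hp (neg_mem_realAxis hz) j).reflect).smul
    ((![1, -1, -1] : Fin 3 → ℂ) j)
  refine h.congr (fun x => ?_) fun x => ?_
  · rw [matJ_mul_matA_mul_matJ, neg_neg, neg_neg]
  · have hE : expDiag ((-x : ℝ) : ℂ) (Lam1 q0 (-z)) = expDiag (x : ℂ) (Lam1 q0 z) := by
      simp only [expDiag, Lam1_neg]
      congr 1
      funext l
      congr 1
      push_cast; ring
    funext k
    have h1 : ∀ M : Mat3, (matJ.mulVec fun k => M k j) = fun k => (matJ * M) k j := fun M => rfl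
    have h2 : ∀ A : Mat3, (A * matJ) k j = A k j * (![1, -1, -1] : Fin 3 → ℂ) j := fun A =>
      Matrix.mul_diagonal _ _ _ _
    rw [h1, hE, nuPlus_eq hq0 hqp hp hz, Pi.smul_apply, smul_eq_mul, Matrix.mul_assoc _ matJ,
      matJ_mul_expDiag, ← Matrix.mul_assoc _ (expDiag (x : ℂ) (Lam1 q0 z)), h2, mul_comm,
      Matrix.mul_assoc]

theorem conjTranspose_nuPlus_mul_nuPlus (hq0 : q0 ≠ 0) (hqp : ‖qp‖ = q0)
    (hp : ∀ a, IntegrableOn (fun x => q (-x) t - qp) (Iic a)) (hz : z ∈ realAxis) (x : ℝ) :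
    (nuPlus q0 q qp t z x).conjTranspose * nuPlus q0 q qp t z x =
      Matrix.diagonal (normY q0 z) := by
  rw [nuPlus_eq hq0 hqp hp hz]
  set M := solMat q0 (fun x => q (-x) t) qp (-z) (-x) with hM
  have h1 : M.conjTranspose * M = Matrix.diagonal (normY q0 z) := by
    rw [← normY_neg]
    exact conjTranspose_solMat_mul_solMat hq0 hqp hp (neg_mem_realAxis hz) (-x)
  have h2 : (matJ * M * matJ).conjTranspose * (matJ * M * matJ) =
      matJ * (M.conjTranspose * M) * matJ := by
    rw [Matrix.conjTranspose_mul, Matrix.conjTranspose_mul, conjTranspose_matJ]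
    have : ∀ X : Mat3, matJ * (matJ * X) = X := fun X => by
      rw [← Matrix.mul_assoc, matJ_mul_matJ, Matrix.one_mul]
    simp only [Matrix.mul_assoc, this]
  rw [h2, h1]
  ext i j
  rw [matJ_mul_mul_matJ_apply]
  by_cases hij : i = j
  · subst hij
    fin_cases i <;> simp
  · simp [Matrix.diagonal_apply_ne _ hij]

variable (hq0 : q0 ≠ 0) (hqm : ‖qm‖ = q0) (hqp : ‖qp‖ = q0)
  (hm : ∀ a, IntegrableOn (fun x => q x t - qm) (Iic a))
  (hp : ∀ a, IntegrableOn (fun x => q (-x) t - qp) (Iic a)) (hz : z ∈ realAxis)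

theorem conjTranspose_mul_expDiag_phase {M : Mat3} (hz : z ∈ realAxis)
    (h : M.conjTranspose * M = Matrix.diagonal (normY q0 z)) (x : ℝ) :
    (M * expDiag 1 (phase σ q0 x t z)).conjTranspose * (M * expDiag 1 (phase σ q0 x t z)) =
      Matrix.diagonal (normY q0 z) := by
  rw [Matrix.conjTranspose_mul, Matrix.mul_assoc, ← Matrix.mul_assoc M.conjTranspose, h,
    ← Matrix.mul_assoc]
  exact expDiag_conjTranspose_mul_diagonal (map_one _) (conj_phase σ x t hz) _

include hq0 hqp hp hz in
theorem conjTranspose_psiPlus_mul_psiPlus (x : ℝ) :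
    (psiPlus σ q0 q qp x t z).conjTranspose * psiPlus σ q0 q qp x t z =
      Matrix.diagonal (normY q0 z) :=
  conjTranspose_mul_expDiag_phase hz (conjTranspose_nuPlus_mul_nuPlus hq0 hqp hp hz x) x

include hq0 hqm hm hz in
theorem conjTranspose_psiMinus_mul_psiMinus (x : ℝ) :
    (psiMinus σ q0 q qm x t z).conjTranspose * psiMinus σ q0 q qm x t z =
      Matrix.diagonal (normY q0 z) := by
  refine conjTranspose_mul_expDiag_phase hz ?_ x
  rw [nuMinus_eq hq0 hqm hm hz]
  exact conjTranspose_solMat_mul_solMat hq0 hqm hm hz x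

include hq0 hqm hqp hm hp hz in
theorem conjTranspose_psiPlus_mul_psiMinus (x y : ℝ) :
    (psiPlus σ q0 q qp x t z).conjTranspose * psiMinus σ q0 q qm x t z =
      (psiPlus σ q0 q qp y t z).conjTranspose * psiMinus σ q0 q qm y t z := by
  have h := conjTranspose_mul_eq_of_isLaxSol (fun x => conjTranspose_matA hz (q x t))
    (isLaxSol_nuPlus hq0 hqp hp hz) (isLaxSol_solMat hq0 hqm hm hz) x y
  rw [← nuMinus_eq hq0 hqm hm hz] at h
  have hP : ∀ X Y P : Mat3, (X * P).conjTranspose * (Y * P) =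
      P.conjTranspose * (X.conjTranspose * Y) * P := fun X Y P => by
    rw [Matrix.conjTranspose_mul]; simp only [Matrix.mul_assoc]
  simp only [psiPlus, psiMinus, expDiag_phase σ q0 x, expDiag_phase σ q0 y]
  rw [← Matrix.mul_assoc (nuPlus q0 q qp t z x), ← Matrix.mul_assoc (nuPlus q0 q qp t z y),
    ← Matrix.mul_assoc (nuMinus q0 q qm t z x), ← Matrix.mul_assoc (nuMinus q0 q qm t z y),
    hP _ _ (expDiag 1 _), hP _ _ (expDiag 1 _), h]

theorem inv_diagonal_normY_mul (hz : z ∈ regularSet q0) :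
    Matrix.diagonal (fun l => (normY q0 z l)⁻¹) * Matrix.diagonal (normY q0 z) = 1 := by
  rw [Matrix.diagonal_mul_diagonal, ← Matrix.diagonal_one]
  congr 1
  funext l
  exact inv_mul_cancel₀ (normY_ne_zero hz l)

include hq0 hqm hqp hm hp hz in
-- The matrix `diag (normY)⁻¹ ψ₊†` is a left inverse of `ψ₊`, hence two-sided. Constancy of `ψ₊† ψ₋`
-- in `x` then provides a scattering matrix, and invertibility of `ψ₊ (0)` leaves only one.
theorem scatS_eq : scatS σ q0 q qm qp t z = Matrix.diagonal (fun l => (normY q0 z l)⁻¹) *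
    ((psiPlus σ q0 q qp 0 t z).conjTranspose * psiMinus σ q0 q qm 0 t z) := by
  set D : Mat3 := Matrix.diagonal fun l => (normY q0 z l)⁻¹
  have hD := inv_diagonal_normY_mul (realAxis_subset_regularSet hq0 hz)
  have hleft : ∀ x, D * (psiPlus σ q0 q qp x t z).conjTranspose * psiPlus σ q0 q qp x t z = 1 :=
    fun x => by
      rw [Matrix.mul_assoc, conjTranspose_psiPlus_mul_psiPlus hq0 hqp hp hz, hD]
  have hspec := Classical.epsilon_spec (p := fun S : Mat3 =>
    ∀ x : ℝ, psiMinus σ q0 q qm x t z = psiPlus σ q0 q qp x t z * S)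
    ⟨D * ((psiPlus σ q0 q qp 0 t z).conjTranspose * psiMinus σ q0 q qm 0 t z), fun x => by
      rw [conjTranspose_psiPlus_mul_psiMinus hq0 hqm hqp hm hp hz 0 x, ← Matrix.mul_assoc D,
        ← Matrix.mul_assoc, mul_eq_one_comm.1 (hleft x), Matrix.one_mul]⟩
  rw [hspec 0, ← Matrix.mul_assoc, ← Matrix.mul_assoc, hleft, Matrix.one_mul]
  rfl

include hq0 hqm hqp hm hp hz in
-- The same computation with the roles of `ψ±` exchanged; it works because both have the same Gram
-- matrix `diag (normY)`.
theorem scatH_eq : scatH σ q0 q qm qp t z = Matrix.diagonal (fun l => (normY q0 z l)⁻¹) *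
    ((psiMinus σ q0 q qm 0 t z).conjTranspose * psiPlus σ q0 q qp 0 t z) := by
  set D : Mat3 := Matrix.diagonal fun l => (normY q0 z l)⁻¹
  have hD := inv_diagonal_normY_mul (realAxis_subset_regularSet hq0 hz)
  have hleft : D * (psiPlus σ q0 q qp 0 t z).conjTranspose * psiPlus σ q0 q qp 0 t z = 1 := by
    rw [Matrix.mul_assoc, conjTranspose_psiPlus_mul_psiPlus hq0 hqp hp hz, hD]
  refine Matrix.inv_eq_left_inv ?_
  rw [scatS_eq hq0 hqm hqp hm hp hz]
  calc D * ((psiMinus σ q0 q qm 0 t z).conjTranspose * psiPlus σ q0 q qp 0 t z) *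
        (D * ((psiPlus σ q0 q qp 0 t z).conjTranspose * psiMinus σ q0 q qm 0 t z))
      = D * (psiMinus σ q0 q qm 0 t z).conjTranspose * (psiPlus σ q0 q qp 0 t z *
        (D * (psiPlus σ q0 q qp 0 t z).conjTranspose)) * psiMinus σ q0 q qm 0 t z := by
        simp only [Matrix.mul_assoc]
    _ = 1 := by
        rw [mul_eq_one_comm.1 hleft, Matrix.mul_one, Matrix.mul_assoc,
          conjTranspose_psiMinus_mul_psiMinus hq0 hqm hm hz, hD]

/-- The signs on the diagonal of `J`. -/
def sgnJ : Fin 3 → ℂ := ![1, -1, -1]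

/-- The value at `x = 0` of the `j`-th column of the modified eigenfunction normalized at `+∞`,
at the point `z̄`. -/
def colPlus (q0 : ℝ) (q : ℝ → C2) (v : C2) (j : Fin 3) (z : ℂ) (i : Fin 3) : ℂ :=
  sgnJ i * sgnJ j * colSol q0 (fun x => q (-x)) v j (-conj z) 0 i

/-- The diagonal entries of the scattering matrix in terms of the columns of the modified
eigenfunctions at `x = 0`. -/
def scatFun (q0 : ℝ) (q : ℝ → C2) (qm qp : C2) (j : Fin 3) (z : ℂ) : ℂ :=
  (normY q0 z j)⁻¹ * ∑ i, conj (colPlus q0 q qp j z i) * colSol q0 q qm j z 0 i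

include hq0 hqm hqp hm hp hz

/-- On the diagonal the two phase factors are conjugate unimodular numbers and cancel. What is left
involves only the modified columns, which make sense off the real axis. -/
theorem scatS_apply_self (j : Fin 3) :
    scatS σ q0 q qm qp t z j j = scatFun q0 (fun x => q x t) qm qp j z := by
  rw [scatS_eq hq0 hqm hqp hm hp hz, Matrix.diagonal_mul, scatFun, psiPlus, psiMinus,
    Matrix.conjTranspose_mul, Matrix.mul_assoc, ← Matrix.mul_assoc (nuPlus q0 q qp t z 0).conjTranspose,
    ← Matrix.mul_assoc, expDiag_conjTranspose_mul (map_one _) (conj_phase σ 0 t hz), sub_self,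
    mul_zero, Complex.exp_zero, one_mul, Matrix.mul_apply]
  congr 1
  refine Finset.sum_congr rfl fun i _ => ?_
  rw [Matrix.conjTranspose_apply, nuMinus_eq hq0 hqm hm hz, nuPlus_eq hq0 hqp hp hz,
    matJ_mul_mul_matJ_apply, neg_zero, colPlus, conj_eq_of_mem_realAxis hz]
  rfl

theorem scatH_apply_self (j : Fin 3) :
    scatH σ q0 q qm qp t z j j = conj (scatFun q0 (fun x => q x t) qm qp j (conj z)) := by
  have hn : conj (normY q0 z j) = normY q0 z j := by
    have hc : (starRingEnd ℂ) z = z := conj_eq_of_mem_realAxis hz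
    fin_cases j <;> simp [normY, hc]
  rw [scatH_eq hq0 hqm hqp hm hp hz, Matrix.diagonal_mul, conj_eq_of_mem_realAxis hz, scatFun,
    psiPlus, psiMinus, Matrix.conjTranspose_mul, Matrix.mul_assoc,
    ← Matrix.mul_assoc (nuMinus q0 q qm t z 0).conjTranspose,
    ← Matrix.mul_assoc, expDiag_conjTranspose_mul (map_one _) (conj_phase σ 0 t hz), sub_self,
    mul_zero, Complex.exp_zero, one_mul, Matrix.mul_apply, map_mul, map_inv₀, hn, map_sum]
  congr 1
  refine Finset.sum_congr rfl fun i _ => ?_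
  rw [Matrix.conjTranspose_apply, nuMinus_eq hq0 hqm hm hz, nuPlus_eq hq0 hqp hp hz,
    matJ_mul_mul_matJ_apply, neg_zero, colPlus, conj_eq_of_mem_realAxis hz, map_mul,
    Complex.conj_conj, mul_comm]
  rfl

end Scattering

/-! ### Where the kernels are bounded -/

section Domains

open Set

variable {q0 : ℝ} {z : ℂ}

/-- The frequency differences are `z`, `q₀²/z` and their sum. With `β = q₀²/|z|²` their signs depend
only on the half plane and on whether `|z|` exceeds `q₀`, which is where the domains come from. -/
theorem Lam1_sub_im (q0 : ℝ) (z : ℂ) :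
    ∃ β : ℝ, β = q0 ^ 2 / ‖z‖ ^ 2 ∧
      ((Lam1 q0 z 1 - Lam1 q0 z 0).im = z.im ∧ (Lam1 q0 z 2 - Lam1 q0 z 0).im = (1 - β) * z.im) ∧
      (Lam1 q0 z 2 - Lam1 q0 z 1).im = -(β * z.im) := by
  refine ⟨_, rfl, ?_⟩
  have h1 : Lam1 q0 z 1 - Lam1 q0 z 0 = z := by
    simp only [Lam1, Matrix.cons_val]
    rw [sub_neg_eq_add, kz_add_lam]
  have h2 : Lam1 q0 z 2 - Lam1 q0 z 1 = (q0 : ℂ) ^ 2 / z := by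
    simp only [Lam1, Matrix.cons_val]
    exact lam_sub_kz q0 z
  have h3 : ((q0 : ℂ) ^ 2 / z).im = -(q0 ^ 2 / ‖z‖ ^ 2 * z.im) := by
    rw [← Complex.normSq_eq_norm_sq, Complex.div_im]
    have : ((q0 : ℂ) ^ 2).im = 0 := by rw [← Complex.ofReal_pow, Complex.ofReal_im]
    have h' : ((q0 : ℂ) ^ 2).re = q0 ^ 2 := by rw [← Complex.ofReal_pow, Complex.ofReal_re]
    rw [this, h']; ring
  have h4 : Lam1 q0 z 2 - Lam1 q0 z 0 = (Lam1 q0 z 2 - Lam1 q0 z 1) + z := by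
    linear_combination h1
  refine ⟨⟨by rw [h1], ?_⟩, by rw [h2, h3]⟩
  rw [h4, h2, Complex.add_im, h3]; ring

theorem sDomain_subset_boundedSet (hq0 : 0 < q0) (j : Fin 3) :
    sDomain q0 j ⊆ boundedSet q0 j := by
  intro z hz
  have hz0 : z ≠ 0 := by
    rintro rfl
    fin_cases j <;> simp [sDomain] at hz
  refine ⟨hz0, ?_⟩
  obtain ⟨β, hβ, ⟨h10, h20⟩, h21⟩ := Lam1_sub_im q0 z
  have hn : 0 < ‖z‖ ^ 2 := by positivity
  have hβ0 : 0 ≤ β := by rw [hβ]; positivity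
  rw [Complex.sub_im] at h10 h20 h21
  simp only [Complex.sub_im]
  fin_cases j
  · obtain ⟨h1, h2⟩ : 0 < z.im ∧ q0 < ‖z‖ := hz
    have : β ≤ 1 := by
      rw [hβ, div_le_one hn]
      exact pow_le_pow_left₀ hq0.le h2.le 2
    have h3 : 0 ≤ (1 - β) * z.im := mul_nonneg (by linarith) h1.le
    intro l
    fin_cases l <;> simp <;> linarith
  · have h1 : z.im < 0 := hz
    have h3 : 0 ≤ β * -z.im := mul_nonneg hβ0 (by linarith)
    intro l
    fin_cases l <;> simp <;> linarith
  · obtain ⟨h1, h2⟩ : 0 < z.im ∧ ‖z‖ < q0 := hz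
    have : 1 ≤ β := by
      rw [hβ, one_le_div hn]
      exact pow_le_pow_left₀ (norm_nonneg _) h2.le 2
    have h3 : 0 ≤ (β - 1) * z.im := mul_nonneg (by linarith) h1.le
    have h4 : 0 ≤ β * z.im := mul_nonneg hβ0 h1.le
    intro l
    fin_cases l <;> simp <;> linarith

theorem isOpen_sDomain (q0 : ℝ) (j : Fin 3) : IsOpen (sDomain q0 j) := by
  fin_cases j
  · exact (isOpen_lt continuous_const Complex.continuous_im).inter
      (isOpen_lt continuous_const continuous_norm)
  · exact isOpen_lt Complex.continuous_im continuous_const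
  · exact (isOpen_lt continuous_const Complex.continuous_im).inter
      (isOpen_lt continuous_norm continuous_const)

theorem mem_regularSet (hz : z ≠ 0) (h1 : z ≠ -(Complex.I * q0)) (h2 : z ≠ Complex.I * q0) :
    z ∈ regularSet q0 := by
  refine ⟨hz, fun h => ?_⟩
  have : (z + Complex.I * q0) * (z - Complex.I * q0) = 0 := by
    rw [← h]; ring_nf; rw [Complex.I_sq]; ring
  rcases mul_eq_zero.1 this with h | h
  · exact h1 (eq_neg_of_add_eq_zero_left h)
  · exact h2 (sub_eq_zero.1 h)

theorem norm_I_mul (hq0 : 0 < q0) : ‖Complex.I * (q0 : ℂ)‖ = q0 := by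
  rw [norm_mul, Complex.norm_I, one_mul, Complex.norm_real, Real.norm_of_nonneg hq0.le]

/-- The singular points `±i q₀` lie on `|z| = q₀`, which the first and third domains avoid; the
second contains only the lower one. -/
theorem mem_regularSet_of_mem_sDomain (hq0 : 0 < q0) {j : Fin 3} (hz : z ∈ sDomain q0 j)
    (h : z ≠ -(Complex.I * q0)) : z ∈ regularSet q0 := by
  refine mem_regularSet (sDomain_subset_boundedSet hq0 j hz).1 h ?_
  rintro rfl
  have hn := norm_I_mul hq0
  fin_cases j
  · have : q0 < ‖Complex.I * (q0 : ℂ)‖ := hz.2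
    linarith
  · have : (Complex.I * (q0 : ℂ)).im < 0 := hz
    simp at this
    linarith
  · have : ‖Complex.I * (q0 : ℂ)‖ < q0 := hz.2
    linarith

/-- The map `z ↦ -z̄` keeps imaginary parts of the frequencies, so the columns from `+∞` and `-∞`
entering `scatFun` are controlled on the same set. -/
theorem neg_conj_mem_boundedSet {j : Fin 3} (hz : z ∈ boundedSet q0 j) :
    -conj z ∈ boundedSet q0 j := by
  refine ⟨by simpa using hz.1, fun l => ?_⟩
  rw [Lam1_neg, Lam1_neg, Lam1_conj, Lam1_conj]
  have := hz.2 l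
  simp only [Complex.sub_im, Complex.neg_im, Complex.conj_im] at this ⊢
  linarith

theorem neg_conj_mem_regularSet (hz : z ∈ regularSet q0) : -conj z ∈ regularSet q0 := by
  refine ⟨by simpa using hz.1, fun h => hz.2 ?_⟩
  have := congrArg conj h
  simpa using this

end Domains

/-! ### Continuity and holomorphy of the scattering coefficients -/

section Regularity

open Set

variable {q0 : ℝ} {z : ℂ} {q : ℝ → C2} {qm qp : C2}

theorem continuousOn_scatFun (hq0 : q0 ≠ 0) (hqm : ‖qm‖ = q0) (hqp : ‖qp‖ = q0)
    (hm : ∀ a, IntegrableOn (fun x => q x - qm) (Iic a))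
    (hp : ∀ a, IntegrableOn (fun x => q (-x) - qp) (Iic a)) (j : Fin 3) :
    ContinuousOn (scatFun q0 q qm qp j) (boundedSet q0 j ∩ regularSet q0) := by
  have h1 : ContinuousOn (fun z => (normY q0 z j)⁻¹) (boundedSet q0 j ∩ regularSet q0) :=
    ((differentiableOn_normY q0 j).continuousOn.mono fun z hz => hz.2.1).inv₀
      fun z hz => normY_ne_zero hz.2 j
  have h2 := continuousOn_colSol hq0 hqm hm j 0
  have h3 : ContinuousOn (fun z => colSol q0 (fun x => q (-x)) qp j (-conj z) 0)
      (boundedSet q0 j ∩ regularSet q0) :=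
    (continuousOn_colSol hq0 hqp hp j 0).comp (Complex.continuous_conj.neg).continuousOn
      fun z hz => ⟨neg_conj_mem_boundedSet hz.1, neg_conj_mem_regularSet hz.2⟩
  refine h1.mul (continuousOn_finsetSum _ fun i _ => ContinuousOn.mul ?_ ?_)
  · exact Complex.continuous_conj.comp_continuousOn
      (continuousOn_const.mul ((continuous_apply i).comp_continuousOn h3))
  · exact (continuous_apply i).comp_continuousOn h2

theorem differentiableOn_scatFun (hq0 : q0 ≠ 0) (hqm : ‖qm‖ = q0) (hqp : ‖qp‖ = q0)
    (hm : ∀ a, IntegrableOn (fun x => q x - qm) (Iic a))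
    (hp : ∀ a, IntegrableOn (fun x => q (-x) - qp) (Iic a)) (j : Fin 3) {U : Set ℂ}
    (hU : IsOpen U) (hUb : U ⊆ boundedSet q0 j) (hUr : U ⊆ regularSet q0) :
    DifferentiableOn ℂ (scatFun q0 q qm qp j) U := by
  have h1 : DifferentiableOn ℂ (fun z => (normY q0 z j)⁻¹) U :=
    ((differentiableOn_normY q0 j).mono fun z hz => (hUr hz).1).inv
      fun z hz => normY_ne_zero (hUr hz) j
  have h2 := differentiableOn_colSol hq0 hqm hm j 0 hU hUb hUr
  set V : Set ℂ := (fun z => -conj z) ⁻¹' U with hV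
  have hVo : IsOpen V := hU.preimage Complex.continuous_conj.neg
  have hinv : ∀ w : ℂ, -conj (-conj w) = w := fun w => by simp
  have h3 := differentiableOn_colSol hq0 hqp hp j 0 hVo
    (fun w hw => by have := neg_conj_mem_boundedSet (hUb hw); rwa [hinv] at this)
    (fun w hw => by have := neg_conj_mem_regularSet (hUr hw); rwa [hinv] at this)
  refine h1.mul (DifferentiableOn.fun_sum fun i _ => DifferentiableOn.mul ?_
    (differentiableOn_pi.1 h2 i))
  intro z hz
  refine DifferentiableAt.differentiableWithinAt ?_
  have hzV : -conj z ∈ V := by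
    show -conj (-conj z) ∈ U
    rwa [hinv]
  have h4 : DifferentiableAt ℂ
      (fun w => sgnJ i * sgnJ j * colSol q0 (fun x => q (-x)) qp j (-w) 0 i) (conj z) := by
    have h5 := (differentiableOn_pi.1 h3 i).differentiableAt (hVo.mem_nhds hzV)
    exact (DifferentiableAt.comp (g := fun w => colSol q0 (fun x => q (-x)) qp j w 0 i)
      (f := fun w : ℂ => -w) (conj z) h5 differentiableAt_id.neg).const_mul _
  -- The outer conjugation undoes the one in the argument, so the conjugated column is holomorphic
  -- in `z`.
  have h6 := h4.star_star
  simpa [Function.comp_def, colPlus] using! h6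

end Regularity

/-! ### Removing the singularity at `-i q₀` -/

section BranchPoint

open Set

variable {q0 : ℝ} {v : C2} {z : ℂ}

/-- Mean value inequality on the half plane `Im w ≥ c`, where the derivative is at most `s e^{-sc} ≤
1/c`. The bound is uniform in `s`. -/
theorem norm_exp_sub_exp_le {c : ℝ} (hc : 0 < c) {s : ℝ} (hs : 0 ≤ s) {a b : ℂ}
    (ha : c ≤ a.im) (hb : c ≤ b.im) :
    ‖Complex.exp (Complex.I * (s : ℂ) * a) - Complex.exp (Complex.I * (s : ℂ) * b)‖ ≤
      ‖a - b‖ / c := by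
  have hconv : Convex ℝ {w : ℂ | c ≤ w.im} := convex_halfSpace_im_ge c
  have hbound : s * Real.exp (-(s * c)) ≤ 1 / c := by
    rw [Real.exp_neg, ← div_eq_mul_inv, div_le_div_iff₀ (Real.exp_pos _) hc, one_mul]
    linarith [Real.add_one_le_exp (s * c)]
  have h := hconv.norm_image_sub_le_of_norm_hasDerivWithin_le (C := 1 / c)
    (f := fun w => Complex.exp (Complex.I * (s : ℂ) * w))
    (f' := fun w => Complex.exp (Complex.I * (s : ℂ) * w) * (Complex.I * (s : ℂ)))
    (fun w _ => by
      have : HasDerivAt (fun w : ℂ => Complex.I * (s : ℂ) * w) (Complex.I * (s : ℂ)) w := by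
        simpa using! (hasDerivAt_id w).const_mul (Complex.I * (s : ℂ))
      exact this.cexp.hasDerivWithinAt)
    (fun w (hw : c ≤ w.im) => by
      refine le_trans ?_ hbound
      have h1 : (Complex.I * (s : ℂ) * w).re = -(s * w.im) := by simp
      rw [norm_mul, norm_mul, Complex.norm_I, one_mul, Complex.norm_real,
        Real.norm_of_nonneg hs, Complex.norm_exp, h1, mul_comm]
      gcongr) (show b ∈ {w : ℂ | c ≤ w.im} from hb) (show a ∈ {w : ℂ | c ≤ w.im} from ha)
  exact h.trans (le_of_eq (by ring))

/-- The numerators of the spectral projections. -/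
def specNum (q0 : ℝ) (v : C2) (l : Fin 3) (z : ℂ) : (Fin 3 → ℂ) →L[ℂ] (Fin 3 → ℂ) :=
  matCLM (Matrix.of fun i j => matY q0 v z i l * adjY q0 v z l j)

theorem continuousOn_specNum (q0 : ℝ) (v : C2) (l : Fin 3) :
    ContinuousOn (specNum q0 v l) {z | z ≠ 0} :=
  (differentiableOn_matCLM fun i j =>
    (differentiableOn_matY q0 v i l).mul (differentiableOn_adjY q0 v l j)).continuousOn

theorem specProj_eq (hq0 : q0 ≠ 0) (hv : ‖v‖ = q0) (hz : z ∈ regularSet q0) (l : Fin 3) :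
    specProj q0 v l z = (normY q0 z l)⁻¹ • specNum q0 v l z := by
  rw [specProj, specNum, ← map_smul]
  congr 1
  ext i j
  simp only [Matrix.smul_apply, Matrix.of_apply, smul_eq_mul, inv_matY_apply hq0 hv hz]
  ring

theorem sum_specProj (hq0 : q0 ≠ 0) (hv : ‖v‖ = q0) (hz : z ∈ regularSet q0) :
    ∑ l, specProj q0 v l z = ContinuousLinearMap.id ℂ (Fin 3 → ℂ) := by
  have h := Matrix.mul_nonsing_inv _ (isUnit_det_matY hq0 hv hz)
  ext1 u
  simp only [specProj, ← map_sum, matCLM_apply, ContinuousLinearMap.id_apply]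
  have h2 : (∑ l, Matrix.of fun i j => matY q0 v z i l * (matY q0 v z)⁻¹ l j) = (1 : Mat3) := by
    rw [← h]
    ext i j
    simp only [Matrix.sum_apply, Matrix.of_apply]
    rw [Matrix.mul_apply]
  rw [h2, Matrix.one_mulVec]

/-- The kernel of the second column is bounded near the branch point `-i q0`. -/
theorem norm_colKernel_one_le (hq0 : 0 < q0) (hv : ‖v‖ = q0) (hz : z ∈ regularSet q0) {c : ℝ}
    (hc : 0 < c) (h1 : c ≤ (-z).im) (h2 : c ≤ ((q0 : ℂ) ^ 2 / z).im) {s : ℝ} (hs : 0 ≤ s) :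
    ‖colKernel q0 v 1 z s‖ ≤ 1 + 2 * ‖specNum q0 v 1 z‖ + ‖z‖ / c * ‖specNum q0 v 2 z‖ := by
  set E0 := Complex.exp (Complex.I * (s : ℂ) * (-z)) with hE0
  set E2 := Complex.exp (Complex.I * (s : ℂ) * ((q0 : ℂ) ^ 2 / z)) with hE2
  have hd0 : Lam1 q0 z 0 - Lam1 q0 z 1 = -z := by
    simp only [Lam1, Matrix.cons_val]
    linear_combination -kz_add_lam q0 z
  have hd2 : Lam1 q0 z 2 - Lam1 q0 z 1 = (q0 : ℂ) ^ 2 / z := by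
    simp only [Lam1, Matrix.cons_val]
    exact lam_sub_kz q0 z
  have hsum := sum_specProj hq0.ne' hv hz
  rw [Fin.sum_univ_three] at hsum
  have hP1 : specProj q0 v 1 z = specNum q0 v 1 z := by
    rw [specProj_eq hq0.ne' hv hz]; simp [normY]
  -- The projection with index `0` is eliminated by the resolution of the identity, so the pole of
  -- `normY⁻¹` appears only against the difference `E2 - E0`.
  have hK : colKernel q0 v 1 z s = E0 • ContinuousLinearMap.id ℂ (Fin 3 → ℂ) +
      (1 - E0) • specNum q0 v 1 z + ((E2 - E0) * (normY q0 z 2)⁻¹) • specNum q0 v 2 z := by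
    rw [colKernel, Fin.sum_univ_three, hd0, hd2, sub_self, mul_zero, Complex.exp_zero, ← hsum,
      ← hP1, mul_smul, ← specProj_eq hq0.ne' hv hz]
    module
  have hn0 : ‖E0‖ ≤ 1 := norm_exp_I_mul_le_one hs (hc.le.trans h1)
  have hdiff : ‖(E2 - E0) * (normY q0 z 2)⁻¹‖ ≤ ‖z‖ / c := by
    have h3 := norm_exp_sub_exp_le hc hs h2 h1
    have hz0 := hz.1
    -- The two frequencies differ by a multiple of `normY`, which cancels the pole.
    have h4 : (q0 : ℂ) ^ 2 / z - -z = z * normY q0 z 2 := by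
      simp only [normY, Matrix.cons_val]; field_simp; ring
    rw [h4, norm_mul] at h3
    have h5 : 0 < ‖normY q0 z 2‖ := norm_pos_iff.2 (normY_ne_zero hz 2)
    rw [norm_mul, norm_inv, ← div_eq_mul_inv, div_le_iff₀ h5]
    refine h3.trans (le_of_eq ?_)
    ring
  rw [hK]
  refine (norm_add_le _ _).trans (add_le_add ((norm_add_le _ _).trans (add_le_add ?_ ?_)) ?_)
  · rw [norm_smul]
    exact mul_le_one₀ hn0 (norm_nonneg _) ContinuousLinearMap.norm_id_le
  · rw [norm_smul]
    gcongr
    refine (norm_sub_le _ _).trans ?_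
    rw [norm_one]; linarith
  · rw [norm_smul]
    gcongr

/-- The identity `Im (q₀²/z) = q₀² Im (-z) / |z|²` with `Im (-z) ≥ q₀/2` and `|z| ≤ 2q₀` yields the
constant `q₀/8`. -/
theorem branch_ball (hq0 : 0 < q0) (hz : z ∈ Metric.ball (-(Complex.I * (q0 : ℂ))) (q0 / 2)) :
    q0 / 2 ≤ (-z).im ∧ ‖z‖ ≤ 2 * q0 ∧ z ≠ 0 ∧ q0 / 8 ≤ ((q0 : ℂ) ^ 2 / z).im := by
  rw [Metric.mem_ball, dist_eq_norm] at hz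
  have h1 : q0 / 2 ≤ (-z).im := by
    have := (abs_le.1 ((Complex.abs_im_le_norm (z - -(Complex.I * (q0 : ℂ)))).trans hz.le)).2
    simp at this ⊢
    linarith
  have h2 : ‖z‖ ≤ 2 * q0 := by
    have h := norm_add_le (z - -(Complex.I * (q0 : ℂ))) (-(Complex.I * (q0 : ℂ)))
    rw [sub_add_cancel, norm_neg (Complex.I * (q0 : ℂ)), norm_I_mul hq0] at h
    linarith
  have h3 : z ≠ 0 := by
    rintro rfl
    simp at h1
    linarith
  refine ⟨h1, h2, h3, ?_⟩
  have hn : 0 < ‖z‖ ^ 2 := by positivity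
  have h4 : ((q0 : ℂ) ^ 2 / z).im = q0 ^ 2 * (-z).im / ‖z‖ ^ 2 := by
    rw [← Complex.normSq_eq_norm_sq, Complex.div_im]
    have : ((q0 : ℂ) ^ 2).im = 0 := by rw [← Complex.ofReal_pow, Complex.ofReal_im]
    have h' : ((q0 : ℂ) ^ 2).re = q0 ^ 2 := by rw [← Complex.ofReal_pow, Complex.ofReal_re]
    rw [this, h', Complex.neg_im]; ring
  rw [h4, le_div_iff₀ hn]
  have h5 : ‖z‖ ^ 2 ≤ (2 * q0) ^ 2 := pow_le_pow_left₀ (norm_nonneg _) h2 2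
  have h6 : q0 ^ 2 * (q0 / 2) ≤ q0 ^ 2 * (-z).im := by gcongr
  nlinarith

/-- The kernel bound, hence the constant in the weight, is uniform on the punctured ball although
the spectral projections blow up at its centre. -/
theorem exists_norm_colSol_one_le (hq0 : 0 < q0) (hv : ‖v‖ = q0) {q : ℝ → C2}
    (hq : ∀ a, IntegrableOn (fun x => q x - v) (Iic a)) :
    ∃ B, ∀ z ∈ Metric.ball (-(Complex.I * (q0 : ℂ))) (q0 / 2) \ {-(Complex.I * (q0 : ℂ))},
      ‖colSol q0 q v 1 z 0‖ ≤ B := by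
  set p : ℂ := -(Complex.I * (q0 : ℂ)) with hp
  have hcpt : IsCompact (Metric.closedBall p (q0 / 2)) := isCompact_closedBall _ _
  have hsub : Metric.closedBall p (q0 / 2) ⊆ {z | z ≠ 0} := by
    rintro z hz rfl
    rw [Metric.mem_closedBall, dist_zero_left, hp, norm_neg, norm_I_mul hq0] at hz
    linarith
  obtain ⟨C1, hC1⟩ := hcpt.exists_bound_of_continuousOn ((continuousOn_specNum q0 v 1).mono hsub)
  obtain ⟨C2, hC2⟩ := hcpt.exists_bound_of_continuousOn ((continuousOn_specNum q0 v 2).mono hsub)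
  have hYc : ContinuousOn (fun z => fun i => matY q0 v z i 1) (Metric.closedBall p (q0 / 2)) :=
    continuousOn_pi.2 fun i => ((differentiableOn_matY q0 v i 1).mono hsub).continuousOn
  obtain ⟨M, hM⟩ := hcpt.exists_bound_of_continuousOn hYc
  have hpm : p ∈ Metric.closedBall p (q0 / 2) := Metric.mem_closedBall_self (by positivity)
  have hC10 : 0 ≤ C1 := (norm_nonneg _).trans (hC1 p hpm)
  have hC20 : 0 ≤ C2 := (norm_nonneg _).trans (hC2 p hpm)
  set C := 1 + 2 * C1 + (2 * q0) / (q0 / 8) * C2 with hC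
  have hC0 : 0 ≤ C := by positivity
  refine ⟨2 * M * voltWeight (potCLM q v) C 0, fun z hz => ?_⟩
  obtain ⟨h1, h2, h3, h4⟩ := branch_ball hq0 hz.1
  have hzc : z ∈ Metric.closedBall p (q0 / 2) := Metric.ball_subset_closedBall hz.1
  have hreg : z ∈ regularSet q0 := by
    refine mem_regularSet h3 hz.2 ?_
    rintro rfl
    simp at h1
    linarith
  have hK : ∀ s, 0 ≤ s → ‖colKernel q0 v 1 z s‖ ≤ C := fun s hs => by
    refine (norm_colKernel_one_le hq0 hv hreg (c := q0 / 8) (by positivity) (by linarith) h4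
      hs).trans ?_
    have := hC1 z hzc
    have := hC2 z hzc
    rw [hC]
    gcongr
  refine (norm_voltSol_le (fun a => integrableOn_potCLM (hq a)) hC0 hK _ 0).trans ?_
  have := one_le_voltWeight (W := potCLM q v) hC0 0
  have := hM z hzc
  gcongr

/-- Riemann's theorem on removable singularities: `scatFun` is bounded near `-i q₀`, so changing its
value at that single point makes it holomorphic. -/
theorem exists_analytic_scatFun (hq0 : 0 < q0) {q : ℝ → C2} {qm qp : C2} (hqm : ‖qm‖ = q0)
    (hqp : ‖qp‖ = q0) (hm : ∀ a, IntegrableOn (fun x => q x - qm) (Iic a))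
    (hp : ∀ a, IntegrableOn (fun x => q (-x) - qp) (Iic a)) (j : Fin 3) :
    ∃ f : ℂ → ℂ, DifferentiableOn ℂ f (sDomain q0 j) ∧
      ∀ z, z ≠ -(Complex.I * q0) → f z = scatFun q0 q qm qp j z := by
  set p : ℂ := -(Complex.I * (q0 : ℂ)) with hpdef
  have hdiff : DifferentiableOn ℂ (scatFun q0 q qm qp j) (sDomain q0 j \ {p}) :=
    differentiableOn_scatFun hq0.ne' hqm hqp hm hp j
      ((isOpen_sDomain q0 j).sdiff isClosed_singleton)
      (fun z hz => sDomain_subset_boundedSet hq0 j hz.1)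
      fun z hz => mem_regularSet_of_mem_sDomain hq0 hz.1 hz.2
  by_cases hpj : p ∈ sDomain q0 j
  · have hj : j = 1 := by
      have him : p.im < 0 := by simp [hpdef, hq0]
      fin_cases j
      · exact absurd (show 0 < p.im from hpj.1) (by linarith)
      · rfl
      · exact absurd (show 0 < p.im from hpj.1) (by linarith)
    subst hj
    have hball : Metric.ball p (q0 / 2) ⊆ sDomain q0 1 := fun z hz => by
      have := (branch_ball hq0 hz).1
      show z.im < 0
      rw [Complex.neg_im] at this
      linarith
    obtain ⟨Bm, hBm⟩ := exists_norm_colSol_one_le hq0 hqm hm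
    obtain ⟨Bp, hBp⟩ := exists_norm_colSol_one_le hq0 hqp hp
    -- The branch point is fixed by `z ↦ -z̄`, so the punctured ball is mapped to itself and the
    -- column from `+∞` is bounded by the same lemma.
    have hfix : -conj p = p := by simp [hpdef]
    have hbdd : BddAbove (norm ∘ scatFun q0 q qm qp 1 '' (Metric.ball p (q0 / 2) \ {p})) := by
      refine ⟨∑ i : Fin 3, Bp * Bm, ?_⟩
      rintro _ ⟨z, hz, rfl⟩
      have hz' : -conj z ∈ Metric.ball p (q0 / 2) \ {p} := by
        refine ⟨?_, fun h => hz.2 ?_⟩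
        · have h1 := hz.1
          rw [Metric.mem_ball] at h1 ⊢
          nth_rw 1 [← hfix]
          rwa [dist_neg_neg, Complex.dist_conj_conj]
        · rw [mem_singleton_iff] at h ⊢
          rw [← hfix, ← h]
          simp
      have hn : normY q0 z 1 = 1 := rfl
      have hs : ∀ i, ‖sgnJ i‖ = 1 := fun i => by fin_cases i <;> simp [sgnJ]
      simp only [Function.comp, scatFun, hn, inv_one, one_mul]
      refine norm_sum_le_of_le _ fun i _ => ?_
      rw [norm_mul, RCLike.norm_conj, colPlus, norm_mul, norm_mul, hs, hs, one_mul, one_mul]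
      have h1 := (norm_le_pi_norm _ i).trans (hBm z hz)
      have h2 := (norm_le_pi_norm _ i).trans (hBp _ hz')
      exact mul_le_mul h2 h1 (norm_nonneg _) ((norm_nonneg _).trans h2)
    have hupd := Complex.differentiableOn_update_limUnder_of_bddAbove
      (Metric.ball_mem_nhds p (half_pos hq0)) (hdiff.mono fun z hz => ⟨hball hz.1, hz.2⟩) hbdd
    refine ⟨Function.update (scatFun q0 q qm qp 1) p
      (limUnder (𝓝[≠] p) (scatFun q0 q qm qp 1)), fun z hz => ?_,
      fun z hz => Function.update_of_ne hz _ _⟩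
    refine DifferentiableAt.differentiableWithinAt ?_
    by_cases hzp : z = p
    · rw [hzp]
      exact hupd.differentiableAt (Metric.ball_mem_nhds p (half_pos hq0))
    · have hnhds : sDomain q0 1 \ {p} ∈ 𝓝 z :=
        ((isOpen_sDomain q0 1).sdiff isClosed_singleton).mem_nhds ⟨hz, hzp⟩
      refine (hdiff.differentiableAt hnhds).congr_of_eventuallyEq ?_
      filter_upwards [hnhds] with w hw
      exact Function.update_of_ne hw.2 _ _
  · exact ⟨_, hdiff.mono fun z hz => ⟨hz, fun h => hpj (h ▸ hz)⟩, fun z _ => rfl⟩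

end BranchPoint

/-! ### The involution `z ↦ -q₀²/z` -/

section Symmetry

variable {q0 : ℝ} {v : C2} {z : ℂ}

/-- The factors relating the columns of `Y` at `-q0² / z` to those at `z`. -/
def invFactor (q0 : ℝ) (z : ℂ) : Fin 3 → ℂ :=
  ![Complex.I * z / (q0 : ℂ), 1, Complex.I * z / (q0 : ℂ)]

theorem matY_inv (hq0 : q0 ≠ 0) (hz : z ≠ 0) (i j : Fin 3) :
    matY q0 v (-(q0 : ℂ) ^ 2 / z) i (Equiv.swap 0 2 j) = invFactor q0 z j * matY q0 v z i j := by
  have hq : (q0 : ℂ) ≠ 0 := Complex.ofReal_ne_zero.2 hq0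
  have hI := Complex.I_sq
  fin_cases i <;> fin_cases j <;>
    simp [matY, invFactor, Equiv.swap_apply_of_ne_of_ne] <;> field_simp <;> grind

theorem adjY_inv (hq0 : q0 ≠ 0) (hz : z ≠ 0) (i j : Fin 3) :
    adjY q0 v (-(q0 : ℂ) ^ 2 / z) (Equiv.swap 0 2 i) j = -invFactor q0 z i *
      (if i = 1 then -1 else 1) * adjY q0 v z i j := by
  have hq : (q0 : ℂ) ≠ 0 := Complex.ofReal_ne_zero.2 hq0
  have hI := Complex.I_sq
  fin_cases i <;> fin_cases j <;>
    simp [adjY, invFactor, Equiv.swap_apply_of_ne_of_ne] <;> field_simp <;> grind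

theorem normY_inv (hq0 : q0 ≠ 0) (hz : z ≠ 0) (j : Fin 3) :
    normY q0 (-(q0 : ℂ) ^ 2 / z) (Equiv.swap 0 2 j) = -invFactor q0 z j ^ 2 *
      (if j = 1 then -1 else 1) * normY q0 z j := by
  have hq : (q0 : ℂ) ≠ 0 := Complex.ofReal_ne_zero.2 hq0
  have hI := Complex.I_sq
  fin_cases j <;>
    simp [normY, invFactor, Equiv.swap_apply_of_ne_of_ne] <;> field_simp <;> grind

theorem invFactor_ne_zero (hq0 : q0 ≠ 0) (hz : z ≠ 0) (j : Fin 3) : invFactor q0 z j ≠ 0 := by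
  have hq : (q0 : ℂ) ≠ 0 := Complex.ofReal_ne_zero.2 hq0
  fin_cases j <;> simp [invFactor, hq, hz]

theorem inv_mem_regularSet (hq0 : q0 ≠ 0) (hz : z ∈ regularSet q0) :
    -(q0 : ℂ) ^ 2 / z ∈ regularSet q0 := by
  have hq : (q0 : ℂ) ≠ 0 := Complex.ofReal_ne_zero.2 hq0
  have h0 := hz.1
  refine ⟨by simp [hq, h0], ?_⟩
  have : (-(q0 : ℂ) ^ 2 / z) ^ 2 + (q0 : ℂ) ^ 2 = (q0 : ℂ) ^ 2 / z ^ 2 * (z ^ 2 + (q0 : ℂ) ^ 2) := by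
    field_simp; ring
  rw [this]
  exact mul_ne_zero (by simp [hq, h0]) hz.2

theorem inv_mem_boundedSet (hq0 : q0 ≠ 0) {j : Fin 3} (hz : z ∈ boundedSet q0 j) :
    -(q0 : ℂ) ^ 2 / z ∈ boundedSet q0 (Equiv.swap 0 2 j) := by
  have hq : (q0 : ℂ) ≠ 0 := Complex.ofReal_ne_zero.2 hq0
  refine ⟨by simp [hq, hz.1], fun l => ?_⟩
  rw [Lam1_inv hq0 hz.1, Lam1_inv hq0 hz.1, Equiv.swap_apply_self]
  exact hz.2 _

/-- The involution permutes the eigenvectors up to scalars, and a spectral projection does not see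
the scaling. -/
theorem specProj_inv (hq0 : q0 ≠ 0) (hv : ‖v‖ = q0) (hz : z ∈ regularSet q0) (l : Fin 3) :
    specProj q0 v (Equiv.swap 0 2 l) (-(q0 : ℂ) ^ 2 / z) = specProj q0 v l z := by
  have hk := invFactor_ne_zero hq0 hz.1 l
  rw [specProj, specProj]
  congr 1
  ext i j
  rw [Matrix.of_apply, Matrix.of_apply, matY_inv hq0 hz.1,
    inv_matY_apply hq0 hv (inv_mem_regularSet hq0 hz), inv_matY_apply hq0 hv hz,
    normY_inv hq0 hz.1, adjY_inv hq0 hz.1]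
  split_ifs <;> field_simp

theorem colKernel_inv (hq0 : q0 ≠ 0) (hv : ‖v‖ = q0) (hz : z ∈ regularSet q0) (j : Fin 3) :
    colKernel q0 v (Equiv.swap 0 2 j) (-(q0 : ℂ) ^ 2 / z) = colKernel q0 v j z := by
  funext s
  rw [colKernel, colKernel, ← Equiv.sum_comp (Equiv.swap (0 : Fin 3) 2)]
  refine Finset.sum_congr rfl fun l _ => ?_
  rw [specProj_inv hq0 hv hz, Lam1_inv hq0 hz.1, Lam1_inv hq0 hz.1, Equiv.swap_apply_self,
    Equiv.swap_apply_self]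

/-- The kernels coincide and the initial vectors are proportional; the Neumann series is homogeneous
in its initial vector. -/
theorem colSol_inv (hq0 : q0 ≠ 0) (hv : ‖v‖ = q0) (q : ℝ → C2) (hz : z ∈ regularSet q0)
    (j : Fin 3) (x : ℝ) :
    colSol q0 q v (Equiv.swap 0 2 j) (-(q0 : ℂ) ^ 2 / z) x =
      invFactor q0 z j • colSol q0 q v j z x := by
  rw [colSol, colSol, colKernel_inv hq0 hv hz, ← voltSol_smul]
  congr 1
  funext i
  exact matY_inv hq0 hz.1 i j

/-- The scalar factors of the two columns multiply to the factor of `normY`, signs of `J` included,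
so everything cancels. -/
theorem scatFun_inv (hq0 : q0 ≠ 0) {qm qp : C2} (hqm : ‖qm‖ = q0) (hqp : ‖qp‖ = q0) (q : ℝ → C2)
    (hz : z ∈ regularSet q0) (j : Fin 3) :
    scatFun q0 q qm qp (Equiv.swap 0 2 j) (-(q0 : ℂ) ^ 2 / z) = scatFun q0 q qm qp j z := by
  have hk := invFactor_ne_zero hq0 hz.1 j
  have hs : sgnJ (Equiv.swap 0 2 j) = -sgnJ j * (if j = 1 then -1 else 1) := by
    fin_cases j <;> simp [sgnJ, Equiv.swap_apply_of_ne_of_ne]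
  have hconj : -conj (-(q0 : ℂ) ^ 2 / z) = -(q0 : ℂ) ^ 2 / -conj z := by
    simp [div_neg, neg_div]
  have hc : conj (invFactor q0 (-conj z) j) = invFactor q0 z j := by
    fin_cases j <;> simp [invFactor]
  have hj : conj (sgnJ j) = sgnJ j := by fin_cases j <;> simp [sgnJ]
  have hij : conj (if j = 1 then (-1 : ℂ) else 1) = if j = 1 then (-1 : ℂ) else 1 := by
    split_ifs <;> simp
  rw [scatFun, scatFun, normY_inv hq0 hz.1, Finset.mul_sum, Finset.mul_sum]
  refine Finset.sum_congr rfl fun i _ => ?_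
  rw [colPlus, colPlus, colSol_inv hq0 hqm q hz, hconj,
    colSol_inv hq0 hqp _ (neg_conj_mem_regularSet hz), hs, Pi.smul_apply, Pi.smul_apply,
    smul_eq_mul, smul_eq_mul]
  simp only [map_mul, map_neg, hc, hj, hij]
  have hn := normY_ne_zero hz j
  split_ifs <;> field_simp

end Symmetry

/-! ### Oscillatory integrals of the potential -/

section OscillatoryBounds

open Set

variable {q0 : ℝ} {v : C2} {q : ℝ → C2}

/-- The entries of the matrix `Q` as real linear maps. -/
def matQEntry (a b : Fin 3) : C2 →L[ℝ] ℂ :=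
  LinearMap.toContinuousLinearMap
    { toFun := fun u => matQ u a b
      map_add' := fun u w => by
        fin_cases a <;> fin_cases b <;> simp [matQ] <;> ring
      map_smul' := fun c u => by
        fin_cases a <;> fin_cases b <;> simp [matQ] }

theorem integrableOn_matQ {s : Set ℝ} (hq : IntegrableOn (fun x => q x - v) s) (a b : Fin 3) :
    IntegrableOn (fun r => matQ (q r - v) a b) s :=
  (matQEntry a b).integrable_comp hq

/-- The oscillatory integrals of the entries of `Q` with frequencies of norm at least `B` are
bounded by `ρ`. -/
def OscBound (q : ℝ → C2) (v : C2) (B ρ : ℝ) : Prop :=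
  ∀ ζ : ℂ, 0 ≤ ζ.im → B ≤ ‖ζ‖ → ∀ x ≤ 0, ∀ a b, ‖oscInt (fun r => matQ (q r - v) a b) ζ x‖ ≤ ρ

theorem OscBound.nonneg {B ρ : ℝ} (h : OscBound q v B ρ) : 0 ≤ ρ :=
  -- The point `i |B|` is an admissible frequency whatever the sign of `B`.
  (norm_nonneg _).trans (h (Complex.I * (|B| : ℝ)) (by simp)
    (by rw [norm_mul, Complex.norm_I, one_mul, Complex.norm_real, Real.norm_eq_abs, abs_abs]
        exact le_abs_self B) 0 le_rfl 0 0)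

theorem OscBound.mono {B B' ρ : ℝ} (h : OscBound q v B ρ) (hB : B ≤ B') : OscBound q v B' ρ :=
  fun ζ h0 h1 => h ζ h0 (hB.trans h1)

theorem exists_oscBound_zero (hq : IntegrableOn (fun x => q x - v) (Iic 0)) :
    ∃ L, OscBound q v 0 L := by
  refine ⟨∑ a, ∑ b, ∫ r in Iic (0 : ℝ), ‖matQ (q r - v) a b‖, fun ζ h0 _ x hx a b => ?_⟩
  have hint := integrableOn_matQ hq
  have hsub : Iic x ⊆ Iic (0 : ℝ) := Iic_subset_Iic.2 hx
  have hnn : ∀ a b, 0 ≤ ∫ r in Iic (0 : ℝ), ‖matQ (q r - v) a b‖ := fun a b =>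
    integral_nonneg fun _ => norm_nonneg _
  calc ‖oscInt (fun r => matQ (q r - v) a b) ζ x‖ ≤ ∫ r in Iic x, ‖matQ (q r - v) a b‖ :=
        norm_oscInt_le ((hint a b).mono_set hsub) h0
    _ ≤ ∫ r in Iic (0 : ℝ), ‖matQ (q r - v) a b‖ :=
        setIntegral_mono_set (hint a b).norm (Eventually.of_forall fun _ => norm_nonneg _)
          hsub.eventuallyLE
    _ ≤ ∑ b, ∫ r in Iic (0 : ℝ), ‖matQ (q r - v) a b‖ :=
        Finset.single_le_sum (f := fun b => ∫ r in Iic (0 : ℝ), ‖matQ (q r - v) a b‖)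
          (fun b _ => hnn a b) (Finset.mem_univ b)
    _ ≤ _ := Finset.single_le_sum
          (f := fun a => ∑ b, ∫ r in Iic (0 : ℝ), ‖matQ (q r - v) a b‖)
          (fun a _ => Finset.sum_nonneg fun b _ => hnn a b) (Finset.mem_univ a)

theorem exists_oscBound (hq : IntegrableOn (fun x => q x - v) (Iic 0)) {ε : ℝ} (hε : 0 < ε) :
    ∃ B, OscBound q v B ε := by
  choose B hB using fun a b => exists_norm_oscInt_le (integrableOn_matQ hq a b) hε
  obtain ⟨M, hM⟩ := (Set.finite_range fun p : Fin 3 × Fin 3 => B p.1 p.2).bddAbove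
  exact ⟨M, fun ζ h0 h1 x hx a b => hB a b ζ h0 ((hM ⟨(a, b), rfl⟩).trans h1) x hx⟩

theorem exists_oscBound_of_deriv (hq : IntegrableOn (fun x => q x - v) (Iic 0)) {q' : ℝ → C2}
    (hd : ∀ x, HasDerivAt q (q' x) x) (hq' : IntegrableOn q' (Iic 0)) :
    ∃ L, ∀ B, 0 < B → OscBound q v B (L * B⁻¹) := by
  have hint : ∀ a b, IntegrableOn (fun r => matQEntry a b (q' r)) (Iic 0) := fun a b =>
    (matQEntry a b).integrable_comp hq'
  obtain ⟨M, hM⟩ := (Set.finite_range fun p : Fin 3 × Fin 3 =>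
    ∫ r in Iic (0 : ℝ), ‖matQEntry p.1 p.2 (q' r)‖).bddAbove
  refine ⟨2 * M, fun B hB ζ h0 h1 x hx a b => ?_⟩
  have hζ : ζ ≠ 0 := by
    rintro rfl
    rw [norm_zero] at h1
    linarith
  have hM1 : ∫ r in Iic (0 : ℝ), ‖matQEntry a b (q' r)‖ ≤ M := hM ⟨(a, b), rfl⟩
  have hM0 : 0 ≤ M := (integral_nonneg fun _ => norm_nonneg _).trans hM1
  refine (norm_oscInt_le_of_hasDerivAt (f' := fun r => matQEntry a b (q' r)) (fun y => ?_)
    (hint a b) (integrableOn_matQ hq a b) h0 hζ hx).trans ?_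
  · exact (matQEntry a b).hasFDerivAt.comp_hasDerivAt y ((hd y).sub_const v)
  · rw [div_eq_mul_inv]
    gcongr

end OscillatoryBounds

/-! ### Eigenvectors and frequencies as `z → ∞` -/

section LargeParameter

variable {q0 : ℝ} {v : C2}

theorem exists_forall_eventually_norm_le {ι α : Type*} [Finite ι] {l : Filter α} {f g : ι → α → ℂ}
    (h : ∀ i, f i =O[l] g i) : ∃ C, 0 ≤ C ∧ ∀ᶠ z in l, ∀ i, ‖f i z‖ ≤ C * ‖g i z‖ := by
  choose c hc using fun i => (h i).bound
  obtain ⟨M, hM⟩ := (Set.finite_range c).bddAbove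
  refine ⟨max M 0, le_max_right _ _, ?_⟩
  filter_upwards [eventually_all.2 hc] with z hz i
  exact (hz i).trans (mul_le_mul_of_nonneg_right ((hM ⟨i, rfl⟩).trans (le_max_left _ _))
    (norm_nonneg _))

theorem eventually_le_norm (R : ℝ) : ∀ᶠ z : ℂ in Bornology.cobounded ℂ, R ≤ ‖z‖ :=
  tendsto_norm_cobounded_atTop.eventually (eventually_ge_atTop R)

theorem tendsto_inv_cobounded_zero :
    Tendsto (fun z : ℂ => z⁻¹) (Bornology.cobounded ℂ) (𝓝 0) :=
  tendsto_inv₀_cobounded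

/-- The size of the entries of `Y` and `Y⁻¹`: the entries mixing the first component with the
others are small. -/
def blockGauge (i j : Fin 3) (z : ℂ) : ℂ := if (i = 0 ↔ j = 0) then 1 else z⁻¹

theorem const_isBigO_one (c : ℂ) (l : Filter ℂ) :
    (fun _ => c) =O[l] fun _ => (1 : ℂ) := isBigO_const_const c one_ne_zero l

theorem const_div_isBigO_inv (c : ℂ) (l : Filter ℂ) : (fun z => c / z) =O[l] fun z => z⁻¹ := by
  simpa only [div_eq_mul_inv] using! (isBigO_refl (fun z : ℂ => z⁻¹) l).const_mul_left c

theorem matY_isBigO (q0 : ℝ) (v : C2) (l : Filter ℂ) (i j : Fin 3) :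
    (fun z => matY q0 v z i j) =O[l] blockGauge i j := by
  have h1 : ∀ c d : ℂ, (fun z : ℂ => c / z * d) =O[l] fun z => z⁻¹ := fun c d => by
    simpa only [div_mul_eq_mul_div] using! const_div_isBigO_inv (c * d) l
  have h2 := fun c => const_div_isBigO_inv c l
  have h3 := fun c => const_isBigO_one c l
  unfold blockGauge
  fin_cases i <;> fin_cases j <;> simp [matY, h1, h2, h3, isBigO_zero, -isBigO_one_iff]

theorem adjY_isBigO (q0 : ℝ) (v : C2) (l : Filter ℂ) (i j : Fin 3) :
    (fun z => adjY q0 v z i j) =O[l] blockGauge i j := by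
  have h1 : ∀ c d : ℂ, (fun z : ℂ => c / z * d) =O[l] fun z => z⁻¹ := fun c d => by
    simpa only [div_mul_eq_mul_div] using! const_div_isBigO_inv (c * d) l
  have h2 := fun c => const_div_isBigO_inv c l
  have h3 := fun c => const_isBigO_one c l
  unfold blockGauge
  fin_cases i <;> fin_cases j <;> simp [adjY, h1, h2, h3, isBigO_zero, -isBigO_one_iff]

/-- The limit of `Y (z)` as `z → ∞`. -/
def matYInf (q0 : ℝ) (v : C2) : Mat3 :=
  !![1, 0, 0;
     0, conj (v 1) / (q0 : ℂ), v 0 / (q0 : ℂ);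
     0, -conj (v 0) / (q0 : ℂ), v 1 / (q0 : ℂ)]

theorem matY_sub_matYInf_isBigO (q0 : ℝ) (v : C2) (l : Filter ℂ) (i j : Fin 3) :
    (fun z => matY q0 v z i j - matYInf q0 v i j) =O[l] fun z => z⁻¹ := by
  have h1 : ∀ c d : ℂ, (fun z : ℂ => c / z * d) =O[l] fun z => z⁻¹ := fun c d => by
    simpa only [div_mul_eq_mul_div] using! const_div_isBigO_inv (c * d) l
  have h2 := fun c => const_div_isBigO_inv c l
  have h3 : (fun _ => (0 : ℂ)) =O[l] fun z : ℂ => z⁻¹ := isBigO_zero _ _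
  fin_cases i <;> fin_cases j <;> simp [matY, matYInf, h1, h2, h3]

theorem inv_isBigO_one : (fun z : ℂ => z⁻¹) =O[Bornology.cobounded ℂ] fun _ => (1 : ℂ) :=
  tendsto_inv_cobounded_zero.isBigO_one ℂ

theorem normY_sub_one_isBigO (q0 : ℝ) (j : Fin 3) :
    (fun z => normY q0 z j - 1) =O[Bornology.cobounded ℂ] fun z => z⁻¹ := by
  have h : (fun z : ℂ => (q0 : ℂ) ^ 2 / z ^ 2) =O[Bornology.cobounded ℂ] fun z => z⁻¹ := by
    have := (const_div_isBigO_inv ((q0 : ℂ) ^ 2) (Bornology.cobounded ℂ)).mul inv_isBigO_one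
    refine this.congr (fun z => ?_) fun z => mul_one _
    rw [div_eq_mul_inv, div_eq_mul_inv]; ring
  have h3 : (fun _ => (0 : ℂ)) =O[Bornology.cobounded ℂ] fun z : ℂ => z⁻¹ := isBigO_zero _ _
  fin_cases j <;> simp [normY, h, h3]

theorem tendsto_normY (q0 : ℝ) (j : Fin 3) :
    Tendsto (fun z => normY q0 z j) (Bornology.cobounded ℂ) (𝓝 1) :=
  tendsto_sub_nhds_zero_iff.1 ((normY_sub_one_isBigO q0 j).trans_tendsto tendsto_inv_cobounded_zero)

theorem inv_normY_sub_one_isBigO (q0 : ℝ) (j : Fin 3) :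
    (fun z => (normY q0 z j)⁻¹ - 1) =O[Bornology.cobounded ℂ] fun z => z⁻¹ := by
  have h1 : (fun z => (normY q0 z j)⁻¹) =O[Bornology.cobounded ℂ] fun _ => (1 : ℂ) :=
    ((tendsto_normY q0 j).inv₀ one_ne_zero).isBigO_one ℂ
  refine (h1.mul (normY_sub_one_isBigO q0 j).neg_left).congr' ?_
    (Eventually.of_forall fun z => one_mul _)
  filter_upwards [(tendsto_normY q0 j).eventually_ne one_ne_zero] with z hz
  field_simp
  ring

theorem eventually_mem_regularSet (q0 : ℝ) :
    ∀ᶠ z in Bornology.cobounded ℂ, z ∈ regularSet q0 := by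
  filter_upwards [eventually_le_norm (|q0| + 1)] with z hz
  have hz0 : z ≠ 0 := by
    rintro rfl
    rw [norm_zero] at hz
    linarith [abs_nonneg q0]
  refine ⟨hz0, fun h => ?_⟩
  have h1 : ‖z‖ ^ 2 = |q0| ^ 2 := by
    rw [← norm_pow, eq_neg_of_add_eq_zero_left h, norm_neg, norm_pow, Complex.norm_real,
      Real.norm_eq_abs]
  nlinarith [abs_nonneg q0]

theorem inv_matY_isBigO (hq0 : q0 ≠ 0) (hv : ‖v‖ = q0) (i j : Fin 3) :
    (fun z => (matY q0 v z)⁻¹ i j) =O[Bornology.cobounded ℂ] blockGauge i j := by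
  have h1 : (fun z => (normY q0 z i)⁻¹) =O[Bornology.cobounded ℂ] fun _ => (1 : ℂ) :=
    ((tendsto_normY q0 i).inv₀ one_ne_zero).isBigO_one ℂ
  refine (h1.mul (adjY_isBigO q0 v _ i j)).congr' ?_ (Eventually.of_forall fun z => one_mul _)
  filter_upwards [eventually_mem_regularSet q0] with z hz
  exact (inv_matY_apply hq0 hv hz i j).symm

/-- For indices in different blocks of the splitting `{0}`, `{1, 2}` the difference is, up to sign,
`z` or `z + q₀²/z`. Within a block it is `0` or `±q₀²/z`, so no oscillation can be used there. -/
theorem eventually_le_norm_Lam1_sub (q0 : ℝ) : ∀ᶠ z in Bornology.cobounded ℂ, ∀ l j : Fin 3,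
    ¬(l = 0 ↔ j = 0) → ‖z‖ / 2 ≤ ‖Lam1 q0 z l - Lam1 q0 z j‖ := by
  filter_upwards [eventually_le_norm (2 * |q0| + 1)] with z hz
  have hzp : 0 < ‖z‖ := by linarith [abs_nonneg q0]
  have hz0 : z ≠ 0 := norm_pos_iff.1 hzp
  have hsmall : ‖(q0 : ℂ) ^ 2 / z‖ ≤ ‖z‖ / 2 := by
    rw [norm_div, norm_pow, Complex.norm_real, Real.norm_eq_abs, div_le_iff₀ hzp]
    nlinarith [abs_nonneg q0]
  have h1 : Lam1 q0 z 1 - Lam1 q0 z 0 = z := by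
    simp only [Lam1, Matrix.cons_val]
    linear_combination kz_add_lam q0 z
  have h2 : Lam1 q0 z 2 - Lam1 q0 z 0 = z - -((q0 : ℂ) ^ 2 / z) := by
    simp only [Lam1, Matrix.cons_val, lam]
    ring
  have k1 : ‖z‖ / 2 ≤ ‖Lam1 q0 z 1 - Lam1 q0 z 0‖ := by
    rw [h1]; linarith
  have k2 : ‖z‖ / 2 ≤ ‖Lam1 q0 z 2 - Lam1 q0 z 0‖ := by
    rw [h2]
    have := norm_sub_norm_le z (-((q0 : ℂ) ^ 2 / z))
    rw [norm_neg] at this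
    linarith
  have key : ∀ l : Fin 3, l ≠ 0 → ‖z‖ / 2 ≤ ‖Lam1 q0 z l - Lam1 q0 z 0‖ := fun l hl => by
    fin_cases l
    · exact absurd rfl hl
    · exact k1
    · exact k2
  intro l j hlj
  by_cases hl : l = 0
  · subst hl
    rw [norm_sub_rev]
    exact key j fun h => hlj (by simp [h])
  · by_cases hj : j = 0
    · subst hj
      exact key l hl
    · exact absurd (by simp [hl, hj]) hlj

theorem matQ_apply_eq_zero (u : C2) {a b : Fin 3} (h : a = 0 ↔ b = 0) : matQ u a b = 0 := by
  fin_cases a <;> fin_cases b <;> simp_all [matQ]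

end LargeParameter

/-! ### Columns as `z → ∞` -/

section ColumnAsymptotics

open Set

variable {q0 : ℝ} {v : C2} {q : ℝ → C2} {z : ℂ}

theorem colKernel_apply (j : Fin 3) (s : ℝ) (u : Fin 3 → ℂ) (i : Fin 3) :
    colKernel q0 v j z s u i = ∑ l, ∑ a, Complex.exp (Complex.I * (s : ℂ) *
      (Lam1 q0 z l - Lam1 q0 z j)) * (matY q0 v z i l * (matY q0 v z)⁻¹ l a * u a) := by
  simp only [colKernel, sum_apply, Finset.sum_apply,
    smul_apply, Pi.smul_apply, specProj, matCLM_apply, smul_eq_mul,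
    Matrix.mulVec, dotProduct, Matrix.of_apply, Finset.mul_sum]

/-- On a constant vector the Volterra operator is a finite sum of oscillatory integrals of entries
of `Q`, to which the Riemann-Lebesgue bounds apply. -/
theorem voltOp_colKernel_const (hq : IntegrableOn (fun x => q x - v) (Iic 0)) (j : Fin 3)
    (hz : z ∈ boundedSet q0 j) {x : ℝ} (hx : x ≤ 0) (y : Fin 3 → ℂ)
    (hint : IntegrableOn (fun r => colKernel q0 v j z (x - r) (potCLM q v r y)) (Iic x))
    (i : Fin 3) :
    voltOp (colKernel q0 v j z) (potCLM q v) (fun _ => y) x i =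
      ∑ l, ∑ a, ∑ b, matY q0 v z i l * (matY q0 v z)⁻¹ l a * y b *
        oscInt (fun r => matQ (q r - v) a b) (Lam1 q0 z l - Lam1 q0 z j) x := by
  have h1 : voltOp (colKernel q0 v j z) (potCLM q v) (fun _ => y) x i =
      ∫ r in Iic x, colKernel q0 v j z (x - r) (potCLM q v r y) i :=
    ((ContinuousLinearMap.proj (R := ℂ) (φ := fun _ : Fin 3 => ℂ) i).integral_comp_comm hint).symm
  have hI : ∀ l a b, IntegrableOn (fun r => matY q0 v z i l * (matY q0 v z)⁻¹ l a * y b *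
      (Complex.exp (Complex.I * ((x - r : ℝ) : ℂ) * (Lam1 q0 z l - Lam1 q0 z j)) *
        matQ (q r - v) a b)) (Iic x) := fun l a b =>
    (integrableOn_exp_mul ((integrableOn_matQ hq a b).mono_set (Iic_subset_Iic.2 hx))
      (hz.2 l)).const_mul _
  rw [h1]
  have h2 : ∀ r, colKernel q0 v j z (x - r) (potCLM q v r y) i = ∑ l, ∑ a, ∑ b,
      matY q0 v z i l * (matY q0 v z)⁻¹ l a * y b *
      (Complex.exp (Complex.I * ((x - r : ℝ) : ℂ) * (Lam1 q0 z l - Lam1 q0 z j)) *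
        matQ (q r - v) a b) := fun r => by
    rw [colKernel_apply]
    refine Finset.sum_congr rfl fun l _ => Finset.sum_congr rfl fun a _ => ?_
    simp only [potCLM, matCLM_apply, Matrix.mulVec, dotProduct, Finset.mul_sum]
    exact Finset.sum_congr rfl fun b _ => by ring
  simp only [h2]
  rw [integral_finsetSum _ fun l _ => integrable_finsetSum _ fun a _ =>
    integrable_finsetSum _ fun b _ => hI l a b]
  refine Finset.sum_congr rfl fun l _ => ?_
  rw [integral_finsetSum _ fun a _ => integrable_finsetSum _ fun b _ => hI l a b]
  refine Finset.sum_congr rfl fun a _ => ?_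
  rw [integral_finsetSum _ fun b _ => hI l a b]
  exact Finset.sum_congr rfl fun b _ => integral_const_mul _ _

theorem norm_specProj_le {C : ℝ} (hC : 0 ≤ C) (hY : ∀ i j, ‖matY q0 v z i j‖ ≤ C)
    (hY' : ∀ i j, ‖(matY q0 v z)⁻¹ i j‖ ≤ C) (l : Fin 3) : ‖specProj q0 v l z‖ ≤ 9 * C ^ 2 := by
  refine (norm_matCLM_le _).trans ?_
  calc _ ≤ ∑ _i : Fin 3, ∑ _j : Fin 3, C * C := by
        refine Finset.sum_le_sum fun i _ => Finset.sum_le_sum fun j _ => ?_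
        rw [Matrix.of_apply, norm_mul]
        exact mul_le_mul (hY i l) (hY' l j) (norm_nonneg _) hC
    _ = 9 * C ^ 2 := by
        simp only [Finset.sum_const, Finset.card_univ, Fintype.card_fin, nsmul_eq_mul]
        push_cast
        ring

/-- The difference `d` between the column and its initial vector `y` satisfies `d - V d = V y`, with
`V` the Volterra operator. It is thus enough to bound the first iterate `V y`, and the higher ones
never have to be estimated. The bound `ρ` is left free so that the same lemma serves both for the
limit and for the rate. -/
theorem exists_norm_colSol_sub_le (hq0 : q0 ≠ 0) (hv : ‖v‖ = q0)
    (hq : ∀ a, IntegrableOn (fun x => q x - v) (Iic a)) (j : Fin 3) :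
    ∃ C, 0 ≤ C ∧ ∀ᶠ z in Bornology.cobounded ℂ, z ∈ boundedSet q0 j →
      ∀ ρ, OscBound q v (‖z‖ / 2) ρ →
        ‖colSol q0 q v j z 0 - fun i => matYInf q0 v i j‖ ≤ C * (ρ + ‖z‖⁻¹) := by
  obtain ⟨L, hL⟩ := exists_oscBound_zero (hq 0)
  have hL0 := hL.nonneg
  obtain ⟨C1, hC1, hY⟩ := exists_forall_eventually_norm_le
    fun p : Fin 3 × Fin 3 => matY_isBigO q0 v (Bornology.cobounded ℂ) p.1 p.2
  obtain ⟨C2, hC2, hY'⟩ := exists_forall_eventually_norm_le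
    fun p : Fin 3 × Fin 3 => inv_matY_isBigO hq0 hv p.1 p.2
  obtain ⟨C3, hC3, hYI⟩ := exists_forall_eventually_norm_le
    fun p : Fin 3 × Fin 3 => matY_sub_matYInf_isBigO q0 v (Bornology.cobounded ℂ) p.1 p.2
  set C := max C1 C2 with hCdef
  have hC : 0 ≤ C := hC1.trans (le_max_left _ _)
  have hW : ∀ a, IntegrableOn (potCLM q v) (Iic a) := fun a => integrableOn_potCLM (hq a)
  have hCK : 0 ≤ 27 * C ^ 2 := by positivity
  set w := voltWeight (potCLM q v) (27 * C ^ 2) 0 with hw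
  have hw1 : 1 ≤ w := one_le_voltWeight hCK 0
  -- The `2` and `w` come from inverting `1 - V` in the weighted norm, `27` counts the triples `(l,
  -- a, b)`, and `C3` measures the distance of `Y` from its limit.
  refine ⟨2 * (27 * (C ^ 3 * (1 + L))) * w + C3, by positivity, ?_⟩
  filter_upwards [hY, hY', hYI, eventually_le_norm 1, eventually_le_norm_Lam1_sub q0,
    eventually_mem_regularSet q0] with z hY hY' hYI hz1 hlam hreg hz ρ hρ
  have hρ0 := hρ.nonneg
  have hzi : 0 ≤ ‖z‖⁻¹ := inv_nonneg.2 (norm_nonneg _)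
  have hzi1 : ‖z‖⁻¹ ≤ 1 := inv_le_one_of_one_le₀ hz1
  have hg1 : ∀ i j, ‖blockGauge i j z‖ ≤ 1 := fun i j => by
    unfold blockGauge
    split_ifs
    · simp
    · rwa [norm_inv]
  have hY1 : ∀ i j, ‖matY q0 v z i j‖ ≤ C * ‖blockGauge i j z‖ := fun i j =>
    (hY (i, j)).trans (mul_le_mul_of_nonneg_right (le_max_left _ _) (norm_nonneg _))
  have hY1' : ∀ i j, ‖(matY q0 v z)⁻¹ i j‖ ≤ C * ‖blockGauge i j z‖ := fun i j =>
    (hY' (i, j)).trans (mul_le_mul_of_nonneg_right (le_max_right _ _) (norm_nonneg _))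
  have hY2 : ∀ i j, ‖matY q0 v z i j‖ ≤ C := fun i j =>
    (hY1 i j).trans (mul_le_of_le_one_right hC (hg1 i j))
  have hY2' : ∀ i j, ‖(matY q0 v z)⁻¹ i j‖ ≤ C := fun i j =>
    (hY1' i j).trans (mul_le_of_le_one_right hC (hg1 i j))
  have hK : ∀ s, 0 ≤ s → ‖colKernel q0 v j z s‖ ≤ 27 * C ^ 2 := fun s hs => by
    refine (norm_colKernel_le_sum j hz hs).trans ?_
    refine (Finset.sum_le_sum fun l _ => norm_specProj_le hC hY2 hY2' l).trans (le_of_eq ?_)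
    simp only [Finset.sum_const, Finset.card_univ, Fintype.card_fin, nsmul_eq_mul]
    push_cast
    ring
  set y : Fin 3 → ℂ := fun i => matY q0 v z i j with hy
  have hfam := isVoltFamily_colKernel hq0 hv hq j (V := {z}) (C := 27 * C ^ 2) (M := ‖y‖)
    (singleton_subset_iff.2 hreg) hCK (by rintro _ rfl; exact hK) (by rintro _ rfl; exact le_rfl)
  have hmem : z ∈ ({z} : Set ℂ) := rfl
  have hKc := hfam.continuous hmem
  have hsol : Continuous (colSol q0 q v j z) := hfam.continuous_voltSol hmem
  have hsolb : ∀ x ≤ 0, ‖colSol q0 q v j z x‖ ≤ 2 * ‖y‖ * w := fun x hx =>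
    (norm_voltSol_le hW hCK hK y x).trans
      (mul_le_mul_of_nonneg_left (voltWeight_mono hW hCK hx) (by positivity))
  set d : ℝ → Fin 3 → ℂ := fun x => colSol q0 q v j z x - y with hd
  have hdb : ∀ x ≤ 0, ‖d x‖ ≤ 2 * ‖y‖ * w + ‖y‖ := fun x hx =>
    (norm_sub_le _ _).trans (by linarith [hsolb x hx])
  have hdeq : ∀ x ≤ 0, d x - voltOp (colKernel q0 v j z) (potCLM q v) d x =
      voltOp (colKernel q0 v j z) (potCLM q v) (fun _ => y) x := fun x hx => by
    have h1 := hfam.voltSol_eq hmem x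
    have h2 := integrableOn_voltOp_integrand hW hCK hK hKc hsol x fun r hr => hsolb r (hr.trans hx)
    have h3 := integrableOn_voltOp_integrand hW hCK hK hKc
      (continuous_const (y := y)) x fun r _ => le_refl ‖y‖
    have h4 : voltOp (colKernel q0 v j z) (potCLM q v) d x =
        voltOp (colKernel q0 v j z) (potCLM q v) (colSol q0 q v j z) x -
        voltOp (colKernel q0 v j z) (potCLM q v) (fun _ => y) x := by
      simp only [voltOp, hd, map_sub]
      exact integral_sub h2 h3
    have h5 : colSol q0 q v j z x =
        y + voltOp (colKernel q0 v j z) (potCLM q v) (colSol q0 q v j z) x := h1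
    rw [h4]
    simp only [hd]
    nth_rw 1 [h5]
    abel
  have hterm : ∀ x ≤ 0, ∀ i l a b, ‖matY q0 v z i l * (matY q0 v z)⁻¹ l a * y b *
      oscInt (fun r => matQ (q r - v) a b) (Lam1 q0 z l - Lam1 q0 z j) x‖ ≤
      C ^ 3 * (1 + L) * (ρ + ‖z‖⁻¹) := by
    intro x hx i l a b
    rw [norm_mul, norm_mul, norm_mul]
    set o := ‖oscInt (fun r => matQ (q r - v) a b) (Lam1 q0 z l - Lam1 q0 z j) x‖ with ho
    have ho0 : 0 ≤ o := norm_nonneg _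
    have hoL : o ≤ L := hL _ (hz.2 l) (norm_nonneg _) x hx a b
    have hexp : C ^ 3 * (1 + L) * (ρ + ‖z‖⁻¹) =
        C * C * C * ρ + C * C * C * ‖z‖⁻¹ * L + (C ^ 3 * L * ρ + C ^ 3 * ‖z‖⁻¹) := by ring
    have hrest : 0 ≤ C ^ 3 * L * ρ + C ^ 3 * ‖z‖⁻¹ := by positivity
    have hA : 0 ≤ C * C * C * ρ := by positivity
    have hB : 0 ≤ C * C * C * ‖z‖⁻¹ * L := by positivity
    -- If `l` and `j` lie in different blocks, the frequency is large. Otherwise `Q a b ≠ 0` forces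
    -- `a` and `b` into different blocks, so one of the factors `Y⁻¹ l a` and `Y b j` mixes the
    -- blocks and is `O(1/z)`.
    by_cases hlj : l = 0 ↔ j = 0
    · by_cases hab : a = 0 ↔ b = 0
      · have : o = 0 := by
          simp only [ho, matQ_apply_eq_zero _ hab, oscInt, mul_zero, integral_zero, norm_zero]
        rw [this, mul_zero]
        positivity
      · have hsm : ‖(matY q0 v z)⁻¹ l a‖ * ‖y b‖ ≤ C * C * ‖z‖⁻¹ := by
          by_cases hla : l = 0 ↔ a = 0
          · have hbj : ¬(b = 0 ↔ j = 0) := by tauto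
            have h := hY1 b j
            rw [blockGauge, if_neg hbj, norm_inv] at h
            calc _ ≤ C * (C * ‖z‖⁻¹) := mul_le_mul (hY2' l a) h (norm_nonneg _) hC
              _ = _ := by ring
          · have h := hY1' l a
            rw [blockGauge, if_neg hla, norm_inv] at h
            calc _ ≤ (C * ‖z‖⁻¹) * C := mul_le_mul h (hY2 b j) (norm_nonneg _) (by positivity)
              _ = _ := by ring
        calc ‖matY q0 v z i l‖ * ‖(matY q0 v z)⁻¹ l a‖ * ‖y b‖ * o
            = ‖matY q0 v z i l‖ * (‖(matY q0 v z)⁻¹ l a‖ * ‖y b‖) * o := by ring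
          _ ≤ C * (C * C * ‖z‖⁻¹) * L := by
              gcongr
              exact hY2 i l
          _ = C * C * C * ‖z‖⁻¹ * L := by ring
          _ ≤ _ := by rw [hexp]; linarith
    · have hoρ : o ≤ ρ := hρ _ (hz.2 l) (hlam l j hlj) x hx a b
      calc ‖matY q0 v z i l‖ * ‖(matY q0 v z)⁻¹ l a‖ * ‖y b‖ * o ≤ C * C * C * ρ := by
            gcongr
            · exact hY2 i l
            · exact hY2' l a
            · exact hY2 b j
        _ ≤ _ := by rw [hexp]; linarith
  have hres : ∀ x ≤ 0, ‖d x - voltOp (colKernel q0 v j z) (potCLM q v) d x‖ ≤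
      27 * (C ^ 3 * (1 + L)) * (ρ + ‖z‖⁻¹) := fun x hx => by
    rw [hdeq x hx, pi_norm_le_iff_of_nonneg (by positivity)]
    intro i
    rw [voltOp_colKernel_const (hq 0) j hz hx y (integrableOn_voltOp_integrand hW hCK hK hKc
      (continuous_const (y := y)) x fun r _ => le_refl ‖y‖) i]
    calc _ ≤ ∑ _l : Fin 3, ∑ _a : Fin 3, ∑ _b : Fin 3, C ^ 3 * (1 + L) * (ρ + ‖z‖⁻¹) :=
          norm_sum_le_of_le _ fun l _ => norm_sum_le_of_le _ fun a _ =>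
            norm_sum_le_of_le _ fun b _ => hterm x hx i l a b
      _ = _ := by
          simp only [Finset.sum_const, Finset.card_univ, Fintype.card_fin, nsmul_eq_mul]
          push_cast
          ring
  have hd0 := norm_le_of_norm_sub_voltOp_le hW hCK hK hdb hres 0 le_rfl
  have hyI : ‖y - fun i => matYInf q0 v i j‖ ≤ C3 * ‖z‖⁻¹ := by
    rw [pi_norm_le_iff_of_nonneg (by positivity)]
    intro i
    have := hYI (i, j)
    rwa [norm_inv] at this
  calc ‖colSol q0 q v j z 0 - fun i => matYInf q0 v i j‖
      = ‖d 0 + (y - fun i => matYInf q0 v i j)‖ := by simp only [hd, sub_add_sub_cancel]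
    _ ≤ _ := norm_add_le _ _
    _ ≤ 2 * (27 * (C ^ 3 * (1 + L)) * (ρ + ‖z‖⁻¹)) * w + C3 * ‖z‖⁻¹ := add_le_add hd0 hyI
    _ ≤ 2 * (27 * (C ^ 3 * (1 + L)) * (ρ + ‖z‖⁻¹)) * w + C3 * (ρ + ‖z‖⁻¹) := by
        gcongr
        linarith
    _ = _ := by ring

end ColumnAsymptotics

/-! ### Scattering coefficients as `z → ∞` -/

section ScatteringAsymptotics

open Set

variable {q0 : ℝ} {v : C2} {q : ℝ → C2} {qm qp : C2}

theorem tendsto_colSol (hq0 : q0 ≠ 0) (hv : ‖v‖ = q0)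
    (hq : ∀ a, IntegrableOn (fun x => q x - v) (Iic a)) (j : Fin 3) :
    Tendsto (fun z => colSol q0 q v j z 0) (Bornology.cobounded ℂ ⊓ 𝓟 (boundedSet q0 j))
      (𝓝 fun i => matYInf q0 v i j) := by
  obtain ⟨C, hC, h⟩ := exists_norm_colSol_sub_le hq0 hv hq j
  rw [Metric.tendsto_nhds]
  intro ε hε
  -- Both `ρ` and `‖z‖⁻¹` are made at most this large; the `1` gives strict inequality and covers `C
  -- = 0`.
  have hδ : 0 < ε / (2 * C + 1) := by positivity
  obtain ⟨B, hB⟩ := exists_oscBound (hq 0) hδ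
  rw [eventually_inf_principal]
  filter_upwards [h, eventually_le_norm (2 * B), eventually_le_norm ((ε / (2 * C + 1))⁻¹)]
    with z hz hzB hzi hmem
  have h1 := hz hmem _ (hB.mono (by linarith))
  have h2 : ‖z‖⁻¹ ≤ ε / (2 * C + 1) := inv_le_of_inv_le₀ hδ hzi
  rw [dist_eq_norm]
  calc _ ≤ _ := h1
    _ ≤ C * (ε / (2 * C + 1) + ε / (2 * C + 1)) := by gcongr
    _ = 2 * C * ε / (2 * C + 1) := by ring
    _ < ε := by
        rw [div_lt_iff₀ (by positivity)]
        linarith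

theorem colSol_sub_isBigO (hq0 : q0 ≠ 0) (hv : ‖v‖ = q0)
    (hq : ∀ a, IntegrableOn (fun x => q x - v) (Iic a)) {q' : ℝ → C2}
    (hd : ∀ x, HasDerivAt q (q' x) x) (hq' : IntegrableOn q' (Iic 0)) (j : Fin 3) :
    (fun z => colSol q0 q v j z 0 - fun i => matYInf q0 v i j)
      =O[Bornology.cobounded ℂ ⊓ 𝓟 (boundedSet q0 j)] fun z => z⁻¹ := by
  obtain ⟨C, hC, h⟩ := exists_norm_colSol_sub_le hq0 hv hq j
  obtain ⟨L, hL⟩ := exists_oscBound_of_deriv (hq 0) hd hq'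
  refine IsBigO.of_bound (C * (2 * L + 1)) ?_
  rw [eventually_inf_principal]
  filter_upwards [h, eventually_le_norm 1] with z hz hz1 hmem
  have hz0 : 0 < ‖z‖ / 2 := by linarith
  refine (hz hmem _ (hL _ hz0)).trans (le_of_eq ?_)
  rw [norm_inv]
  field_simp

/-- The set of parameters going to infinity on which the `j`-th columns are bounded. -/
def largeFilter (q0 : ℝ) (j : Fin 3) : Filter ℂ :=
  Bornology.cobounded ℂ ⊓ 𝓟 (boundedSet q0 j)

theorem tendsto_neg_conj_largeFilter (q0 : ℝ) (j : Fin 3) :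
    Tendsto (fun z => -conj z) (largeFilter q0 j) (largeFilter q0 j) := by
  refine tendsto_inf.2 ⟨?_, ?_⟩
  · rw [← tendsto_norm_atTop_iff_cobounded]
    simp only [norm_neg, RCLike.norm_conj]
    exact tendsto_norm_cobounded_atTop.mono_left inf_le_left
  · exact tendsto_principal.2 (eventually_inf_principal.2
      (Eventually.of_forall fun z hz => neg_conj_mem_boundedSet hz))

theorem isBigO_mul_sub_mul {α : Type*} {l : Filter α} {f h g : α → ℂ} {a b : ℂ}
    (hf : (fun z => f z - a) =O[l] g) (hh : (fun z => h z - b) =O[l] g) (hhb : Tendsto h l (𝓝 b)) :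
    (fun z => f z * h z - a * b) =O[l] g := by
  have h1 : (fun z => (f z - a) * h z) =O[l] g := by
    simpa using! hf.mul (hhb.isBigO_one ℂ)
  refine (h1.add (hh.const_mul_left a)).congr_left fun z => ?_
  ring

/-- The limit of the `j`-th column normalized at `+∞`. -/
def colPlusInf (q0 : ℝ) (v : C2) (j i : Fin 3) : ℂ := sgnJ i * sgnJ j * matYInf q0 v i j

theorem tendsto_colPlus (hq0 : q0 ≠ 0) (hv : ‖v‖ = q0)
    (hq : ∀ a, IntegrableOn (fun x => q (-x) - v) (Iic a)) (j i : Fin 3) :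
    Tendsto (fun z => conj (colPlus q0 q v j z i)) (largeFilter q0 j)
      (𝓝 (conj (colPlusInf q0 v j i))) := by
  have h := (tendsto_pi_nhds.1 (tendsto_colSol hq0 hv hq j) i).comp
    (tendsto_neg_conj_largeFilter q0 j)
  exact (Complex.continuous_conj.tendsto _).comp (h.const_mul _)

theorem colPlus_sub_isBigO (hq0 : q0 ≠ 0) (hv : ‖v‖ = q0)
    (hq : ∀ a, IntegrableOn (fun x => q (-x) - v) (Iic a)) {q' : ℝ → C2}
    (hd : ∀ x, HasDerivAt (fun x => q (-x)) (q' x) x) (hq' : IntegrableOn q' (Iic 0))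
    (j i : Fin 3) :
    (fun z => conj (colPlus q0 q v j z i) - conj (colPlusInf q0 v j i))
      =O[largeFilter q0 j] fun z => z⁻¹ := by
  have h := (isBigO_pi.1 (colSol_sub_isBigO hq0 hv hq hd hq' j) i).comp_tendsto
    (tendsto_neg_conj_largeFilter q0 j)
  have h2 := h.const_mul_left (sgnJ i * sgnJ j)
  rw [← isBigO_norm_left, ← isBigO_norm_right] at h2 ⊢
  refine h2.congr (fun z => ?_) fun z => ?_
  · rw [← map_sub, RCLike.norm_conj, colPlus, colPlusInf, ← mul_sub]
    rfl
  · simp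

/-- The limiting columns are orthonormal frames built from `q±`; their products are `1` or, with
`v^⊥` reversing the order, the two inner products of `q₋` and `q₊`. -/
theorem sum_conj_colPlusInf_mul (q0 : ℝ) (qm qp : C2) (j : Fin 3) :
    ∑ i, conj (colPlusInf q0 qp j i) * matYInf q0 qm i j = sInf q0 qm qp j := by
  fin_cases j <;>
    simp [Fin.sum_univ_three, colPlusInf, matYInf, sInf, sgnJ, cMP, cPM, PiLp.inner_apply] <;>
    ring

theorem tendsto_scatFun (hq0 : q0 ≠ 0) (hqm : ‖qm‖ = q0) (hqp : ‖qp‖ = q0)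
    (hm : ∀ a, IntegrableOn (fun x => q x - qm) (Iic a))
    (hp : ∀ a, IntegrableOn (fun x => q (-x) - qp) (Iic a)) (j : Fin 3) :
    Tendsto (scatFun q0 q qm qp j) (largeFilter q0 j) (𝓝 (sInf q0 qm qp j)) := by
  have h1 : Tendsto (fun z => (normY q0 z j)⁻¹) (largeFilter q0 j) (𝓝 1) := by
    simpa using! ((tendsto_normY q0 j).inv₀ one_ne_zero).mono_left inf_le_left
  have h2 : Tendsto (fun z => ∑ i, conj (colPlus q0 q qp j z i) * colSol q0 q qm j z 0 i)
      (largeFilter q0 j) (𝓝 (∑ i, conj (colPlusInf q0 qp j i) * matYInf q0 qm i j)) :=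
    tendsto_finsetSum _ fun i _ => (tendsto_colPlus hq0 hqp hp j i).mul
      (tendsto_pi_nhds.1 (tendsto_colSol hq0 hqm hm j) i)
  rw [sum_conj_colPlusInf_mul] at h2
  simpa using! h1.mul h2

theorem scatFun_sub_isBigO (hq0 : q0 ≠ 0) (hqm : ‖qm‖ = q0) (hqp : ‖qp‖ = q0)
    (hm : ∀ a, IntegrableOn (fun x => q x - qm) (Iic a))
    (hp : ∀ a, IntegrableOn (fun x => q (-x) - qp) (Iic a)) (hd : Differentiable ℝ q)
    (hd' : Integrable (deriv q)) (j : Fin 3) :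
    (fun z => scatFun q0 q qm qp j z - sInf q0 qm qp j) =O[largeFilter q0 j] fun z => z⁻¹ := by
  have hdm : ∀ x, HasDerivAt q (deriv q x) x := fun x => (hd x).hasDerivAt
  have hdp : ∀ x, HasDerivAt (fun x => q (-x)) (-deriv q (-x)) x := fun x => by
    simpa using! (hdm (-x)).scomp x (hasDerivAt_neg x)
  have hm1 := colSol_sub_isBigO hq0 hqm hm hdm hd'.integrableOn j
  have hp1 := colPlus_sub_isBigO hq0 hqp hp hdp hd'.comp_neg.neg.integrableOn j
  have hm2 := tendsto_colSol hq0 hqm hm j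
  have hp2 := tendsto_colPlus hq0 hqp hp j
  have h2 : Tendsto (fun z => ∑ i, conj (colPlus q0 q qp j z i) * colSol q0 q qm j z 0 i)
      (largeFilter q0 j) (𝓝 (∑ i, conj (colPlusInf q0 qp j i) * matYInf q0 qm i j)) :=
    tendsto_finsetSum _ fun i _ => (hp2 i).mul (tendsto_pi_nhds.1 hm2 i)
  have h3 : (fun z => (∑ i, conj (colPlus q0 q qp j z i) * colSol q0 q qm j z 0 i) -
      ∑ i, conj (colPlusInf q0 qp j i) * matYInf q0 qm i j) =O[largeFilter q0 j] fun z => z⁻¹ := by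
    simp only [← Finset.sum_sub_distrib]
    exact IsBigO.fun_sum fun i _ => isBigO_mul_sub_mul (hp1 i) (isBigO_pi.1 hm1 i)
      (tendsto_pi_nhds.1 hm2 i)
  have h4 := isBigO_mul_sub_mul ((inv_normY_sub_one_isBigO q0 j).mono inf_le_left) h3 h2
  rw [sum_conj_colPlusInf_mul, one_mul] at h4
  exact h4

end ScatteringAsymptotics

/-! ### Continuations, limits at the origin, and complex conjugation -/

section Coefficients

open Set

variable {q0 : ℝ} {q : ℝ → C2} {qm qp : C2}

theorem sDomain_union_realAxis_subset (hq0 : 0 < q0) (j : Fin 3) :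
    sDomain q0 j ∪ realAxis ⊆ boundedSet q0 j :=
  union_subset (sDomain_subset_boundedSet hq0 j) (realAxis_subset_boundedSet q0 j)

theorem atInf_le_largeFilter (hq0 : 0 < q0) (j : Fin 3) :
    atInf (sDomain q0 j) ≤ largeFilter q0 j :=
  inf_le_inf_left _ (principal_mono.2 (sDomain_union_realAxis_subset hq0 j))

theorem eventually_atZero (hq0 : 0 < q0) (j : Fin 3) :
    ∀ᶠ z in atZero (sDomain q0 j), z ∈ boundedSet q0 j ∧ ‖z‖ < q0 := by
  refine (eventually_mem_nhdsWithin.mono fun z hz => sDomain_union_realAxis_subset hq0 j hz).and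
    (mem_nhdsWithin_of_mem_nhds ?_)
  simpa [Metric.ball, dist_zero_right] using! Metric.ball_mem_nhds (0 : ℂ) hq0

theorem mem_regularSet_of_norm_ne (hq0 : 0 < q0) {z : ℂ} (hz : z ≠ 0) (h : ‖z‖ ≠ q0) :
    z ∈ regularSet q0 := by
  refine mem_regularSet hz ?_ ?_ <;> rintro rfl
  · exact h (by rw [norm_neg, norm_I_mul hq0])
  · exact h (norm_I_mul hq0)

/-- The involution sends the approach to `0` for the index `j` to the approach to infinity for the
swapped index, so the asymptotics at infinity can be pulled back. -/
theorem tendsto_inv_atZero (hq0 : 0 < q0) (j : Fin 3) :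
    Tendsto (fun z => -(q0 : ℂ) ^ 2 / z) (atZero (sDomain q0 j))
      (largeFilter q0 (Equiv.swap 0 2 j)) := by
  have hq : (-(q0 : ℂ) ^ 2) ≠ 0 := by simp [hq0.ne']
  have hle : atZero (sDomain q0 j) ≤ 𝓝[≠] 0 :=
    nhdsWithin_mono _ fun z hz => (sDomain_union_realAxis_subset hq0 j hz).1
  refine tendsto_inf.2 ⟨?_, tendsto_principal.2 ?_⟩
  · simp only [div_eq_mul_inv]
    exact (tendsto_mul_left_cobounded hq).comp (tendsto_inv₀_nhdsNE_zero.mono_left hle)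
  · filter_upwards [eventually_atZero hq0 j] with z hz
    exact inv_mem_boundedSet hq0.ne' hz.1

theorem sInf_swap (q0 : ℝ) (qm qp : C2) (j : Fin 3) :
    sInf q0 qm qp (Equiv.swap 0 2 j) = sZero q0 qm qp j := by
  fin_cases j <;> simp [sInf, sZero, Equiv.swap_apply_of_ne_of_ne]

theorem exists_scatteringCoefficient (hq0 : 0 < q0) (hqm : ‖qm‖ = q0) (hqp : ‖qp‖ = q0)
    (hm : ∀ a, IntegrableOn (fun x => q x - qm) (Iic a))
    (hp : ∀ a, IntegrableOn (fun x => q (-x) - qp) (Iic a)) (j : Fin 3) :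
    ∃ f : ℂ → ℂ, IsAnalyticContinuation (sDomain q0 j) (scatFun q0 q qm qp j) f ∧
      Tendsto f (atInf (sDomain q0 j)) (𝓝 (sInf q0 qm qp j)) ∧
      Tendsto f (atZero (sDomain q0 j)) (𝓝 (sZero q0 qm qp j)) ∧
      (Differentiable ℝ q → Integrable (deriv q) →
        (fun z => f z - sInf q0 qm qp j) =O[atInf (sDomain q0 j)] (fun z => z⁻¹) ∧
        (fun z => f z - sZero q0 qm qp j) =O[atZero (sDomain q0 j)] fun z => z) := by
  obtain ⟨f, hf, hfe⟩ := exists_analytic_scatFun hq0 hqm hqp hm hp j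
  have hne : ∀ z : ℂ, ‖z‖ ≠ q0 → z ≠ -(Complex.I * q0) := fun z hz h => hz (by
    rw [h, norm_neg, norm_I_mul hq0])
  have hreal : ∀ z ∈ realAxis, z ≠ -(Complex.I * (q0 : ℂ)) := fun z hz h => by
    have := hz.1
    rw [h] at this
    simp at this
    exact hq0.ne' this
  -- Near infinity, as near the origin, `|z| ≠ q₀`, so the modified value at the branch point plays
  -- no role in the limits.
  have hinf : ∀ᶠ z in atInf (sDomain q0 j), scatFun q0 q qm qp j z = f z := by
    filter_upwards [(eventually_le_norm (q0 + 1)).filter_mono inf_le_left] with z hz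
    exact (hfe z (hne z (by linarith))).symm
  have hzero : ∀ᶠ z in atZero (sDomain q0 j),
      scatFun q0 q qm qp (Equiv.swap 0 2 j) (-(q0 : ℂ) ^ 2 / z) = f z := by
    filter_upwards [eventually_atZero hq0 j] with z hz
    rw [hfe z (hne z hz.2.ne), scatFun_inv hq0.ne' hqm hqp q
      (mem_regularSet_of_norm_ne hq0 hz.1.1 hz.2.ne)]
  refine ⟨f, ⟨fun z hz => hfe z (hreal z hz), hf, ?_⟩, ?_, ?_, fun hd hd' => ⟨?_, ?_⟩⟩
  · rintro z (hz | hz)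
    · exact (hf.differentiableAt ((isOpen_sDomain q0 j).mem_nhds hz)).continuousAt
        |>.continuousWithinAt
    · have hz2 := hreal z hz.2
      have hreg := realAxis_subset_regularSet hq0.ne' hz.2
      have h1 := continuousOn_scatFun hq0.ne' hqm hqp hm hp j z
        ⟨realAxis_subset_boundedSet q0 j hz.2, hreg⟩
      have h2 : ContinuousWithinAt f (boundedSet q0 j ∩ regularSet q0) z := by
        refine h1.congr_of_eventuallyEq ?_ (hfe z hz2)
        filter_upwards [mem_nhdsWithin_of_mem_nhds (isOpen_ne.mem_nhds hz2)] with w hw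
        exact hfe w hw
      refine h2.mono_of_mem_nhdsWithin ?_
      filter_upwards [self_mem_nhdsWithin,
        mem_nhdsWithin_of_mem_nhds ((isOpen_regularSet q0).mem_nhds hreg)] with w hw hwr
      exact ⟨sDomain_union_realAxis_subset hq0 j (hw.imp_right And.right), hwr⟩
  · exact ((tendsto_scatFun hq0.ne' hqm hqp hm hp j).mono_left
      (atInf_le_largeFilter hq0 j)).congr' hinf
  · rw [← sInf_swap]
    exact ((tendsto_scatFun hq0.ne' hqm hqp hm hp (Equiv.swap 0 2 j)).comp
      (tendsto_inv_atZero hq0 j)).congr' hzero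
  · refine ((scatFun_sub_isBigO hq0.ne' hqm hqp hm hp hd hd' j).mono
      (atInf_le_largeFilter hq0 j)).congr' ?_ EventuallyEq.rfl
    filter_upwards [hinf] with z hz
    rw [hz]
  · rw [← sInf_swap]
    have h := (scatFun_sub_isBigO hq0.ne' hqm hqp hm hp hd hd' (Equiv.swap 0 2 j)).comp_tendsto
      (tendsto_inv_atZero hq0 j)
    -- The inverse of `-q₀²/z` is a constant multiple of `z`, which turns `O(1/z)` at infinity into
    -- `O(z)` at the origin.
    refine (h.congr' (f₂ := fun z => f z - sInf q0 qm qp (Equiv.swap 0 2 j))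
      (g₂ := fun z => (-(q0 : ℂ) ^ 2)⁻¹ * z) ?_ ?_).trans ?_
    · filter_upwards [hzero] with z hz
      simp only [Function.comp, hz]
    · refine Eventually.of_forall fun z => ?_
      simp only [Function.comp, inv_div]
      rw [div_eq_mul_inv, mul_comm]
    · exact (isBigO_refl _ _).const_mul_left _

theorem conj_mem_sDomain_iff {j : Fin 3} {z : ℂ} : conj z ∈ sDomain q0 j ↔ z ∈ hDomain q0 j := by
  fin_cases j <;> simp [sDomain, hDomain]

theorem conj_mem_realAxis_iff {z : ℂ} : conj z ∈ realAxis ↔ z ∈ realAxis := by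
  simp [realAxis]

theorem conj_sInf (q0 : ℝ) (qm qp : C2) (j : Fin 3) :
    conj (sInf q0 qm qp j) = hInf q0 qm qp j := by
  fin_cases j <;> simp [sInf, hInf, cMP, cPM, inner_conj_symm]

theorem conj_sZero (q0 : ℝ) (qm qp : C2) (j : Fin 3) :
    conj (sZero q0 qm qp j) = hZero q0 qm qp j := by
  fin_cases j <;> simp [sZero, hZero, cMP, cPM, inner_conj_symm]

theorem tendsto_conj_atInf (q0 : ℝ) (j : Fin 3) :
    Tendsto (fun z : ℂ => conj z) (atInf (hDomain q0 j)) (atInf (sDomain q0 j)) := by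
  refine tendsto_inf.2 ⟨?_, ?_⟩
  · rw [← tendsto_norm_atTop_iff_cobounded]
    simp only [RCLike.norm_conj]
    exact tendsto_norm_cobounded_atTop.mono_left inf_le_left
  · exact tendsto_principal.2 (eventually_inf_principal.2 (Eventually.of_forall fun z hz =>
      hz.imp conj_mem_sDomain_iff.2 conj_mem_realAxis_iff.2))

theorem tendsto_conj_atZero (q0 : ℝ) (j : Fin 3) :
    Tendsto (fun z : ℂ => conj z) (atZero (hDomain q0 j)) (atZero (sDomain q0 j)) := by
  refine tendsto_inf.2 ⟨?_, ?_⟩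
  · have h : Tendsto (fun z : ℂ => conj z) (𝓝 0) (𝓝 0) := by
      simpa using Complex.continuous_conj.tendsto (0 : ℂ)
    exact h.mono_left inf_le_left
  · exact tendsto_principal.2 (eventually_inf_principal.2 (Eventually.of_forall fun z hz =>
      hz.imp conj_mem_sDomain_iff.2 conj_mem_realAxis_iff.2))

/-- Schwarz reflection carries the domains of the entries of `S` to those of `H`. -/
theorem IsAnalyticContinuation.conj_comp_conj {j : Fin 3} {g f : ℂ → ℂ}
    (h : IsAnalyticContinuation (sDomain q0 j) g f) :
    IsAnalyticContinuation (hDomain q0 j) (fun z => conj (g (conj z)))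
      fun z => conj (f (conj z)) where
  eq_real z hz := by
    show conj (f (conj z)) = conj (g (conj z))
    rw [h.eq_real (conj_mem_realAxis_iff.2 hz)]
  holo z hz := by
    have h1 := h.holo.differentiableAt
      ((isOpen_sDomain q0 j).mem_nhds (conj_mem_sDomain_iff.2 hz))
    have h2 := h1.star_star
    rw [show star (conj z) = z from Complex.conj_conj z] at h2
    exact DifferentiableAt.differentiableWithinAt h2
  cont := by
    refine Complex.continuous_conj.comp_continuousOn
      (h.cont.comp Complex.continuous_conj.continuousOn fun z hz => ?_)
    have hsub : MapsTo (fun z : ℂ => conj z) (hDomain q0 j) (sDomain q0 j) := fun z hz =>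
      conj_mem_sDomain_iff.2 hz
    exact hz.imp (fun h => hsub h) fun h =>
      ⟨hsub.closure Complex.continuous_conj h.1, conj_mem_realAxis_iff.2 h.2⟩

theorem IsAnalyticContinuation.congr {D : Set ℂ} {g g' f : ℂ → ℂ}
    (h : IsAnalyticContinuation D g f) (hg : EqOn g g' realAxis) :
    IsAnalyticContinuation D g' f :=
  ⟨h.eq_real.trans hg, h.holo, h.cont⟩

theorem isBigO_conj_comp_conj {l l' : Filter ℂ} {f g : ℂ → ℂ} {c : ℂ}
    (h : (fun z => f z - c) =O[l] g) (hl : Tendsto (fun z : ℂ => conj z) l' l)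
    (hg : ∀ z, ‖g (conj z)‖ = ‖g z‖) :
    (fun z => conj (f (conj z)) - conj c) =O[l'] g := by
  have h1 := h.comp_tendsto hl
  rw [← isBigO_norm_left, ← isBigO_norm_right] at h1 ⊢
  refine h1.congr (fun z => ?_) fun z => hg z
  rw [← map_sub, RCLike.norm_conj]
  rfl

end Coefficients

end LPD

end

/-! ### The theorem -/

theorem corollary2 (σ q0 : ℝ) (hq0 : 0 < q0) (q : ℝ → ℝ → LPD.C2) (qm qp : LPD.C2)
    (hqm : ‖qm‖ = q0) (hqp : ‖qp‖ = q0) (t : ℝ)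
    (hm : ∀ a : ℝ, IntegrableOn (fun x => q x t - qm) (Set.Iio a))
    (hp : ∀ a : ℝ, IntegrableOn (fun x => q x t - qp) (Set.Ioi a)) :
    ∃ s h : Fin 3 → ℂ → ℂ,
      LPD.IsAnalyticScatteringData σ q0 q qm qp t s h ∧
      (∀ j : Fin 3,
        Tendsto (s j) (LPD.atInf (LPD.sDomain q0 j)) (𝓝 (LPD.sInf q0 qm qp j)) ∧
        Tendsto (h j) (LPD.atInf (LPD.hDomain q0 j)) (𝓝 (LPD.hInf q0 qm qp j)) ∧
        Tendsto (s j) (LPD.atZero (LPD.sDomain q0 j)) (𝓝 (LPD.sZero q0 qm qp j)) ∧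
        Tendsto (h j) (LPD.atZero (LPD.hDomain q0 j)) (𝓝 (LPD.hZero q0 qm qp j))) ∧
      ((∀ x : ℝ, DifferentiableAt ℝ (fun y => q y t) x) →
        Integrable (deriv fun y => q y t) →
        ∀ j : Fin 3,
          (fun z => s j z - LPD.sInf q0 qm qp j) =O[LPD.atInf (LPD.sDomain q0 j)]
            (fun z => z⁻¹) ∧
          (fun z => h j z - LPD.hInf q0 qm qp j) =O[LPD.atInf (LPD.hDomain q0 j)]
            (fun z => z⁻¹) ∧
          (fun z => s j z - LPD.sZero q0 qm qp j) =O[LPD.atZero (LPD.sDomain q0 j)]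
            (fun z => z) ∧
          (fun z => h j z - LPD.hZero q0 qm qp j) =O[LPD.atZero (LPD.hDomain q0 j)]
            (fun z => z)) := by
  have hm' : ∀ a, IntegrableOn (fun x => q x t - qm) (Set.Iic a) := fun a =>
    (integrableOn_Iic_iff_integrableOn_Iio).2 (hm a)
  have hp' : ∀ a, IntegrableOn (fun x => q (-x) t - qp) (Set.Iic a) := fun a => by
    have h := (integrableOn_Ici_iff_integrableOn_Ioi).2 (hp (-a))
    have h2 := (Measure.measurePreserving_neg volume).integrableOn_comp_preimage
      (Homeomorph.neg ℝ).measurableEmbedding (f := fun x => q x t - qp) (s := Set.Ici (-a))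
    simpa [Function.comp_def] using! h2.2 h
  choose s hs hsInf hsZero hsO using
    LPD.exists_scatteringCoefficient (q := fun x => q x t) hq0 hqm hqp hm' hp'
  have hconj : ∀ c : ℂ, Tendsto (fun z : ℂ => conj z) (𝓝 c) (𝓝 (conj c)) := fun c =>
    Complex.continuous_conj.tendsto c
  -- Each `hⱼⱼ` is the reflection of `sⱼⱼ`, so its continuation, limits and rates follow by
  -- conjugation.
  refine ⟨s, fun j z => conj (s j (conj z)), ⟨fun j => ?_, fun j => ?_⟩,
    fun j => ⟨hsInf j, ?_, hsZero j, ?_⟩, fun hd hd' j => ?_⟩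
  · exact (hs j).congr fun z hz => (LPD.scatS_apply_self hq0.ne' hqm hqp hm' hp' hz j).symm
  · exact (hs j).conj_comp_conj.congr fun z hz =>
      (LPD.scatH_apply_self hq0.ne' hqm hqp hm' hp' hz j).symm
  · rw [← LPD.conj_sInf]
    exact (hconj _).comp ((hsInf j).comp (LPD.tendsto_conj_atInf q0 j))
  · rw [← LPD.conj_sZero]
    exact (hconj _).comp ((hsZero j).comp (LPD.tendsto_conj_atZero q0 j))
  · obtain ⟨h1, h2⟩ := hsO j hd hd'
    refine ⟨h1, ?_, h2, ?_⟩
    · rw [← LPD.conj_sInf]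
      exact LPD.isBigO_conj_comp_conj h1 (LPD.tendsto_conj_atInf q0 j) fun z => by
        simp
    · rw [← LPD.conj_sZero]
      exact LPD.isBigO_conj_comp_conj h2 (LPD.tendsto_conj_atZero q0 j) fun z => by
        simp
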